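/- **Setting.** Let $n\in\{2,3\}$. A *mixed-dimensional medium* consists of finitely many pairwise disjoint, bounded, connected, flat subdomains $\Omega_s\subset\mathbb R^n$, each relatively open in an affine subspace of dimension $d_s\in\{0,\dots,n\}$, and of finitely many interfaces $\Gamma_g$. An interface coincides as a set with a subdomain $\Omega_{\mathrm{lo}(g)}$, which is touched from the side opposite to a unit normal $\nu_g$ by a subdomain $\Omega_{\mathrm{hi}(g)}$ of one dimension more ($\nu_g$ is outward for $\Omega_{\mathrm{hi}(g)}$). The graph of subdomains and interfaces is connected. The outer boundary $\overline{\bigcup_s\Omega_s}\setminus\bigcup_s\Omega_s$ is the disjoint union of a Dirichlet part of positive $(n-1)$-dimensional measure and a Neumann part. Every subdomain has a conforming simplicial mesh which resolves the interfaces and the two parts of the outer boundary, and every interface has a simplicial mortar mesh; meshes need not match across interfaces. Let $V_h$ be the space of lowest-order Raviart–Thomas fields (zero on $0$-dimensional subdomains) with zero normal component on the Neumann part, $V_{0h}\subset V_h$ those with zero normal component on all interfaces, $\Lambda_h$ and $Q_h$ the piecewise constants on the mortar meshes and on the subdomain meshes, and $W_h=V_{0h}\times\Lambda_h$. Let $R_h:\Lambda_h\to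 V_h$ be a linear extension operator: on the interfaces the normal component of $R_h\mu$ is the $L^2$-projection of $\mu$ to the piecewise constants on the trace mesh, and it vanishes on the outer boundary. Let $K$ be a symmetric positive definite tensor, constant on each subdomain, $\gamma>0$ constant on each interface, and $K_\nu$ measurable on the interfaces and bounded between two positive constants. For $w=(u_0,\lambda)$, $r=(v_0,\mu)\in W_h$ and $q\in Q_h$ put $$a(w,r)=(K^{-1}(u_0+R_h\lambda),v_0+R_h\mu)_\Omega+(\gamma K_\nu^{-1}\lambda,\mu)_\Gamma,\qquad b(r,q)=-(q,\nabla\cdot(v_0+R_h\mu)+[\![\mu]\!])_\Omega,$$ where $[\![\mu]\!]$ on $\Omega_s$ is $-\sum_{\mathrm{lo}(g)=s}\mu_g$, and $$a^D(w,r)=\sum_T\sum_{f\subset\partial T}\big((u_0+R_h\lambda)|_T\cdot\nu_f\big)\big((v_0+R_h\mu)|_T\cdot\nu_f\big)(K^{-1}\phi_f,\phi_f)_T+(\gamma K_\nu^{-1}\lambda,\mu)_\Gamma,$$ where $T$ runs over the elements of positive dimension, $f$ over the facets of $T$, $\nu_f$ is the outer unit normal, and $\phi_f$ the local Raviart–Thomas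 basis function of $f$. Let $A,D_A:W_h\to W_h'$ and $B:W_h\to Q_h'$ be the operators of $a$, $a^D$, $b$, let $\mathcal A=\begin{pmatrix}A&B^T\\-B&0\end{pmatrix}$, $D_h=D_A^{-1}B^T:Q_h\to W_h$, $|||(r,q)|||^2=a(r,r)+a^D(D_hq,D_hq)$, and $$\mathcal L(w,p;r,q)=a(w,r)+a^D(D_hp,r)+a^D(D_hq,w).$$ Call $\alpha,\beta>0$ *well-posedness constants* if $|\mathcal L(x;y)|\le\alpha\,|||x|||\,|||y|||$ for all $x,y\in W_h\times Q_h$ and $\inf_{y\ne0}\sup_{x\neq0}\frac{\mathcal L(x;y)}{|||x|||\,|||y|||}\ge\beta$. **Theorem.** 1. For every such discretization $A$, $D_A$ and $BD_A^{-1}B^T$ are bijective. 2. For all $\sigma,\theta$ there are well-posedness constants $\alpha,\beta>0$, depending only on $n,\sigma,\theta$, that are common to all such discretizations whose subdomain meshes are shape regular with constant $\sigma$ (each element $T$ of positive dimension contains a ball of the affine subspace spanned by $T$, of radius $r>0$ with $\operatorname{diam}T\le\sigma r$) and for which, on each subdomain, the ratio of any two eigenvalues of $K$ on the tangent space is at most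 $\theta$ (so $\theta=1$ for scalar $K$). 3. For every such discretization let $\alpha,\beta>0$ be any well-posedness constants. Let $H_w:W_h'\to W_h$ and $H_p:Q_h'\to Q_h$ be symmetric positive definite and let $c_{1,w},c_{1,p}>0$ and $c_{2,w},c_{2,p}$ be real numbers with $$c_{1,w}\langle f,H_wf\rangle\le\langle f,A^{-1}f\rangle\le c_{2,w}\langle f,H_wf\rangle,\qquad c_{1,p}\langle g,H_pg\rangle\le\langle g,(BD_A^{-1}B^T)^{-1}g\rangle\le c_{2,p}\langle g,H_pg\rangle$$ for all $f\in W_h'$, $g\in Q_h'$. Let $\mathcal M_D=\operatorname{diag}(H_w,H_p)$, $c_2=\max\{c_{2,w},c_{2,p}\}$, $c_1=\min\{c_{1,w},c_{1,p}\}$. Then $\mathcal M_D$ and $\mathcal M_D\mathcal A$ are bijective and $$\kappa(\mathcal M_D\mathcal A)=\|\mathcal M_D\mathcal A\|\,\|(\mathcal M_D\mathcal A)^{-1}\|\le\frac{\alpha c_2}{\beta c_1},$$ both for the operator norm induced by $|||\cdot|||$ and for the one induced by $\|x\|_{\mathcal M_D^{-1}}=\langle\mathcal M_D^{-1}x,x\rangle^{1/2}$.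 -/

import Mathlib

open MeasureTheory Set Topology
open scoped ENNReal InnerProductSpace

noncomputable section

namespace MixedDim

/-! ### Simplices in `ℝⁿ` and lowest-order Raviart–Thomas fields on them -/

/-- The ambient Euclidean space `ℝⁿ`. -/
abbrev E (n : ℕ) := EuclideanSpace ℝ (Fin n)

section Simplices

variable {n d : ℕ}

/-- The relatively open simplex: all barycentric coordinates are positive. (Unlike
`Affine.Simplex.interior`, a `0`-simplex is its own relatively open simplex.) -/
def openCell (T : Affine.Simplex ℝ (E n) d) : Set (E n) := T.setInterior (Ioi 0)

/-- The relatively open facet opposite to the vertex `k`. It is empty if `d = 0`. -/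
def openFacet (T : Affine.Simplex ℝ (E n) d) (k : Fin (d + 1)) : Set (E n) :=
  {x | ∃ w : Fin (d + 1) → ℝ, ∑ i, w i = 1 ∧ w k = 0 ∧ (∀ i, i ≠ k → 0 < w i) ∧
    Finset.univ.affineCombination ℝ T.points w = x}

/-- The closed facet opposite to the vertex `k`. It is empty if `d = 0`. -/
def closedFacet (T : Affine.Simplex ℝ (E n) d) (k : Fin (d + 1)) : Set (E n) :=
  convexHull ℝ (T.points '' {k}ᶜ)

/-- The orthogonal projection of the vertex `k` to the plane of the opposite facet
(only relevant for `d ≥ 1`). -/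
def foot (T : Affine.Simplex ℝ (E n) d) (k : Fin (d + 1)) : E n :=
  if h : d ≠ 0 then haveI : NeZero d := ⟨h⟩; T.altitudeFoot k else T.points k

/-- The height of the simplex over the facet opposite to the vertex `k`. -/
def height (T : Affine.Simplex ℝ (E n) d) (k : Fin (d + 1)) : ℝ := dist (T.points k) (foot T k)

/-- The unit outward normal, in the plane of the simplex, of the facet opposite to `k`. -/
def normal (T : Affine.Simplex ℝ (E n) d) (k : Fin (d + 1)) : E n :=
  (height T k)⁻¹ • (foot T k - T.points k)

/-- A lowest-order Raviart–Thomas field on a simplex `T` is a field `x ↦ a + b (x - x₀)` with `a`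
tangent to `T`, `b ∈ ℝ`, and `x₀` the first vertex of `T`; it is stored as the pair `(a, b)`.
This is its value at the point `x`. -/
def rtEval (T : Affine.Simplex ℝ (E n) d) (v : E n × ℝ) (x : E n) : E n :=
  v.1 + v.2 • (x - T.points 0)

/-- The tangential divergence of `x ↦ a + b (x - x₀)` on a `d`-dimensional simplex is `d b`. -/
def rtDiv (d : ℕ) (v : E n × ℝ) : ℝ := d * v.2

/-- The outward normal component on the facet opposite to `k`: it is constant on the
plane of that facet, so it is evaluated at the foot of the altitude. -/
def normalTrace (T : Affine.Simplex ℝ (E n) d) (k : Fin (d + 1)) (v : E n × ℝ) : ℝ :=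
  ⟪rtEval T v (foot T k), normal T k⟫_ℝ

/-- The Raviart–Thomas basis field `x ↦ (x - x_k) / height_k` of the facet opposite to `k`: it has
outward normal component one on that facet and zero on the other facets. -/
def rtBasis (T : Affine.Simplex ℝ (E n) d) (k : Fin (d + 1)) : E n × ℝ :=
  ((height T k)⁻¹ • (T.points 0 - T.points k), (height T k)⁻¹)

/-- The `d`-dimensional volume of a set (length, area, ...; number of points for `d = 0`). -/
def vol (d : ℕ) (s : Set (E n)) : ℝ := (Measure.euclideanHausdorffMeasure d : Measure (E n)).real s

theorem measure_closedInterior_lt_top (T : Affine.Simplex ℝ (E n) d) :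
    (Measure.euclideanHausdorffMeasure d : Measure (E n)) T.closedInterior < ∞ := by
  set S := affineSpan ℝ (range T.points) with hS
  have : Nonempty S := ⟨⟨T.points 0, mem_affineSpan ℝ (mem_range_self 0)⟩⟩
  have hd : Module.finrank ℝ S.direction = d := by
    rw [hS, direction_affineSpan]
    exact T.independent.finrank_vectorSpan (by simp)
  have hsub : T.closedInterior ⊆ (S : Set (E n)) := T.closedInterior_subset_affineSpan
  have himg : ((↑) : S → E n) '' (((↑) : S → E n) ⁻¹' T.closedInterior) = T.closedInterior := by
    rw [image_preimage_eq_inter_range]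
    refine inter_eq_self_of_subset_left (fun x hx => ⟨⟨x, hsub hx⟩, rfl⟩)
  have hc : IsCompact (((↑) : S → E n) ⁻¹' T.closedInterior) := by
    refine Topology.IsInducing.subtypeVal.isCompact_iff.mpr ?_
    exact (congrArg IsCompact himg).mpr T.isCompact_closedInterior
  rw [← himg, AffineSubspace.euclideanHausdorffMeasure_coe_image]
  let p : S := Classical.arbitrary S
  have h := EuclideanGeometry.euclideanHausdorffMeasure_eq (V := S.direction) (P := S) p
  rw [hd] at h
  have hm : MeasurableEmbedding (IsometryEquiv.vaddConst p) :=
    (IsometryEquiv.vaddConst p).toHomeomorph.measurableEmbedding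
  rw [h, hm.map_apply]
  exact ((IsometryEquiv.vaddConst p).toHomeomorph.isCompact_preimage.mpr hc).measure_lt_top

theorem rtEval_continuous (T : Affine.Simplex ℝ (E n) d) (v : E n × ℝ) :
    Continuous (rtEval T v) := by
  unfold rtEval; fun_prop

theorem rtEval_add (T : Affine.Simplex ℝ (E n) d) (u v : E n × ℝ) (x : E n) :
    rtEval T (u + v) x = rtEval T u x + rtEval T v x := by
  simp only [rtEval, Prod.fst_add, Prod.snd_add, add_smul]; abel

theorem rtEval_smul (T : Affine.Simplex ℝ (E n) d) (c : ℝ) (v : E n × ℝ) (x : E n) :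
    rtEval T (c • v) x = c • rtEval T v x := by
  simp only [rtEval, Prod.smul_fst, Prod.smul_snd, smul_add, smul_smul, smul_eq_mul]

theorem normalTrace_add (T : Affine.Simplex ℝ (E n) d) (k : Fin (d + 1)) (u v : E n × ℝ) :
    normalTrace T k (u + v) = normalTrace T k u + normalTrace T k v := by
  simp only [normalTrace, rtEval_add, inner_add_left]

theorem normalTrace_smul (T : Affine.Simplex ℝ (E n) d) (k : Fin (d + 1)) (c : ℝ)
    (v : E n × ℝ) : normalTrace T k (c • v) = c * normalTrace T k v := by
  simp only [normalTrace, rtEval_smul, real_inner_smul_left]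

/-- The weighted `L²` product `∫_T (κ⁻¹ u) · v` of two Raviart–Thomas fields. -/
def cellProduct (T : Affine.Simplex ℝ (E n) d) (κ : E n ≃ₗ[ℝ] E n) (u v : E n × ℝ) : ℝ :=
  ∫ x in T.closedInterior, ⟪κ.symm (rtEval T u x), rtEval T v x⟫_ℝ
    ∂(Measure.euclideanHausdorffMeasure d)

theorem cellProduct_integrable (T : Affine.Simplex ℝ (E n) d) (κ : E n ≃ₗ[ℝ] E n)
    (u v : E n × ℝ) :
    IntegrableOn (fun x => ⟪κ.symm (rtEval T u x), rtEval T v x⟫_ℝ) T.closedInterior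
      (Measure.euclideanHausdorffMeasure d) := by
  refine ContinuousOn.integrableOn_of_subset_isCompact (K := T.closedInterior) ?_
    T.isCompact_closedInterior T.isClosed_closedInterior.measurableSet subset_rfl
    (measure_closedInterior_lt_top T).ne
  have h1 : Continuous κ.symm := κ.symm.toLinearMap.continuous_of_finiteDimensional
  exact ((h1.comp (rtEval_continuous T u)).inner (rtEval_continuous T v)).continuousOn

theorem cellProduct_add_left (T : Affine.Simplex ℝ (E n) d) (κ : E n ≃ₗ[ℝ] E n)
    (u u' v : E n × ℝ) :
    cellProduct T κ (u + u') v = cellProduct T κ u v + cellProduct T κ u' v := by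
  unfold cellProduct
  rw [← integral_add (cellProduct_integrable T κ u v) (cellProduct_integrable T κ u' v)]
  simp only [rtEval_add, map_add, inner_add_left]

theorem cellProduct_add_right (T : Affine.Simplex ℝ (E n) d) (κ : E n ≃ₗ[ℝ] E n)
    (u v v' : E n × ℝ) :
    cellProduct T κ u (v + v') = cellProduct T κ u v + cellProduct T κ u v' := by
  unfold cellProduct
  rw [← integral_add (cellProduct_integrable T κ u v) (cellProduct_integrable T κ u v')]
  simp only [rtEval_add, inner_add_right]

theorem cellProduct_smul_left (T : Affine.Simplex ℝ (E n) d) (κ : E n ≃ₗ[ℝ] E n)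
    (c : ℝ) (u v : E n × ℝ) : cellProduct T κ (c • u) v = c * cellProduct T κ u v := by
  unfold cellProduct
  rw [← integral_const_mul]
  simp only [rtEval_smul, map_smul, real_inner_smul_left]

theorem cellProduct_smul_right (T : Affine.Simplex ℝ (E n) d) (κ : E n ≃ₗ[ℝ] E n)
    (c : ℝ) (u v : E n × ℝ) : cellProduct T κ u (c • v) = c * cellProduct T κ u v := by
  unfold cellProduct
  rw [← integral_const_mul]
  simp only [rtEval_smul, real_inner_smul_right]

/-- The closed cells `cl i` and their relative interiors `op i` partition the set `Ω`, as the
elements of a mesh do: the open cells are disjoint subsets of `Ω`, the closed cells fill its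
closure. -/
def Partitions {ι : Type} (cl op : ι → Set (E n)) (Ω : Set (E n)) : Prop :=
  (⋃ i, cl i) = closure Ω ∧ (∀ i, op i ⊆ Ω) ∧ Pairwise fun i j => Disjoint (op i) (op j)

end Simplices

/-! ### The mixed-dimensional geometry -/

/-- A fractured porous medium in `ℝⁿ`: finitely many flat subdomains `Ω s` of dimensions
`0, …, n`, the interfaces between subdomains of consecutive dimensions, and the partition of the
outer boundary into a Dirichlet and a Neumann part. An interface `g` coincides, as a set, with
its lower-dimensional subdomain `Ω (lo g)`, which `Ω (hi g)` touches from the side opposite to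
the unit vector `nu g`; the two sides of a fracture are different interfaces. -/
structure Geometry (n : ℕ) where
  Sub : Type
  [fintypeSub : Fintype Sub]
  dim : Sub → ℕ
  Ω : Sub → Set (E n)
  /-- The affine subspace that contains the flat subdomain. -/
  plane : Sub → AffineSubspace ℝ (E n)
  finrank_plane : ∀ s, Module.finrank ℝ (plane s).direction = dim s
  relOpen : ∀ s, ∃ U : Set (E n), IsOpen U ∧ Ω s = U ∩ plane s
  isConnected : ∀ s, IsConnected (Ω s)
  isBounded : ∀ s, Bornology.IsBounded (Ω s)
  disjoint : Pairwise fun s t => Disjoint (Ω s) (Ω t)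
  Interface : Type
  [fintypeInterface : Fintype Interface]
  lo : Interface → Sub
  hi : Interface → Sub
  /-- The unit normal of the interface, outward for the higher-dimensional side. -/
  nu : Interface → E n
  dim_hi : ∀ g, dim (hi g) = dim (lo g) + 1
  plane_le : ∀ g, plane (lo g) ≤ plane (hi g)
  norm_nu : ∀ g, ‖nu g‖ = 1
  nu_mem : ∀ g, nu g ∈ (plane (hi g)).direction
  nu_orthogonal : ∀ g, nu g ∈ ((plane (lo g)).direction)ᗮ
  side : ∀ g, ∀ x ∈ Ω (lo g), ∀ᶠ t : ℝ in 𝓝[>] 0, x - t • nu g ∈ Ω (hi g)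
  interface_ext : ∀ g g', lo g = lo g' → hi g = hi g' → nu g = nu g' → g = g'
  /-- The mixed-dimensional medium is connected. -/
  connected : ∀ s t, Relation.EqvGen (fun s t => ∃ g, lo g = s ∧ hi g = t) s t
  dirichlet : Set (E n)
  neumann : Set (E n)
  boundary_eq : dirichlet ∪ neumann = closure (⋃ s, Ω s) \ ⋃ s, Ω s
  boundary_disjoint : Disjoint dirichlet neumann
  dirichlet_pos : 0 < (Measure.euclideanHausdorffMeasure (n - 1) : Measure (E n)) dirichlet

attribute [instance] Geometry.fintypeSub Geometry.fintypeInterface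

/-! ### Meshes -/

/-- Simplicial meshes of all subdomains and mortar meshes of all interfaces. The mesh of a
subdomain is conforming inside the subdomain and resolves its boundary; the meshes on the two
sides of an interface and the mortar mesh need not match. -/
structure Mesh {n : ℕ} (G : Geometry n) where
  Cell : G.Sub → Type
  [fintypeCell : ∀ s, Fintype (Cell s)]
  simplex : ∀ {s}, Cell s → Affine.Simplex ℝ (E n) (G.dim s)
  partitions : ∀ s, Partitions (fun c : Cell s => (simplex c).closedInterior)
    (fun c => openCell (simplex c)) (G.Ω s)
  /-- Two elements meet inside the subdomain only in a common face. -/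
  conforming : ∀ s (c c' : Cell s),
    (simplex c).closedInterior ∩ (simplex c').closedInterior ∩ G.Ω s ⊆
      convexHull ℝ (range (simplex c).points ∩ range (simplex c').points)
  /-- Every facet lies inside the subdomain, or on an interface, or on one of the two parts of the
  outer boundary. -/
  resolved : ∀ s (c : Cell s) (k : Fin (G.dim s + 1)),
    openFacet (simplex c) k ⊆ G.Ω s ∨
    (∃ g, G.hi g = s ∧ openFacet (simplex c) k ⊆ G.Ω (G.lo g) ∧ normal (simplex c) k = G.nu g) ∨
    openFacet (simplex c) k ⊆ G.dirichlet ∨ openFacet (simplex c) k ⊆ G.neumann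
  /-- The facets that lie on an interface form a mesh of it. -/
  trace_partitions : ∀ g, Partitions
    (fun f : {f : Cell (G.hi g) × Fin (G.dim (G.hi g) + 1) //
        openFacet (simplex f.1) f.2 ⊆ G.Ω (G.lo g) ∧ normal (simplex f.1) f.2 = G.nu g} =>
      closedFacet (simplex f.1.1) f.1.2)
    (fun f => openFacet (simplex f.1.1) f.1.2) (G.Ω (G.lo g))
  Mortar : G.Interface → Type
  [fintypeMortar : ∀ g, Fintype (Mortar g)]
  mortarSimplex : ∀ {g}, Mortar g → Affine.Simplex ℝ (E n) (G.dim (G.lo g))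
  mortar_partitions : ∀ g, Partitions (fun m : Mortar g => (mortarSimplex m).closedInterior)
    (fun m => openCell (mortarSimplex m)) (G.Ω (G.lo g))

attribute [instance] Mesh.fintypeCell Mesh.fintypeMortar

namespace Mesh

variable {n : ℕ} {G : Geometry n} (M : Mesh G)

/-- The facet opposite to the vertex `k` of the element `c` lies on the interface `g`. -/
def OnInterface (g : G.Interface) {s : G.Sub} (c : M.Cell s) (k : Fin (G.dim s + 1)) : Prop :=
  G.hi g = s ∧ openFacet (M.simplex c) k ⊆ G.Ω (G.lo g) ∧ normal (M.simplex c) k = G.nu g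

/-- Elementwise data `(a, b)` of piecewise Raviart–Thomas fields. -/
abbrev Field := ∀ s, M.Cell s → E n × ℝ

/-- The flux space `V_h`: elementwise lowest-order Raviart–Thomas fields (zero on points) whose
normal components are continuous across the facets inside each subdomain and vanish on the
Neumann boundary. -/
def V : Submodule ℝ M.Field where
  carrier := {v |
    (∀ s (c : M.Cell s), (v s c).1 ∈ (G.plane s).direction ∧ (G.dim s = 0 → (v s c).2 = 0)) ∧
    (∀ s (c c' : M.Cell s) (k k' : Fin (G.dim s + 1)), c ≠ c' →
      openFacet (M.simplex c) k = openFacet (M.simplex c') k' →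
      openFacet (M.simplex c) k ⊆ G.Ω s →
      normalTrace (M.simplex c) k (v s c) + normalTrace (M.simplex c') k' (v s c') = 0) ∧
    (∀ s (c : M.Cell s) (k : Fin (G.dim s + 1)), openFacet (M.simplex c) k ⊆ G.neumann →
      normalTrace (M.simplex c) k (v s c) = 0)}
  add_mem' := by
    rintro u v ⟨hu1, hu2, hu3⟩ ⟨hv1, hv2, hv3⟩
    refine ⟨fun s c => ⟨Submodule.add_mem _ (hu1 s c).1 (hv1 s c).1, fun h => ?_⟩,
      fun s c c' k k' h1 h2 h3 => ?_, fun s c k h => ?_⟩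
    · simp [(hu1 s c).2 h, (hv1 s c).2 h]
    · have h4 := hu2 s c c' k k' h1 h2 h3
      have h5 := hv2 s c c' k k' h1 h2 h3
      simp only [Pi.add_apply, normalTrace_add]
      linarith
    · simp only [Pi.add_apply, normalTrace_add, hu3 s c k h, hv3 s c k h, add_zero]
  zero_mem' := by
    have h0 : ∀ s (c : M.Cell s) (k : Fin (G.dim s + 1)),
        normalTrace (M.simplex c) k (0 : E n × ℝ) = 0 := by
      intro s c k
      simp [normalTrace, rtEval]
    refine ⟨fun s c => ⟨Submodule.zero_mem _, fun _ => rfl⟩, fun s c c' k k' _ _ _ => ?_,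
      fun s c k _ => ?_⟩
    · simp only [Pi.zero_apply, h0, add_zero]
    · simp only [Pi.zero_apply, h0]
  smul_mem' := by
    rintro r v ⟨hv1, hv2, hv3⟩
    refine ⟨fun s c => ⟨Submodule.smul_mem _ r (hv1 s c).1, fun h => ?_⟩,
      fun s c c' k k' h1 h2 h3 => ?_, fun s c k h => ?_⟩
    · simp [(hv1 s c).2 h]
    · simp only [Pi.smul_apply, normalTrace_smul]
      rw [← mul_add, hv2 s c c' k k' h1 h2 h3, mul_zero]
    · simp only [Pi.smul_apply, normalTrace_smul, hv3 s c k h, mul_zero]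

/-- The subspace `V_{0h}` of fluxes with zero normal component on all interfaces. -/
def V0 : Submodule ℝ M.Field where
  carrier := {v | v ∈ M.V ∧ ∀ g s (c : M.Cell s) (k : Fin (G.dim s + 1)), M.OnInterface g c k →
    normalTrace (M.simplex c) k (v s c) = 0}
  add_mem' := by
    rintro u v ⟨hu, hu'⟩ ⟨hv, hv'⟩
    refine ⟨Submodule.add_mem _ hu hv, fun g s c k h => ?_⟩
    simp only [Pi.add_apply, normalTrace_add, hu' g s c k h, hv' g s c k h, add_zero]
  zero_mem' := ⟨Submodule.zero_mem _, fun g s c k _ => by simp [normalTrace, rtEval]⟩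
  smul_mem' := by
    rintro r v ⟨hv, hv'⟩
    refine ⟨Submodule.smul_mem _ r hv, fun g s c k h => ?_⟩
    simp only [Pi.smul_apply, normalTrace_smul, hv' g s c k h, mul_zero]

/-- The mortar space `Λ_h` of piecewise constants on the mortar meshes. -/
abbrev Λ := ∀ g, M.Mortar g → ℝ

/-- The pressure space `Q_h` of piecewise constants on the subdomain meshes. -/
abbrev Q := ∀ s, M.Cell s → ℝ

/-- The space `W_h = V_{0h} × Λ_h` of all fluxes. -/
abbrev W := M.V0 × M.Λ

/-- `R` is a discrete extension operator: on every interface the normal component of `R μ` is the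
`L²` projection of `μ` to the piecewise constants on the trace mesh (its mean value over each
facet), and on the outer boundary the normal component of `R μ` vanishes (on the Neumann part
this is part of `R μ ∈ V_h`). -/
def IsExtension (R : M.Λ →ₗ[ℝ] M.V) : Prop :=
  (∀ μ g s (c : M.Cell s) (k : Fin (G.dim s + 1)), M.OnInterface g c k →
    vol (G.dim (G.lo g)) (closedFacet (M.simplex c) k) *
        normalTrace (M.simplex c) k ((R μ : M.Field) s c) =
      ∑ m : M.Mortar g, μ g m * vol (G.dim (G.lo g))
        (closedFacet (M.simplex c) k ∩ (M.mortarSimplex m).closedInterior)) ∧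
  (∀ μ s (c : M.Cell s) (k : Fin (G.dim s + 1)), openFacet (M.simplex c) k ⊆ G.dirichlet →
    normalTrace (M.simplex c) k ((R μ : M.Field) s c) = 0)

/-- Shape regularity with constant `σ`: each element of positive dimension contains a ball of its
plane whose radius is at least the `σ`-th part of the diameter of the element. -/
def ShapeRegular (σ : ℝ) : Prop :=
  ∀ s (c : M.Cell s), G.dim s ≠ 0 → ∃ x ∈ G.plane s, ∃ r : ℝ, 0 < r ∧
    Metric.closedBall x r ∩ G.plane s ⊆ (M.simplex c).closedInterior ∧
    Metric.diam (M.simplex c).closedInterior ≤ σ * r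

end Mesh

/-! ### Physical parameters -/

/-- The permeability `K` (a symmetric positive definite tensor on the tangent space of each
subdomain, constant on the subdomain; it is extended to `ℝⁿ`, and the extension is irrelevant),
the distances `γ`, constant on each interface, and the normal permeability `Kν`. -/
structure Parameters {n : ℕ} (G : Geometry n) where
  K : G.Sub → (E n ≃ₗ[ℝ] E n)
  K_tangent : ∀ s, ∀ v ∈ (G.plane s).direction, K s v ∈ (G.plane s).direction
  K_symm : ∀ s u v, ⟪K s u, v⟫_ℝ = ⟪u, K s v⟫_ℝ
  K_pos : ∀ s v, v ≠ 0 → 0 < ⟪K s v, v⟫_ℝ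
  γ : G.Interface → ℝ
  γ_pos : ∀ g, 0 < γ g
  Kν : G.Interface → E n → ℝ
  Kν_measurable : ∀ g, Measurable (Kν g)
  Kν_bounds : ∀ g, ∃ m M : ℝ, 0 < m ∧ ∀ x ∈ G.Ω (G.lo g), m ≤ Kν g x ∧ Kν g x ≤ M

/-- On the tangent space of each subdomain, the ratio of any two eigenvalues of `K` is at most
`θ`. -/
def Parameters.AnisotropyBound {n : ℕ} {G : Geometry n} (P : Parameters G) (θ : ℝ) : Prop :=
  ∀ s, ∀ u ∈ (G.plane s).direction, ∀ v ∈ (G.plane s).direction, ‖u‖ = 1 → ‖v‖ = 1 →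
    ⟪P.K s u, u⟫_ℝ ≤ θ * ⟪P.K s v, v⟫_ℝ

/-! ### The discrete problem -/

/-- All data of the mixed finite element discretization of the mixed-dimensional flow problem. -/
structure Discretization (n : ℕ) where
  G : Geometry n
  M : Mesh G
  P : Parameters G
  R : M.Λ →ₗ[ℝ] M.V
  isExtension : M.IsExtension R

/-- The inverse of a linear bijection (and `0` if the map is not bijective). -/
def inv {X Y : Type*} [AddCommGroup X] [Module ℝ X] [AddCommGroup Y] [Module ℝ Y]
    (T : X →ₗ[ℝ] Y) : Y →ₗ[ℝ] X :=
  open Classical in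
  if h : Function.Bijective T then (LinearEquiv.ofBijective T h).symm.toLinearMap else 0

/-- The operator norm `sup_{x ≠ 0} N (T x) / N x` of `T` with respect to a norm `N`. -/
def opNorm {X : Type*} [AddCommGroup X] [Module ℝ X] (N : X → ℝ) (T : X →ₗ[ℝ] X) : ℝ≥0∞ :=
  ⨆ x : {x : X // x ≠ 0}, ENNReal.ofReal (N (T x) / N x)

/-- The condition number `‖T‖ ‖T⁻¹‖` of a linear bijection `T` with respect to a norm `N`. -/
def condNumber {X : Type*} [AddCommGroup X] [Module ℝ X] (N : X → ℝ) (T : X →ₗ[ℝ] X) : ℝ≥0∞ :=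
  opNorm N T * opNorm N (inv T)

/-- A symmetric positive definite operator from the dual of `X` to `X`. -/
def IsSPD {X : Type*} [AddCommGroup X] [Module ℝ X] (H : Module.Dual ℝ X →ₗ[ℝ] X) : Prop :=
  (∀ f f' : Module.Dual ℝ X, f (H f') = f' (H f)) ∧ ∀ f : Module.Dual ℝ X, f ≠ 0 → 0 < f (H f)

/-- The operators `H` and `S` satisfy `c₁ (H f, f) ≤ (S f, f) ≤ c₂ (H f, f)`. -/
def SpectrallyEquivalent {X : Type*} [AddCommGroup X] [Module ℝ X]
    (H S : Module.Dual ℝ X →ₗ[ℝ] X) (c₁ c₂ : ℝ) : Prop :=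
  ∀ f : Module.Dual ℝ X, c₁ * f (H f) ≤ f (S f) ∧ f (S f) ≤ c₂ * f (H f)

namespace Discretization

variable {n : ℕ} (D : Discretization n)

/-- The flux space `W_h`. -/
abbrev W := D.M.W

/-- The pressure space `Q_h`. -/
abbrev Q := D.M.Q

/-- The total flux `v₀ + R μ` of `r = (v₀, μ) ∈ W_h`. -/
def flux : D.W →ₗ[ℝ] D.M.Field :=
  D.M.V0.subtype ∘ₗ LinearMap.fst ℝ D.M.V0 D.M.Λ +
    D.M.V.subtype ∘ₗ D.R ∘ₗ LinearMap.snd ℝ D.M.V0 D.M.Λ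

/-- The `L²` product `(γ Kν⁻¹ λ, μ)` over all interfaces. -/
def mortarProduct (l m : D.M.Λ) : ℝ :=
  ∑ g, ∑ τ : D.M.Mortar g,
    (∫ x in (D.M.mortarSimplex τ).closedInterior, D.P.γ g * (D.P.Kν g x)⁻¹
      ∂(Measure.euclideanHausdorffMeasure (D.G.dim (D.G.lo g)))) * (l g τ * m g τ)

/-- The operator `A : W_h → W_h'`, given by the bilinear form
`a(w, r) = (K⁻¹ (u₀ + R λ), v₀ + R μ)_Ω + (γ Kν⁻¹ λ, μ)_Γ`. -/
def A : D.W →ₗ[ℝ] Module.Dual ℝ D.W :=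
  LinearMap.mk₂ ℝ
    (fun w r => (∑ s, ∑ c : D.M.Cell s,
        cellProduct (D.M.simplex c) (D.P.K s) (D.flux w s c) (D.flux r s c)) +
      D.mortarProduct w.2 r.2)
    (by
      intro w w' r
      simp only [mortarProduct, map_add, Pi.add_apply, cellProduct_add_left, Prod.snd_add, add_mul,
        mul_add, Finset.sum_add_distrib]
      ring)
    (by
      intro t w r
      simp only [mortarProduct, map_smul, Pi.smul_apply, cellProduct_smul_left, Prod.smul_snd,
        smul_eq_mul, mul_add, Finset.mul_sum]
      congr 1
      exact Finset.sum_congr rfl fun _ _ => Finset.sum_congr rfl fun _ _ => by ring)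
    (by
      intro w r r'
      simp only [mortarProduct, map_add, Pi.add_apply, cellProduct_add_right, Prod.snd_add, mul_add,
        Finset.sum_add_distrib]
      ring)
    (by
      intro t w r
      simp only [mortarProduct, map_smul, Pi.smul_apply, cellProduct_smul_right, Prod.smul_snd,
        smul_eq_mul, mul_add, Finset.mul_sum]
      congr 1
      exact Finset.sum_congr rfl fun _ _ => Finset.sum_congr rfl fun _ _ => by ring)

/-- The operator `D_A : W_h → W_h'`, given by the bilinear form `a^D(w, r)`, in which on each
element only the diagonal of the local mass matrix of the Raviart–Thomas basis is kept. -/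
def DA : D.W →ₗ[ℝ] Module.Dual ℝ D.W :=
  LinearMap.mk₂ ℝ
    (fun w r => (∑ s, ∑ c : D.M.Cell s, ∑ k : Fin (D.G.dim s + 1),
        normalTrace (D.M.simplex c) k (D.flux w s c) *
          normalTrace (D.M.simplex c) k (D.flux r s c) *
          cellProduct (D.M.simplex c) (D.P.K s)
            (rtBasis (D.M.simplex c) k) (rtBasis (D.M.simplex c) k)) +
      D.mortarProduct w.2 r.2)
    (by
      intro w w' r
      simp only [mortarProduct, map_add, Pi.add_apply, normalTrace_add, Prod.snd_add, add_mul,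
        mul_add, Finset.sum_add_distrib]
      ring)
    (by
      intro t w r
      simp only [mortarProduct, map_smul, Pi.smul_apply, normalTrace_smul, Prod.smul_snd,
        smul_eq_mul, mul_add, Finset.mul_sum]
      congr 1
      · exact Finset.sum_congr rfl fun _ _ => Finset.sum_congr rfl fun _ _ =>
          Finset.sum_congr rfl fun _ _ => by ring
      · exact Finset.sum_congr rfl fun _ _ => Finset.sum_congr rfl fun _ _ => by ring)
    (by
      intro w r r'
      simp only [mortarProduct, map_add, Pi.add_apply, normalTrace_add, Prod.snd_add, add_mul,
        mul_add, Finset.sum_add_distrib]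
      ring)
    (by
      intro t w r
      simp only [mortarProduct, map_smul, Pi.smul_apply, normalTrace_smul, Prod.smul_snd,
        smul_eq_mul, mul_add, Finset.mul_sum]
      congr 1
      · exact Finset.sum_congr rfl fun _ _ => Finset.sum_congr rfl fun _ _ =>
          Finset.sum_congr rfl fun _ _ => by ring
      · exact Finset.sum_congr rfl fun _ _ => Finset.sum_congr rfl fun _ _ => by ring)

/-- The operator `B : W_h → Q_h'`, given by the bilinear form
`b(r, q) = -(q, ∇·(v₀ + R μ) + ⟦μ⟧)_Ω`. The jump `⟦μ⟧` on a subdomain is minus the sum of `μ`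
over the interfaces whose lower-dimensional side it is; the `L²` product of two functions that are
constant on the elements of two meshes is computed over the intersections of the elements. -/
def B : D.W →ₗ[ℝ] Module.Dual ℝ D.Q :=
  LinearMap.mk₂ ℝ
    (fun r q => -((∑ s, ∑ c : D.M.Cell s, q s c * rtDiv (D.G.dim s) (D.flux r s c) *
          vol (D.G.dim s) (D.M.simplex c).closedInterior) +
        -(∑ g, ∑ c : D.M.Cell (D.G.lo g), ∑ τ : D.M.Mortar g, q (D.G.lo g) c * r.2 g τ *
          vol (D.G.dim (D.G.lo g))
            ((D.M.simplex c).closedInterior ∩ (D.M.mortarSimplex τ).closedInterior))))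
    (by
      intro r r' q
      simp only [rtDiv, map_add, Pi.add_apply, Prod.snd_add, add_mul, mul_add,
        Finset.sum_add_distrib]
      ring)
    (by
      intro t r q
      simp only [rtDiv, map_smul, Pi.smul_apply, Prod.smul_snd, smul_eq_mul, mul_neg, mul_add,
        Finset.mul_sum]
      congr 2
      · exact Finset.sum_congr rfl fun _ _ => Finset.sum_congr rfl fun _ _ => by ring
      · congr 1
        exact Finset.sum_congr rfl fun _ _ => Finset.sum_congr rfl fun _ _ =>
          Finset.sum_congr rfl fun _ _ => by ring)
    (by
      intro r q q'
      simp only [Pi.add_apply, add_mul, Finset.sum_add_distrib]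
      ring)
    (by
      intro t r q
      simp only [Pi.smul_apply, smul_eq_mul, mul_neg, mul_add, Finset.mul_sum]
      congr 2
      · exact Finset.sum_congr rfl fun _ _ => Finset.sum_congr rfl fun _ _ => by ring
      · congr 1
        exact Finset.sum_congr rfl fun _ _ => Finset.sum_congr rfl fun _ _ =>
          Finset.sum_congr rfl fun _ _ => by ring)

/-- The transpose `Bᵀ : Q_h → W_h'`. -/
def BT : D.Q →ₗ[ℝ] Module.Dual ℝ D.W := D.B.flip

/-- The block operator `𝒜 = (A, Bᵀ; -B, 0)` of the discrete saddle point problem. -/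
def saddle : D.W × D.Q →ₗ[ℝ] Module.Dual ℝ D.W × Module.Dual ℝ D.Q :=
  LinearMap.prod (LinearMap.coprod D.A D.BT) (-(D.B ∘ₗ LinearMap.fst ℝ D.W D.Q))

/-- The operator `B D_A⁻¹ Bᵀ : Q_h → Q_h'`. -/
def schur : D.Q →ₗ[ℝ] Module.Dual ℝ D.Q := D.B ∘ₗ inv D.DA ∘ₗ D.BT

/-- The discrete gradient `D_h : Q_h → W_h`, given by `a^D(D_h q, r) = b(r, q)`. -/
def grad : D.Q →ₗ[ℝ] D.W := inv D.DA ∘ₗ D.BT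

/-- The weighted norm `|||(r, q)|||² = a(r, r) + a^D(D_h q, D_h q)`. -/
def tripleNorm (x : D.W × D.Q) : ℝ :=
  Real.sqrt (D.A x.1 x.1 + D.DA (D.grad x.2) (D.grad x.2))

/-- The bilinear form `ℒ(w, p; r, q) = a(w, r) + a^D(D_h p, r) + a^D(D_h q, w)`. -/
def form (x y : D.W × D.Q) : ℝ :=
  D.A x.1 y.1 + D.DA (D.grad x.2) y.1 + D.DA (D.grad y.2) x.1

/-- Continuity with constant `α` and inf-sup condition with constant `β` of the form `ℒ` with
respect to the weighted norm. -/
def WellPosed (α β : ℝ) : Prop :=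
  (∀ x y, |D.form x y| ≤ α * D.tripleNorm x * D.tripleNorm y) ∧
  ∀ y, y ≠ 0 → β ≤ ⨆ x : {x : D.W × D.Q // x ≠ 0},
    D.form x y / (D.tripleNorm x * D.tripleNorm y)

/-- The block diagonal operator `diag(H_w, H_p) : W_h' × Q_h' → W_h × Q_h`. -/
def blockDiag (Hw : Module.Dual ℝ D.W →ₗ[ℝ] D.W) (Hp : Module.Dual ℝ D.Q →ₗ[ℝ] D.Q) :
    Module.Dual ℝ D.W × Module.Dual ℝ D.Q →ₗ[ℝ] D.W × D.Q :=
  LinearMap.prodMap Hw Hp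

/-- The norm `‖x‖² = ⟨M⁻¹ x, x⟩` on `W_h × Q_h` induced by a preconditioner `M`. -/
def precondNorm (M : Module.Dual ℝ D.W × Module.Dual ℝ D.Q →ₗ[ℝ] D.W × D.Q) (x : D.W × D.Q) : ℝ :=
  Real.sqrt ((inv M x).1 x.1 + (inv M x).2 x.2)

end Discretization

end MixedDim

end

noncomputable section

namespace MixedDim

/-! ### Barycentric coordinates as affine functions on `ℝⁿ` -/

section Barycentric

variable {n d : ℕ} (T : Affine.Simplex ℝ (E n) d)

/-! Everything rests on comparing the forms a and a^D element by element. A Raviart–Thomas field on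
a d-simplex is the sum of d + 1 multiples of basis fields, so a ≤ (n + 1) a^D on every mesh
(`cellProduct_self_le_diagonal`). The reverse bound a^D ≤ C a is where shape regularity enters
(`diagonal_le_cellProduct_self`). The field is constant or of the form b (x - c); outside a small
ball around its zero c, the inscribed ball still carries a fixed share of the mean square, which
therefore controls the values on the facets. The basis fields are bounded because no height is
smaller than the inscribed radius. The tensor is compared with a single Rayleigh quotient, which
cancels.

Bijectivity is positive definiteness in finite dimension. For the Schur complement, whose form is
a^D(D_h q, D_h q'), this amounts to injectivity of Bᵀ (`injective_BT`). Let Bᵀ q = 0. Testing with a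
unit flux through the facet between two elements shows that the values of q there differ by a
positive factor. The elements of a connected subdomain cannot be split into two families without a
common facet (`mem_of_adjacent_closed`), so q vanishes or has one strict sign on each subdomain. A
flux through a Dirichlet facet makes q vanish on one subdomain. The mortar function 1 on one
interface equates positively weighted sums of q on its two sides, so zeros pass across it both ways
(`interface_balance`), and the graph is connected.

In the weighted norm, whose square is a plus the Schur form, continuity of ℒ follows from
Cauchy–Schwarz and a^D ≤ C a. The inf-sup condition follows by testing with (r + δ D_h q, -q); it
uses only a ≤ (n + 1) a^D, so β depends on n alone.

Finally, ℒ is the pairing with 𝒜 x up to a sign in the pressure component. With E the square of the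
weighted norm and E* the dual quantity built from the inverses of A and of the Schur complement,
well-posedness says β² E(x) ≤ E*(𝒜 x) ≤ α² E(x). The spectral equivalences compare E* with the
energy of the preconditioner on functionals and, after inversion, E with its energy on vectors.
Hence c₁ ‖M 𝒜 x‖ ≤ α ‖x‖ and β ‖x‖ ≤ c₂ ‖M 𝒜 x‖ in either norm, and the condition number is bounded
by the product of the two ratios. -/

theorem foot_eq [NeZero d] (k : Fin (d + 1)) : foot T k = T.altitudeFoot k := by
  simp [foot, NeZero.ne d]

theorem height_pos [NeZero d] (k : Fin (d + 1)) : 0 < height T k := by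
  rw [height, foot_eq]
  exact T.height_pos k

theorem height_pos_of_ne_zero (hd : d ≠ 0) (k : Fin (d + 1)) : 0 < height T k := by
  have : NeZero d := ⟨hd⟩
  exact height_pos T k

/-- In dimension 0 the foot is by convention the vertex itself. Since 0⁻¹ = 0, normals and basis
fields then vanish, so points carry no flux. -/
theorem height_of_eq_zero (hd : d = 0) (k : Fin (d + 1)) : height T k = 0 := by
  simp [height, foot, hd]

theorem normal_of_eq_zero (hd : d = 0) (k : Fin (d + 1)) : normal T k = 0 := by
  simp [normal, height_of_eq_zero T hd]

theorem norm_normal [NeZero d] (k : Fin (d + 1)) : ‖normal T k‖ = 1 := by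
  have h := height_pos T k
  rw [normal, norm_smul, norm_inv, Real.norm_of_nonneg h.le, ← dist_eq_norm, dist_comm,
    ← height, inv_mul_cancel₀ h.ne']

/-- The inner product of the outward normal with an edge ending in the opposite vertex. -/
theorem inner_foot_sub_point_normal [NeZero d] (k j : Fin (d + 1)) :
    ⟪foot T k - T.points j, normal T k⟫_ℝ = if k = j then height T k else 0 := by
  have h := height_pos T k
  rw [normal, real_inner_smul_right]
  split_ifs with hkj
  · subst hkj
    rw [real_inner_self_eq_norm_sq, ← dist_eq_norm, dist_comm, ← height]
    field_simp
  · have h0 := T.inner_vsub_altitudeFoot_vsub_altitudeFoot_eq_zero hkj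
    simp only [vsub_eq_sub] at h0
    rw [foot_eq, ← neg_sub (T.points j), ← neg_sub (T.points k), inner_neg_neg, h0, mul_zero]

/-- The barycentric coordinate of the vertex `k`, extended to an affine function on `ℝⁿ`. -/
def bary (k : Fin (d + 1)) : E n →ᵃ[ℝ] ℝ :=
  -- The only coordinate of a point is 1; the formula with the height would give 0 here.
  if d = 0 then AffineMap.const ℝ _ 1 else
    AffineMap.const ℝ _ ((height T k)⁻¹ * ⟪foot T k, normal T k⟫_ℝ) -
      ((height T k)⁻¹ • (innerₛₗ ℝ (normal T k))).toAffineMap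

theorem bary_apply [NeZero d] (k : Fin (d + 1)) (x : E n) :
    bary T k x = (height T k)⁻¹ * ⟪foot T k - x, normal T k⟫_ℝ := by
  rw [bary, if_neg (NeZero.ne d), inner_sub_left, mul_sub, real_inner_comm _ x]
  rfl

theorem continuous_bary (k : Fin (d + 1)) : Continuous (bary T k) :=
  (bary T k).continuous_of_finiteDimensional

theorem bary_point (k j : Fin (d + 1)) : bary T k (T.points j) = if k = j then 1 else 0 := by
  by_cases hd : d = 0
  · subst hd
    have hkj : k = j := by omega
    simp [bary, hkj]
  · have : NeZero d := ⟨hd⟩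
    rw [bary_apply, inner_foot_sub_point_normal]
    split_ifs
    · exact inv_mul_cancel₀ (height_pos T k).ne'
    · simp

theorem bary_affineCombination (k : Fin (d + 1)) {w : Fin (d + 1) → ℝ} (hw : ∑ i, w i = 1) :
    bary T k (Finset.univ.affineCombination ℝ T.points w) = w k := by
  rw [Finset.map_affineCombination _ _ _ hw,
    Finset.affineCombination_eq_linear_combination _ _ _ hw]
  simp [bary_point]

theorem affineCombination_bary {x : E n} (hx : x ∈ affineSpan ℝ (range T.points)) :
    ∑ i, bary T i x = 1 ∧
      Finset.univ.affineCombination ℝ T.points (fun i => bary T i x) = x := by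
  obtain ⟨w, hw, rfl⟩ := eq_affineCombination_of_mem_affineSpan_of_fintype hx
  simp only [bary_affineCombination T _ hw]
  exact ⟨hw, trivial⟩

/-- A function that is affine is determined on the plane of a simplex by its values in the
vertices. -/
theorem affineMap_eq_sum_bary (f : E n →ᵃ[ℝ] ℝ) {x : E n}
    (hx : x ∈ affineSpan ℝ (range T.points)) : f x = ∑ i, bary T i x * f (T.points i) := by
  obtain ⟨h1, h2⟩ := affineCombination_bary T hx
  conv_lhs => rw [← h2, Finset.map_affineCombination _ _ _ h1,
    Finset.affineCombination_eq_linear_combination _ _ _ h1]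
  simp

theorem sum_bary {x : E n} (hx : x ∈ affineSpan ℝ (range T.points)) : ∑ i, bary T i x = 1 :=
  (affineCombination_bary T hx).1

/-- Replaces the weights, which are given by existence only, by inequalities between fixed affine
functions on the ambient space. Closure, measure and convexity arguments below all use this form. -/
theorem mem_setInterior_iff (I : Set ℝ) {x : E n} :
    x ∈ T.setInterior I ↔ x ∈ affineSpan ℝ (range T.points) ∧ ∀ k, bary T k x ∈ I := by
  constructor
  · intro hx
    have hs := Affine.Simplex.setInterior_subset_affineSpan hx
    refine ⟨hs, ?_⟩
    obtain ⟨w, hw, hwI, rfl⟩ := hx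
    simpa only [bary_affineCombination T _ hw] using hwI
  · rintro ⟨hs, hI⟩
    obtain ⟨h1, h2⟩ := affineCombination_bary T hs
    exact ⟨_, h1, hI, h2⟩

theorem mem_openCell_iff {x : E n} :
    x ∈ openCell T ↔ x ∈ affineSpan ℝ (range T.points) ∧ ∀ k, 0 < bary T k x :=
  mem_setInterior_iff T _

theorem mem_closedInterior_iff {x : E n} :
    x ∈ T.closedInterior ↔ x ∈ affineSpan ℝ (range T.points) ∧ ∀ k, 0 ≤ bary T k x := by
  rw [Affine.Simplex.closedInterior, mem_setInterior_iff]
  refine and_congr_right fun hs => ⟨fun h k => (h k).1, fun h k => ⟨h k, ?_⟩⟩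
  -- Nonnegative coordinates with sum 1 are at most 1.
  rw [← sum_bary T hs]
  exact Finset.single_le_sum (f := fun i => bary T i x) (fun i _ => h i) (Finset.mem_univ k)

theorem mem_openFacet_iff {k : Fin (d + 1)} {x : E n} :
    x ∈ openFacet T k ↔ x ∈ affineSpan ℝ (range T.points) ∧ bary T k x = 0 ∧
      ∀ i, i ≠ k → 0 < bary T i x := by
  constructor
  · rintro ⟨w, hw, hk, hi, rfl⟩
    simp only [bary_affineCombination T _ hw]
    exact ⟨affineCombination_mem_affineSpan hw _, hk, hi⟩
  · rintro ⟨hs, hk, hi⟩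
    obtain ⟨h1, h2⟩ := affineCombination_bary T hs
    exact ⟨_, h1, hk, hi, h2⟩

/-- A face is cut out of the simplex by the vanishing of the coordinates of the vertices that it
misses. -/
theorem mem_convexHull_image_iff {A : Set (Fin (d + 1))} {x : E n} :
    x ∈ convexHull ℝ (T.points '' A) ↔ x ∈ affineSpan ℝ (range T.points) ∧
      (∀ i, 0 ≤ bary T i x) ∧ ∀ i ∉ A, bary T i x = 0 := by
  constructor
  · intro hx
    have hconv : Convex ℝ {x : E n | x ∈ affineSpan ℝ (range T.points) ∧
        (∀ i, 0 ≤ bary T i x) ∧ ∀ i ∉ A, bary T i x = 0} := by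
      have h1 : ∀ i, Convex ℝ {x | 0 ≤ bary T i x} := fun i =>
        (convex_Ici (0 : ℝ)).affine_preimage (bary T i)
      have h2 : ∀ i, Convex ℝ {x | bary T i x = 0} := fun i =>
        (convex_singleton (0 : ℝ)).affine_preimage (bary T i)
      have h3 := ((affineSpan ℝ (range T.points)).convex.inter
        ((convex_iInter h1).inter (convex_iInter fun i => convex_iInter fun _ : i ∉ A => h2 i)))
      have h4 : {x : E n | x ∈ affineSpan ℝ (range T.points) ∧
          (∀ i, 0 ≤ bary T i x) ∧ ∀ i ∉ A, bary T i x = 0} =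
          (affineSpan ℝ (range T.points) : Set (E n)) ∩ ((⋂ i, {x | 0 ≤ bary T i x}) ∩
            ⋂ i, ⋂ (_ : i ∉ A), {x | bary T i x = 0}) := by
        ext x
        simp only [mem_ofPred_eq, mem_inter_iff, mem_iInter, SetLike.mem_coe]
      exact h4 ▸ h3
    refine convexHull_min ?_ hconv hx
    rintro _ ⟨j, hj, rfl⟩
    refine ⟨mem_affineSpan ℝ (mem_range_self j), fun i => ?_, fun i hi => ?_⟩
    · rw [bary_point]; split_ifs <;> norm_num
    · rw [bary_point, if_neg]; rintro rfl; exact hi hj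
  · rintro ⟨hs, h0, hA⟩
    obtain ⟨h1, h2⟩ := affineCombination_bary T hs
    rw [← h2, Finset.affineCombination_eq_linear_combination _ _ _ h1]
    classical
    rw [← Finset.sum_subset (Finset.subset_univ (Finset.univ.filter (· ∈ A)))
      (fun i _ hi => by rw [hA i (by simpa using hi), zero_smul])]
    refine (convex_convexHull ℝ _).sum_mem (fun i _ => h0 i) ?_ fun i hi =>
      subset_convexHull ℝ _ ⟨i, by simpa using hi, rfl⟩
    rw [← h1]
    exact Finset.sum_subset (Finset.subset_univ _) fun i _ hi => hA i (by simpa using hi)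

theorem mem_closedFacet_iff {k : Fin (d + 1)} {x : E n} :
    x ∈ closedFacet T k ↔ x ∈ affineSpan ℝ (range T.points) ∧ (∀ i, 0 ≤ bary T i x) ∧
      bary T k x = 0 := by
  rw [closedFacet, mem_convexHull_image_iff]
  simp

theorem openFacet_subset_closedFacet (k : Fin (d + 1)) : openFacet T k ⊆ closedFacet T k := by
  intro x hx
  rw [mem_openFacet_iff] at hx
  rw [mem_closedFacet_iff]
  refine ⟨hx.1, fun i => ?_, hx.2.1⟩
  by_cases hi : i = k
  · rw [hi, hx.2.1]
  · exact (hx.2.2 i hi).le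

theorem closedFacet_subset_closedInterior (k : Fin (d + 1)) :
    closedFacet T k ⊆ T.closedInterior := by
  intro x hx
  rw [mem_closedFacet_iff] at hx
  rw [mem_closedInterior_iff]
  exact ⟨hx.1, hx.2.1⟩

theorem openCell_subset_closedInterior : openCell T ⊆ T.closedInterior := by
  intro x hx
  rw [mem_openCell_iff] at hx
  rw [mem_closedInterior_iff]
  exact ⟨hx.1, fun i => (hx.2 i).le⟩

theorem openCell_nonempty : (openCell T).Nonempty := by
  refine ⟨_, fun _ => ((d : ℝ) + 1)⁻¹, ?_, fun i => ?_, rfl⟩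
  · simp [mul_inv_cancel₀ (by positivity : (d : ℝ) + 1 ≠ 0)]
  · exact mem_Ioi.2 (by positivity)

theorem openFacet_nonempty (hd : d ≠ 0) (k : Fin (d + 1)) : (openFacet T k).Nonempty := by
  classical
  have hd' : (d : ℝ) ≠ 0 := by exact_mod_cast hd
  refine ⟨_, fun i => if i = k then 0 else (d : ℝ)⁻¹, ?_, by simp, fun i hi => ?_, rfl⟩
  · rw [Finset.sum_ite, Finset.sum_const_zero, zero_add, Finset.sum_const]
    have : (Finset.univ.filter fun i : Fin (d + 1) => ¬ i = k) = Finset.univ.erase k := by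
      ext; simp
    rw [this, Finset.card_erase_of_mem (Finset.mem_univ _)]
    simp [hd']
  · simp only [hi, if_false]
    positivity

/-- Moving from a point of the plane towards a point `z`. -/
theorem bary_lineMap (k : Fin (d + 1)) (x z : E n) (t : ℝ) :
    bary T k (AffineMap.lineMap x z t) = (1 - t) * bary T k x + t * bary T k z := by
  rw [AffineMap.apply_lineMap, AffineMap.lineMap_apply_ring]

/-- A point of a convex hull of a set of vertices that is in no proper face of it. -/
def hullInterior (V : Set (E n)) : Set (E n) :=
  {x | x ∈ convexHull ℝ V ∧ ∀ v ∈ V, x ∉ convexHull ℝ (V \ {v})}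

theorem points_image_sdiff (A : Set (Fin (d + 1))) (i : Fin (d + 1)) :
    T.points '' A \ {T.points i} = T.points '' (A \ {i}) := by
  rw [image_sdiff T.independent.injective, image_singleton]

theorem mem_hullInterior_iff {A : Set (Fin (d + 1))} {x : E n} :
    x ∈ hullInterior (T.points '' A) ↔ x ∈ affineSpan ℝ (range T.points) ∧
      (∀ i ∈ A, 0 < bary T i x) ∧ ∀ i ∉ A, bary T i x = 0 := by
  simp only [hullInterior, mem_ofPred_eq, forall_mem_image, points_image_sdiff,
    mem_convexHull_image_iff]
  constructor
  · rintro ⟨⟨h1, h2, h3⟩, h4⟩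
    refine ⟨h1, fun i hi => lt_of_le_of_ne (h2 i) fun h0 => h4 hi ⟨h1, h2, fun j hj => ?_⟩, h3⟩
    by_cases hjA : j ∈ A
    · have : j = i := by by_contra hne; exact hj ⟨hjA, hne⟩
      rw [this, ← h0]
    · exact h3 j hjA
  · rintro ⟨h1, h2, h3⟩
    refine ⟨⟨h1, fun i => ?_, h3⟩, fun i hi h => ?_⟩
    · by_cases hi : i ∈ A
      · exact (h2 i hi).le
      · rw [h3 i hi]
    · exact (h2 i hi).ne' (h.2.2 i fun hh => hh.2 rfl)

/-- The right-hand side depends only on the set of vertices, so simplices with the same vertices in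
different order have the same open cell. The version for facets serves the same purpose. -/
theorem openCell_eq_hullInterior : openCell T = hullInterior (range T.points) := by
  ext x
  rw [← image_univ, mem_hullInterior_iff, mem_openCell_iff]
  simp

theorem openFacet_eq_hullInterior (k : Fin (d + 1)) :
    openFacet T k = hullInterior (T.points '' {k}ᶜ) := by
  ext x
  rw [mem_hullInterior_iff, mem_openFacet_iff]
  simp only [mem_compl_iff, mem_singleton_iff, not_not, forall_eq]
  tauto

theorem openFacet_injective (hd : d ≠ 0) {k l : Fin (d + 1)}
    (h : openFacet T k = openFacet T l) : k = l := by
  obtain ⟨x, hx⟩ := openFacet_nonempty T hd k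
  have hx' := h ▸ hx
  rw [mem_openFacet_iff] at hx hx'
  by_contra hkl
  exact (hx'.2.2 k hkl).ne' hx.2.1

/-- A point of the closed facet is the limit of points moving from it towards a point of the open
facet. Thus the open facet alone, as a set, determines the closed one. -/
theorem closedFacet_eq_closure (hd : d ≠ 0) (k : Fin (d + 1)) :
    closedFacet T k = closure (openFacet T k) := by
  refine Subset.antisymm (fun x hx => ?_) ?_
  · obtain ⟨z, hz⟩ := openFacet_nonempty T hd k
    rw [mem_closedFacet_iff] at hx
    rw [mem_openFacet_iff] at hz
    have hc : Filter.Tendsto (fun t : ℝ => (AffineMap.lineMap x z t : E n)) (𝓝[>] 0) (𝓝 x) := by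
      have : Continuous fun t : ℝ => (AffineMap.lineMap x z t : E n) :=
        AffineMap.lineMap_continuous
      have h := this.tendsto 0
      rw [AffineMap.lineMap_apply_zero] at h
      exact h.mono_left nhdsWithin_le_nhds
    refine mem_closure_of_tendsto hc ?_
    filter_upwards [Ioo_mem_nhdsGT (zero_lt_one' ℝ)] with t ht
    rw [mem_openFacet_iff]
    refine ⟨AffineMap.lineMap_mem _ hx.1 hz.1, ?_, fun i hi => ?_⟩
    · rw [bary_lineMap, hx.2.2, hz.2.1]; simp
    · rw [bary_lineMap]
      have := mul_nonneg (sub_nonneg.2 ht.2.le) (hx.2.1 i)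
      have := mul_pos ht.1 (hz.2.2 i hi)
      linarith
  · refine closure_minimal (openFacet_subset_closedFacet T k) ?_
    exact ((T.points '' {k}ᶜ).toFinite.isCompact_convexHull ℝ).isClosed

theorem closedInterior_eq_closure : T.closedInterior = closure (openCell T) := by
  refine Subset.antisymm (fun x hx => ?_) ?_
  · obtain ⟨z, hz⟩ := openCell_nonempty T
    rw [mem_closedInterior_iff] at hx
    rw [mem_openCell_iff] at hz
    have hc : Filter.Tendsto (fun t : ℝ => (AffineMap.lineMap x z t : E n)) (𝓝[>] 0) (𝓝 x) := by
      have : Continuous fun t : ℝ => (AffineMap.lineMap x z t : E n) :=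
        AffineMap.lineMap_continuous
      have h := this.tendsto 0
      rw [AffineMap.lineMap_apply_zero] at h
      exact h.mono_left nhdsWithin_le_nhds
    refine mem_closure_of_tendsto hc ?_
    filter_upwards [Ioo_mem_nhdsGT (zero_lt_one' ℝ)] with t ht
    rw [mem_openCell_iff]
    refine ⟨AffineMap.lineMap_mem _ hx.1 hz.1, fun i => ?_⟩
    rw [bary_lineMap]
    have := mul_nonneg (sub_nonneg.2 ht.2.le) (hx.2 i)
    have := mul_pos ht.1 (hz.2 i)
    linarith
  · exact closure_minimal (openCell_subset_closedInterior T) T.isClosed_closedInterior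

theorem finrank_direction_span :
    Module.finrank ℝ (affineSpan ℝ (range T.points)).direction = d := by
  rw [direction_affineSpan]
  exact T.independent.finrank_vectorSpan (by simp)

/-- A plane of dimension `d` that contains the open simplex is the plane of the simplex. -/
theorem affineSpan_eq_of_openCell_subset {P : AffineSubspace ℝ (E n)}
    (hP : Module.finrank ℝ P.direction = d) (h : openCell T ⊆ P) :
    affineSpan ℝ (range T.points) = P := by
  have hclosed : IsClosed (P : Set (E n)) := AffineSubspace.closed_of_finiteDimensional P
  have hle : affineSpan ℝ (range T.points) ≤ P := by
    rw [affineSpan_le]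
    rintro _ ⟨j, rfl⟩
    refine hclosed.closure_subset_iff.2 h ?_
    rw [← closedInterior_eq_closure]
    exact T.point_mem_closedInterior j
  refine AffineSubspace.eq_of_direction_eq_of_nonempty_of_le ?_
    ⟨T.points 0, mem_affineSpan ℝ (mem_range_self 0)⟩ hle
  refine Submodule.eq_of_le_of_finrank_eq (AffineSubspace.direction_le hle) ?_
  rw [hP, finrank_direction_span]

end Barycentric

/-! ### The Hausdorff measure on a plane -/

section PlaneMeasure

variable {n d : ℕ} {P : AffineSubspace ℝ (E n)}

theorem euclideanHausdorffMeasure_of_dimH_lt {s : Set (E n)} (h : dimH s < d) :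
    (Measure.euclideanHausdorffMeasure d : Measure (E n)) s = 0 := by
  have h0 : (Measure.hausdorffMeasure (d : ℝ) : Measure (E n)) s = 0 := by
    have := hausdorffMeasure_of_dimH_lt (d := (d : NNReal)) (s := s) (by simpa using h)
    simpa using this
  rw [Measure.euclideanHausdorffMeasure_def, Measure.smul_apply, h0, smul_zero]

/-- The Hausdorff dimension of a nonempty convex set is the dimension of its linear span of
differences. -/
theorem measure_convex_eq_zero {s : Set (E n)} (hs : Convex ℝ s)
    (h : Module.finrank ℝ (vectorSpan ℝ s) < d) :
    (Measure.euclideanHausdorffMeasure d : Measure (E n)) s = 0 := by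
  rcases s.eq_empty_or_nonempty with rfl | hne
  · simp
  · refine euclideanHausdorffMeasure_of_dimH_lt ?_
    rw [Real.Convex.dimH_eq_finrank_vectorSpan hs hne]
    exact_mod_cast h

theorem measure_plane_eq_zero (h : Module.finrank ℝ P.direction < d) :
    (Measure.euclideanHausdorffMeasure d : Measure (E n)) P = 0 :=
  measure_convex_eq_zero P.convex h

/-- Differences of zeros lie in the kernel of the linear part of `f`. If they spanned the whole
direction of the plane, `f` would be constant on it, hence zero there. -/
theorem finrank_vectorSpan_zeros_lt (hP : Module.finrank ℝ P.direction = d) (f : E n →ᵃ[ℝ] ℝ)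
    {x : E n} (hx : x ∈ P) (hfx : f x ≠ 0) {y : E n} (hy : y ∈ P) (hfy : f y = 0) :
    Module.finrank ℝ (vectorSpan ℝ ((P : Set (E n)) ∩ {z | f z = 0})) < d := by
  rw [← hP]
  refine Submodule.finrank_lt_finrank_of_lt (lt_of_le_of_ne ?_ fun h => hfx ?_)
  · exact vectorSpan_mono ℝ inter_subset_left
  · have hle : vectorSpan ℝ ((P : Set (E n)) ∩ {z | f z = 0}) ≤ LinearMap.ker f.linear := by
      rw [vectorSpan_def, Submodule.span_le]
      rintro _ ⟨a, ha, b, hb, rfl⟩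
      simp only [SetLike.mem_coe, LinearMap.mem_ker, AffineMap.linearMap_vsub]
      rw [show f a = 0 from ha.2, show f b = 0 from hb.2, vsub_self]
    have hxy : x -ᵥ y ∈ P.direction := AffineSubspace.vsub_mem_direction hx hy
    rw [← h] at hxy
    have := hle hxy
    rwa [LinearMap.mem_ker, AffineMap.linearMap_vsub, hfy, vsub_eq_sub, sub_zero] at this

/-- The zeros of an affine function on a plane are a null set of the plane. -/
theorem measure_zeros_eq_zero (hP : Module.finrank ℝ P.direction = d) (f : E n →ᵃ[ℝ] ℝ)
    {x : E n} (hx : x ∈ P) (hfx : f x ≠ 0) :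
    (Measure.euclideanHausdorffMeasure d : Measure (E n)) ((P : Set (E n)) ∩ {z | f z = 0}) = 0 := by
  rcases ((P : Set (E n)) ∩ {z | f z = 0}).eq_empty_or_nonempty with h | ⟨y, hy, hfy⟩
  · rw [h, measure_empty]
  · exact measure_convex_eq_zero (P.convex.inter ((convex_singleton (0 : ℝ)).affine_preimage f))
      (finrank_vectorSpan_zeros_lt hP f hx hfx hy hfy)

/-- The volume of the unit ball of a linear subspace. -/
def unitBallVolume (V : Submodule ℝ (E n)) : ℝ≥0∞ :=
  (Measure.euclideanHausdorffMeasure (Module.finrank ℝ V) : Measure V) (Metric.ball 0 1)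

theorem unitBallVolume_pos (V : Submodule ℝ (E n)) : 0 < unitBallVolume V :=
  Metric.measure_ball_pos _ _ one_pos

theorem unitBallVolume_lt_top (V : Submodule ℝ (E n)) : unitBallVolume V < ∞ :=
  measure_ball_lt_top

/-- Translation by `x` is an isometry from the direction onto the plane, and Haar measure on the
direction scales with the power `d` of the radius. -/
theorem measure_inter_closedBall (hP : Module.finrank ℝ P.direction = d) {x : E n} (hx : x ∈ P)
    {r : ℝ} (hr : 0 ≤ r) :
    (Measure.euclideanHausdorffMeasure d : Measure (E n)) ((P : Set (E n)) ∩ Metric.closedBall x r)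
      = ENNReal.ofReal (r ^ d) * unitBallVolume P.direction := by
  have hiso : Isometry fun v : P.direction => (v : E n) + x := by
    refine Isometry.of_dist_eq fun u v => ?_
    rw [dist_add_right]
    rfl
  have himg : (fun v : P.direction => (v : E n) + x) '' Metric.closedBall 0 r =
      (P : Set (E n)) ∩ Metric.closedBall x r := by
    ext y
    constructor
    · rintro ⟨v, hv, rfl⟩
      refine ⟨AffineSubspace.vadd_mem_of_mem_direction v.2 hx, ?_⟩
      simpa [dist_eq_norm] using hv
    · rintro ⟨hy, hyr⟩
      refine ⟨⟨y -ᵥ x, AffineSubspace.vsub_mem_direction hy hx⟩, ?_, by simp⟩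
      simpa [dist_eq_norm] using hyr
  rw [← himg, hiso.euclideanHausdorffMeasure_image, ← hP, unitBallVolume,
    Measure.addHaar_closedBall _ _ hr]

theorem measure_lt_top_of_isBounded (hP : Module.finrank ℝ P.direction = d) {s : Set (E n)}
    (hs : Bornology.IsBounded s) (hsP : s ⊆ P) :
    (Measure.euclideanHausdorffMeasure d : Measure (E n)) s < ∞ := by
  rcases s.eq_empty_or_nonempty with rfl | ⟨x, hx⟩
  · simp
  · obtain ⟨r, hr⟩ := hs.subset_closedBall x
    have hr' : s ⊆ (P : Set (E n)) ∩ Metric.closedBall x (max r 0) := fun y hy =>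
      ⟨hsP hy, Metric.closedBall_subset_closedBall (le_max_left _ _) (hr hy)⟩
    refine (measure_mono hr').trans_lt ?_
    rw [measure_inter_closedBall hP (hsP hx) (le_max_right _ _)]
    exact ENNReal.mul_lt_top ENNReal.ofReal_lt_top (unitBallVolume_lt_top _)

theorem measure_pos_of_isOpen (hP : Module.finrank ℝ P.direction = d) {U : Set (E n)}
    (hU : IsOpen U) {x : E n} (hx : x ∈ P) (hxU : x ∈ U) :
    0 < (Measure.euclideanHausdorffMeasure d : Measure (E n)) ((P : Set (E n)) ∩ U) := by
  obtain ⟨r, hr, hrU⟩ := Metric.nhds_basis_closedBall.mem_iff.1 (hU.mem_nhds hxU)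
  refine lt_of_lt_of_le ?_ (measure_mono (inter_subset_inter_right _ hrU))
  rw [measure_inter_closedBall hP hx hr.le]
  exact ENNReal.mul_pos (ENNReal.ofReal_pos.2 (pow_pos hr d)).ne' (unitBallVolume_pos _).ne'

/-- A relatively open subset of a plane is not covered by the zeros of finitely many affine
functions that do not vanish on the plane. -/
theorem exists_mem_forall_ne_zero (hP : Module.finrank ℝ P.direction = d) {U : Set (E n)}
    (hU : IsOpen U) {x : E n} (hx : x ∈ P) (hxU : x ∈ U) {ι : Type*} [Finite ι]
    (f : ι → E n →ᵃ[ℝ] ℝ) (hf : ∀ i, ∃ y ∈ P, f i y ≠ 0) :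
    ∃ z ∈ P, z ∈ U ∧ ∀ i, f i z ≠ 0 := by
  by_contra! hcon
  -- Otherwise a relatively open set, which has positive measure, would be covered by finitely many
  -- null sets.
  have hsub : (P : Set (E n)) ∩ U ⊆ ⋃ i, (P : Set (E n)) ∩ {z | f i z = 0} := by
    rintro z ⟨hz, hzU⟩
    obtain ⟨i, hi⟩ := hcon z hz hzU
    exact mem_iUnion.2 ⟨i, hz, hi⟩
  have h0 := measure_mono_null hsub (measure_iUnion_null fun i => by
    obtain ⟨y, hy, hfy⟩ := hf i
    exact measure_zeros_eq_zero hP (f i) hy hfy)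
  exact (measure_pos_of_isOpen hP hU hx hxU).ne' h0

theorem measure_singleton_eq_zero (hd : d ≠ 0) (x : E n) :
    (Measure.euclideanHausdorffMeasure d : Measure (E n)) {x} = 0 :=
  measure_convex_eq_zero (convex_singleton x) (by
    rw [vectorSpan_singleton, finrank_bot]
    exact Nat.pos_of_ne_zero hd)

end PlaneMeasure

/-! ### Volumes of simplices and facets -/

section SimplexVolume

variable {n d : ℕ} (T : Affine.Simplex ℝ (E n) d)

theorem point_mem_span (k : Fin (d + 1)) : T.points k ∈ affineSpan ℝ (range T.points) :=
  mem_affineSpan ℝ (mem_range_self k)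

/-- The set where finitely many barycentric coordinates are positive is open. -/
theorem isOpen_bary_pos (s : Set (Fin (d + 1))) : IsOpen {x | ∀ k ∈ s, 0 < bary T k x} := by
  have : {x | ∀ k ∈ s, 0 < bary T k x} = ⋂ k ∈ s, {x | 0 < bary T k x} := by
    ext x
    simp
  rw [this]
  exact s.toFinite.isOpen_biInter fun k _ => isOpen_lt continuous_const (continuous_bary T k)

theorem openCell_eq_inter :
    openCell T = (affineSpan ℝ (range T.points) : Set (E n)) ∩ {x | ∀ k ∈ univ, 0 < bary T k x} := by
  ext x
  simp [mem_openCell_iff]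

theorem measure_openCell_pos :
    0 < (Measure.euclideanHausdorffMeasure d : Measure (E n)) (openCell T) := by
  obtain ⟨x, hx⟩ := openCell_nonempty T
  rw [openCell_eq_inter] at hx ⊢
  exact measure_pos_of_isOpen (finrank_direction_span T) (isOpen_bary_pos T univ) hx.1 hx.2

theorem measure_closedInterior_pos :
    0 < (Measure.euclideanHausdorffMeasure d : Measure (E n)) T.closedInterior :=
  (measure_openCell_pos T).trans_le (measure_mono (openCell_subset_closedInterior T))

theorem vol_closedInterior_pos : 0 < vol d T.closedInterior :=
  ENNReal.toReal_pos (measure_closedInterior_pos T).ne' (measure_closedInterior_lt_top T).ne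

theorem measure_closedInterior_sdiff_openCell :
    (Measure.euclideanHausdorffMeasure d : Measure (E n)) (T.closedInterior \ openCell T) = 0 := by
  have hsub : T.closedInterior \ openCell T ⊆
      ⋃ k, (affineSpan ℝ (range T.points) : Set (E n)) ∩ {x | bary T k x = 0} := by
    rintro x ⟨hx, hx'⟩
    rw [mem_closedInterior_iff] at hx
    rw [mem_openCell_iff] at hx'
    push Not at hx'
    obtain ⟨k, hk⟩ := hx' hx.1
    exact mem_iUnion.2 ⟨k, hx.1, le_antisymm hk (hx.2 k)⟩
  refine measure_mono_null hsub (measure_iUnion_null fun k => ?_)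
  exact measure_zeros_eq_zero (finrank_direction_span T) _ (point_mem_span T k) (by simp [bary_point])

/-- The plane of the facet opposite to the vertex `k`. -/
def facetPlane (k : Fin (d + 1)) : AffineSubspace ℝ (E n) := affineSpan ℝ (T.points '' {k}ᶜ)

theorem finrank_facetPlane {e : ℕ} (hd : d = e + 1) (k : Fin (d + 1)) :
    Module.finrank ℝ (facetPlane T k).direction = e := by
  subst hd
  rw [facetPlane, ← Affine.Simplex.range_faceOpposite_points]
  exact finrank_direction_span (T.faceOpposite k)

theorem facetPlane_le (k : Fin (d + 1)) : facetPlane T k ≤ affineSpan ℝ (range T.points) :=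
  affineSpan_mono _ (image_subset_range _ _)

theorem mem_facetPlane_iff {k : Fin (d + 1)} {x : E n} :
    x ∈ facetPlane T k ↔ x ∈ affineSpan ℝ (range T.points) ∧ bary T k x = 0 := by
  constructor
  · refine fun hx => ⟨facetPlane_le T k hx, ?_⟩
    refine affineSpan_induction (p := fun x => bary T k x = 0) hx ?_ ?_
    · rintro _ ⟨j, hj, rfl⟩
      rw [bary_point, if_neg]
      rintro rfl
      exact hj rfl
    · intro c u v w hu hv hw
      rw [AffineMap.map_vadd, map_smul, AffineMap.linearMap_vsub, hu, hv, hw]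
      simp
  · rintro ⟨hs, hk⟩
    obtain ⟨h1, h2⟩ := affineCombination_bary T hs
    rw [← h2]
    exact affineCombination_mem_affineSpan_image h1 (fun i _ hi => by
      have : i = k := by simpa using hi
      rw [this, hk]) _

theorem openFacet_eq_inter (k : Fin (d + 1)) :
    openFacet T k = (facetPlane T k : Set (E n)) ∩ {x | ∀ i ∈ ({k}ᶜ : Set _), 0 < bary T i x} := by
  ext x
  simp [mem_openFacet_iff, mem_facetPlane_iff, and_assoc]

theorem measure_openFacet_pos {e : ℕ} (hd : d = e + 1) (k : Fin (d + 1)) :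
    0 < (Measure.euclideanHausdorffMeasure e : Measure (E n)) (openFacet T k) := by
  obtain ⟨x, hx⟩ := openFacet_nonempty T (by omega) k
  rw [openFacet_eq_inter] at hx ⊢
  exact measure_pos_of_isOpen (finrank_facetPlane T hd k) (isOpen_bary_pos T _) hx.1 hx.2

theorem measure_closedFacet_lt_top {e : ℕ} (hd : d = e + 1) (k : Fin (d + 1)) :
    (Measure.euclideanHausdorffMeasure e : Measure (E n)) (closedFacet T k) < ∞ := by
  refine measure_lt_top_of_isBounded (finrank_facetPlane T hd k)
    (T.isCompact_closedInterior.isBounded.subset (closedFacet_subset_closedInterior T k)) ?_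
  intro x hx
  rw [mem_closedFacet_iff] at hx
  exact (mem_facetPlane_iff T).2 ⟨hx.1, hx.2.2⟩

theorem vol_closedFacet_pos {e : ℕ} (hd : d = e + 1) (k : Fin (d + 1)) :
    0 < vol e (closedFacet T k) :=
  ENNReal.toReal_pos ((measure_openFacet_pos T hd k).trans_le
    (measure_mono (openFacet_subset_closedFacet T k))).ne' (measure_closedFacet_lt_top T hd k).ne

theorem measure_closedFacet_sdiff_openFacet {e : ℕ} (hd : d = e + 1) (k : Fin (d + 1)) :
    (Measure.euclideanHausdorffMeasure e : Measure (E n)) (closedFacet T k \ openFacet T k) = 0 := by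
  have hsub : closedFacet T k \ openFacet T k ⊆
      ⋃ i : {i // i ≠ k}, (facetPlane T k : Set (E n)) ∩ {x | bary T i x = 0} := by
    rintro x ⟨hx, hx'⟩
    rw [mem_closedFacet_iff] at hx
    rw [mem_openFacet_iff] at hx'
    push Not at hx'
    obtain ⟨i, hik, hi⟩ := hx' hx.1 hx.2.2
    exact mem_iUnion.2 ⟨⟨i, hik⟩, (mem_facetPlane_iff T).2 ⟨hx.1, hx.2.2⟩,
      le_antisymm hi (hx.2.1 i)⟩
  refine measure_mono_null hsub (measure_iUnion_null fun i => ?_)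
  refine measure_zeros_eq_zero (x := T.points i) (finrank_facetPlane T hd k) _ ?_
    (by simp [bary_point])
  exact mem_affineSpan ℝ (mem_image_of_mem _ (by simpa using i.2))

end SimplexVolume

/-! ### Lowest-order Raviart–Thomas fields on a simplex -/

section RaviartThomas

variable {n d : ℕ} (T : Affine.Simplex ℝ (E n) d)

/-- Two values of the field differ by a multiple of the difference of the points, which is
orthogonal to the normal when both points lie in the plane of the facet. So the normal component can
be read off anywhere on that plane. -/
theorem normalTrace_eq_of_bary_eq_zero [NeZero d] {k : Fin (d + 1)} {x : E n}
    (hx : bary T k x = 0) (v : E n × ℝ) :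
    normalTrace T k v = ⟪rtEval T v x, normal T k⟫_ℝ := by
  rw [bary_apply, mul_eq_zero, or_iff_right (inv_ne_zero (height_pos T k).ne')] at hx
  have h : rtEval T v (foot T k) = rtEval T v x + v.2 • (foot T k - x) := by
    simp only [rtEval, smul_sub]
    abel
  rw [normalTrace, h, inner_add_left, real_inner_smul_left, hx, mul_zero, add_zero]

theorem rtEval_rtBasis (k : Fin (d + 1)) (x : E n) :
    rtEval T (rtBasis T k) x = (height T k)⁻¹ • (x - T.points k) := by
  rw [rtEval, rtBasis, ← smul_add]
  congr 1
  abel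

theorem normalTrace_rtBasis [NeZero d] (j k : Fin (d + 1)) :
    normalTrace T j (rtBasis T k) = if j = k then 1 else 0 := by
  rw [normalTrace, rtEval_rtBasis, real_inner_smul_left, inner_foot_sub_point_normal]
  split_ifs with h
  · rw [h, inv_mul_cancel₀ (height_pos T k).ne']
  · rw [mul_zero]

theorem normalTrace_of_eq_zero (hd : d = 0) (k : Fin (d + 1)) (v : E n × ℝ) :
    normalTrace T k v = 0 := by
  rw [normalTrace, normal_of_eq_zero T hd, inner_zero_right]

theorem normalTrace_sum {ι : Type*} (s : Finset ι) (k : Fin (d + 1)) (f : ι → E n × ℝ) :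
    normalTrace T k (∑ i ∈ s, f i) = ∑ i ∈ s, normalTrace T k (f i) := by
  classical
  induction s using Finset.induction_on with
  | empty => simp [normalTrace, rtEval]
  | insert a s ha ih => rw [Finset.sum_insert ha, Finset.sum_insert ha, normalTrace_add, ih]

theorem rtBasis_fst_mem_direction (k : Fin (d + 1)) :
    (rtBasis T k).1 ∈ (affineSpan ℝ (range T.points)).direction :=
  Submodule.smul_mem _ _ (AffineSubspace.vsub_mem_direction (point_mem_span T 0)
    (point_mem_span T k))

theorem normal_mem_direction (k : Fin (d + 1)) :
    normal T k ∈ (affineSpan ℝ (range T.points)).direction := by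
  refine Submodule.smul_mem _ _ (AffineSubspace.vsub_mem_direction ?_ (point_mem_span T k))
  by_cases hd : d = 0
  · simpa [foot, hd] using point_mem_span T k
  · have : NeZero d := ⟨hd⟩
    rw [foot_eq]
    exact T.altitudeFoot_mem_affineSpan k

theorem rtEval_mem_direction {v : E n × ℝ}
    (hv : v.1 ∈ (affineSpan ℝ (range T.points)).direction) {x : E n}
    (hx : x ∈ affineSpan ℝ (range T.points)) :
    rtEval T v x ∈ (affineSpan ℝ (range T.points)).direction :=
  Submodule.add_mem _ hv (Submodule.smul_mem _ _
    (AffineSubspace.vsub_mem_direction hx (point_mem_span T 0)))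

/-- The point `w + T.points j` has the same barycentric coordinates as the vertex `j`: those with
index other than `j` are unchanged by a vector orthogonal to their normals, and the last one follows
from the sum. -/
theorem eq_zero_of_inner_normal [NeZero d] (j : Fin (d + 1)) {w : E n}
    (hw : w ∈ (affineSpan ℝ (range T.points)).direction)
    (h : ∀ k, k ≠ j → ⟪w, normal T k⟫_ℝ = 0) : w = 0 := by
  have hmem : w + T.points j ∈ affineSpan ℝ (range T.points) :=
    AffineSubspace.vadd_mem_of_mem_direction hw (point_mem_span T j)
  have hk : ∀ k, k ≠ j → bary T k (w + T.points j) = 0 := by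
    intro k hkj
    have h1 : foot T k - (w + T.points j) = foot T k - T.points j - w := by abel
    rw [bary_apply, h1, inner_sub_left, h k hkj, inner_foot_sub_point_normal, if_neg hkj]
    simp
  have hj : bary T j (w + T.points j) = 1 := by
    rw [← sum_bary T hmem]
    exact (Finset.sum_eq_single j (fun k _ hkj => hk k hkj) (by simp)).symm
  obtain ⟨h1, h2⟩ := affineCombination_bary T hmem
  obtain ⟨h3, h4⟩ := affineCombination_bary T (point_mem_span T j)
  have h5 : (fun i => bary T i (w + T.points j)) = fun i => bary T i (T.points j) := by
    funext i
    by_cases hi : i = j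
    · rw [hi, hj, bary_point, if_pos rfl]
    · rw [hk i hi, bary_point, if_neg hi]
  rw [h5, h4] at h2
  simpa using h2.symm

/-- A Raviart–Thomas field with vanishing normal components is zero. -/
theorem eq_zero_of_normalTrace [NeZero d] {v : E n × ℝ}
    (hv : v.1 ∈ (affineSpan ℝ (range T.points)).direction) (h : ∀ k, normalTrace T k v = 0) :
    v = 0 := by
  -- The vertex `j` lies on all facets except its own, so the value there is orthogonal to the
  -- normals of all these facets.
  have hpt : ∀ j, rtEval T v (T.points j) = 0 := fun j =>
    eq_zero_of_inner_normal T j (rtEval_mem_direction T hv (point_mem_span T j)) fun k hk => by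
      rw [← normalTrace_eq_of_bary_eq_zero T (by rw [bary_point, if_neg hk]), h k]
  have h0 : v.1 = 0 := by simpa [rtEval] using hpt 0
  have hne : (0 : Fin (d + 1)) ≠ Fin.last d := by
    intro h
    exact NeZero.ne d (by simpa using (congrArg Fin.val h).symm)
  have h1 := hpt (Fin.last d)
  rw [rtEval, h0, zero_add, smul_eq_zero, sub_eq_zero] at h1
  exact Prod.ext h0 (h1.resolve_right fun h => hne (T.independent.injective h).symm)

theorem eq_sum_normalTrace_smul_rtBasis [NeZero d] {v : E n × ℝ}
    (hv : v.1 ∈ (affineSpan ℝ (range T.points)).direction) :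
    v = ∑ k, normalTrace T k v • rtBasis T k := by
  rw [← sub_eq_zero]
  refine eq_zero_of_normalTrace T ?_ fun k => ?_
  · rw [Prod.fst_sub, Prod.fst_sum]
    exact Submodule.sub_mem _ hv (Submodule.sum_mem _ fun k _ =>
      Submodule.smul_mem _ _ (rtBasis_fst_mem_direction T k))
  · rw [sub_eq_add_neg, ← neg_one_smul ℝ, normalTrace_add, normalTrace_smul, normalTrace_sum]
    simp [normalTrace_smul, normalTrace_rtBasis]

end RaviartThomas

/-! ### Positive definite tensors -/

section Tensor

variable {n : ℕ} {κ : E n ≃ₗ[ℝ] E n}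

theorem inner_symm_comm (hs : ∀ u v, ⟪κ u, v⟫_ℝ = ⟪u, κ v⟫_ℝ) (u v : E n) :
    ⟪κ.symm u, v⟫_ℝ = ⟪κ.symm v, u⟫_ℝ := by
  have h := hs (κ.symm u) (κ.symm v)
  rw [κ.apply_symm_apply, κ.apply_symm_apply] at h
  rw [← h, real_inner_comm]

theorem inner_symm_self_pos (hp : ∀ v, v ≠ 0 → 0 < ⟪κ v, v⟫_ℝ) {u : E n} (hu : u ≠ 0) :
    0 < ⟪κ.symm u, u⟫_ℝ := by
  have h := hp (κ.symm u) (by simpa using hu)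
  rwa [κ.apply_symm_apply, real_inner_comm] at h

theorem inner_symm_self_nonneg (hp : ∀ v, v ≠ 0 → 0 < ⟪κ v, v⟫_ℝ) (u : E n) :
    0 ≤ ⟪κ.symm u, u⟫_ℝ := by
  by_cases hu : u = 0
  · simp [hu]
  · exact (inner_symm_self_pos hp hu).le

theorem inner_sq_le (hs : ∀ u v, ⟪κ u, v⟫_ℝ = ⟪u, κ v⟫_ℝ) (hp : ∀ v, v ≠ 0 → 0 < ⟪κ v, v⟫_ℝ)
    (u v : E n) : ⟪κ u, v⟫_ℝ ^ 2 ≤ ⟪κ u, u⟫_ℝ * ⟪κ v, v⟫_ℝ := by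
  let β : LinearMap.BilinForm ℝ (E n) := (innerₗ (E n)) ∘ₗ κ.toLinearMap
  have hβ : ∀ a b, β a b = ⟪κ a, b⟫_ℝ := fun a b => rfl
  have := LinearMap.BilinForm.apply_sq_le_of_symm β (fun x => ?_) ⟨fun a b => ?_⟩ u v
  · exact this
  · by_cases hx : x = 0
    · simp [hx]
    · exact (hp x hx).le
  · simp only [hβ, RingHom.id_apply]
    rw [hs, real_inner_comm]

variable {V : Submodule ℝ (E n)}

theorem symm_mem_of_mem (hV : ∀ v ∈ V, κ v ∈ V) {u : E n} (hu : u ∈ V) : κ.symm u ∈ V := by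
  have hle : V.map κ.toLinearMap ≤ V := by
    rintro _ ⟨v, hv, rfl⟩
    exact hV v hv
  have heq : V.map κ.toLinearMap = V :=
    Submodule.eq_of_le_of_finrank_eq hle (LinearEquiv.finrank_map_eq κ V)
  rw [← heq] at hu
  obtain ⟨v, hv, rfl⟩ := hu
  simpa using hv

/-- The bounds on unit vectors extend to all of `V` by homogeneity. The vector `e` provides one
reference Rayleigh quotient for the whole tensor. -/
theorem inner_le_of_unit {θ : ℝ} {e : E n}
    (h : ∀ u ∈ V, ‖u‖ = 1 → ⟪κ u, u⟫_ℝ ≤ θ * ⟪κ e, e⟫_ℝ) {u : E n} (hu : u ∈ V) :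
    ⟪κ u, u⟫_ℝ ≤ θ * ⟪κ e, e⟫_ℝ * ‖u‖ ^ 2 := by
  by_cases h0 : u = 0
  · simp [h0]
  have hn : ‖u‖ ≠ 0 := norm_ne_zero_iff.2 h0
  have h1 := h (‖u‖⁻¹ • u) (V.smul_mem _ hu) (by rw [norm_smul, norm_inv, norm_norm,
    inv_mul_cancel₀ hn])
  rw [map_smul, real_inner_smul_left, real_inner_smul_right] at h1
  have h2 : ⟪κ u, u⟫_ℝ = ‖u‖⁻¹ * (‖u‖⁻¹ * ⟪κ u, u⟫_ℝ) * ‖u‖ ^ 2 := by field_simp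
  rw [h2]
  exact mul_le_mul_of_nonneg_right h1 (sq_nonneg _)

theorem inner_ge_of_unit {θ : ℝ} {e : E n}
    (h : ∀ u ∈ V, ‖u‖ = 1 → ⟪κ e, e⟫_ℝ ≤ θ * ⟪κ u, u⟫_ℝ) {u : E n} (hu : u ∈ V) :
    ⟪κ e, e⟫_ℝ * ‖u‖ ^ 2 ≤ θ * ⟪κ u, u⟫_ℝ := by
  by_cases h0 : u = 0
  · simp [h0]
  have hn : ‖u‖ ≠ 0 := norm_ne_zero_iff.2 h0
  have h1 := h (‖u‖⁻¹ • u) (V.smul_mem _ hu) (by rw [norm_smul, norm_inv, norm_norm,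
    inv_mul_cancel₀ hn])
  rw [map_smul, real_inner_smul_left, real_inner_smul_right] at h1
  have h2 : θ * ⟪κ u, u⟫_ℝ = θ * (‖u‖⁻¹ * (‖u‖⁻¹ * ⟪κ u, u⟫_ℝ)) * ‖u‖ ^ 2 := by field_simp
  rw [h2]
  exact mul_le_mul_of_nonneg_right h1 (sq_nonneg _)

/-- Upper bound for the inverse of a tensor whose Rayleigh quotients on `V` are comparable. -/
theorem inner_symm_self_le (hV : ∀ v ∈ V, κ v ∈ V) {θ : ℝ} (hθ : 0 < θ) {e : E n}
    (hpe : 0 < ⟪κ e, e⟫_ℝ) (h : ∀ u ∈ V, ‖u‖ = 1 → ⟪κ e, e⟫_ℝ ≤ θ * ⟪κ u, u⟫_ℝ)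
    {u : E n} (hu : u ∈ V) : ⟪κ e, e⟫_ℝ * ⟪κ.symm u, u⟫_ℝ ≤ θ * ‖u‖ ^ 2 := by
  have h1 := inner_ge_of_unit h (symm_mem_of_mem hV hu)
  rw [κ.apply_symm_apply, real_inner_comm _ u] at h1
  have h2 := real_inner_le_norm (κ.symm u) u
  -- The lower bound at `κ.symm u` and the Cauchy–Schwarz inequality, with one factor `‖κ.symm u‖`
  -- cancelled.
  have h3 : ⟪κ e, e⟫_ℝ * ‖κ.symm u‖ ≤ θ * ‖u‖ := by
    by_cases h0 : ‖κ.symm u‖ = 0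
    · rw [h0, mul_zero]
      positivity
    · have h4 : 0 < ‖κ.symm u‖ := lt_of_le_of_ne (norm_nonneg _) (Ne.symm h0)
      refine le_of_mul_le_mul_right ?_ h4
      nlinarith [mul_le_mul_of_nonneg_left h2 hθ.le]
  calc ⟪κ e, e⟫_ℝ * ⟪κ.symm u, u⟫_ℝ ≤ ⟪κ e, e⟫_ℝ * (‖κ.symm u‖ * ‖u‖) :=
        mul_le_mul_of_nonneg_left h2 hpe.le
    _ = ⟪κ e, e⟫_ℝ * ‖κ.symm u‖ * ‖u‖ := by ring
    _ ≤ θ * ‖u‖ * ‖u‖ := mul_le_mul_of_nonneg_right h3 (norm_nonneg _)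
    _ = θ * ‖u‖ ^ 2 := by ring

/-- Lower bound for the inverse of a tensor whose Rayleigh quotients on `V` are comparable. -/
theorem norm_sq_le_inner_symm (hs : ∀ u v, ⟪κ u, v⟫_ℝ = ⟪u, κ v⟫_ℝ)
    (hp : ∀ v, v ≠ 0 → 0 < ⟪κ v, v⟫_ℝ) {θ : ℝ} {e : E n}
    (h : ∀ u ∈ V, ‖u‖ = 1 → ⟪κ u, u⟫_ℝ ≤ θ * ⟪κ e, e⟫_ℝ) {u : E n} (hu : u ∈ V) :
    ‖u‖ ^ 2 ≤ θ * ⟪κ e, e⟫_ℝ * ⟪κ.symm u, u⟫_ℝ := by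
  by_cases h0 : u = 0
  · simp [h0]
  have hn : 0 < ‖u‖ ^ 2 := by have := norm_pos_iff.2 h0; positivity
  -- The Cauchy–Schwarz inequality of the form of `κ` at `κ.symm u` and `u`; its left side is the
  -- fourth power of `‖u‖`.
  have h1 := inner_sq_le hs hp (κ.symm u) u
  rw [κ.apply_symm_apply, real_inner_self_eq_norm_sq, real_inner_comm] at h1
  have h2 := mul_le_mul_of_nonneg_left (inner_le_of_unit h hu) (inner_symm_self_nonneg hp u)
  refine le_of_mul_le_mul_right ?_ hn
  linarith

end Tensor

/-! ### The weighted `L²` product -/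

section CellProduct

variable {n d : ℕ} (T : Affine.Simplex ℝ (E n) d) {κ : E n ≃ₗ[ℝ] E n}

theorem cellProduct_comm (hs : ∀ u v, ⟪κ u, v⟫_ℝ = ⟪u, κ v⟫_ℝ) (u v : E n × ℝ) :
    cellProduct T κ u v = cellProduct T κ v u := by
  simp only [cellProduct]
  congr 1
  funext x
  exact inner_symm_comm hs _ _

theorem cellProduct_self_nonneg (hp : ∀ v, v ≠ 0 → 0 < ⟪κ v, v⟫_ℝ) (v : E n × ℝ) :
    0 ≤ cellProduct T κ v v :=
  integral_nonneg fun _ => inner_symm_self_nonneg hp _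

theorem cellProduct_zero (v : E n × ℝ) : cellProduct T κ 0 v = 0 := by
  simpa using cellProduct_smul_left T κ 0 0 v

/-- A nonzero Raviart–Thomas field has at most one zero, as it is a nonzero constant or a multiple
of the distance vector from one point. -/
theorem rtEval_eq_zero_subset {v : E n × ℝ} (hv : v ≠ 0) {x : E n} (hx : rtEval T v x = 0) :
    x = T.points 0 - v.2⁻¹ • v.1 := by
  rw [rtEval] at hx
  by_cases h2 : v.2 = 0
  · rw [h2, zero_smul, add_zero] at hx
    exact absurd (Prod.ext hx h2) hv
  · have h3 : v.2⁻¹ • v.1 + (x - T.points 0) = 0 := by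
      have h4 := congrArg (v.2⁻¹ • ·) hx
      simpa only [smul_add, smul_smul, inv_mul_cancel₀ h2, one_smul, smul_zero] using h4
    rw [eq_neg_of_add_eq_zero_left h3]
    abel

/-- The integrand is positive off the only possible zero of the field, and in positive dimension a
single point is a null set. -/
theorem cellProduct_self_pos (hd : d ≠ 0) (hp : ∀ v, v ≠ 0 → 0 < ⟪κ v, v⟫_ℝ) {v : E n × ℝ}
    (hv : v ≠ 0) : 0 < cellProduct T κ v v := by
  rw [cellProduct, setIntegral_pos_iff_support_of_nonneg_ae
    (Filter.Eventually.of_forall fun _ => inner_symm_self_nonneg hp _)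
    (cellProduct_integrable T κ v v)]
  have hsub : T.closedInterior \ {T.points 0 - v.2⁻¹ • v.1} ⊆
      (Function.support fun x => ⟪κ.symm (rtEval T v x), rtEval T v x⟫_ℝ) ∩ T.closedInterior := by
    rintro x ⟨hx, hne⟩
    exact ⟨(inner_symm_self_pos hp fun h => hne (rtEval_eq_zero_subset T hv h)).ne', hx⟩
  refine lt_of_lt_of_le ?_ (measure_mono hsub)
  rw [measure_sdiff_null (measure_singleton_eq_zero hd _)]
  exact measure_closedInterior_pos T

/-- The weighted `L²` product as a bilinear form. -/
def cellForm (κ : E n ≃ₗ[ℝ] E n) : LinearMap.BilinForm ℝ (E n × ℝ) :=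
  LinearMap.mk₂ ℝ (cellProduct T κ) (cellProduct_add_left T κ) (cellProduct_smul_left T κ)
    (cellProduct_add_right T κ) (cellProduct_smul_right T κ)

end CellProduct

/-- The square of a sum of finitely many vectors in a positive semidefinite form. -/
theorem bilinForm_sum_self_le {X ι : Type*} [AddCommGroup X] [Module ℝ X] [Fintype ι]
    (β : LinearMap.BilinForm ℝ X) (hβ : ∀ x, 0 ≤ β x x) (x : ι → X) :
    β (∑ i, x i) (∑ i, x i) ≤ Fintype.card ι * ∑ i, β (x i) (x i) := by
  -- Expansion of the nonnegative value at `x i - x j`. Both mixed terms are kept because `β` need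
  -- not be symmetric.
  have h1 : ∀ i j, β (x i) (x j) + β (x j) (x i) ≤ β (x i) (x i) + β (x j) (x j) := by
    intro i j
    have := hβ (x i - x j)
    simp only [map_sub, LinearMap.sub_apply] at this
    linarith
  have h2 : β (∑ i, x i) (∑ i, x i) = ∑ i, ∑ j, β (x i) (x j) := by
    simp only [map_sum, LinearMap.sum_apply]
    exact Finset.sum_comm
  have h3 : ∑ i, ∑ j, (β (x i) (x j) + β (x j) (x i)) ≤
      ∑ i, ∑ j, (β (x i) (x i) + β (x j) (x j)) :=
    Finset.sum_le_sum fun i _ => Finset.sum_le_sum fun j _ => h1 i j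
  have h4 : ∑ i, ∑ j, β (x j) (x i) = ∑ i, ∑ j, β (x i) (x j) := Finset.sum_comm
  simp only [Finset.sum_add_distrib, h4, Finset.sum_const, Finset.card_univ, nsmul_eq_mul,
    ← Finset.mul_sum] at h3
  rw [h2]
  linarith

section CellProduct

variable {n d : ℕ} (T : Affine.Simplex ℝ (E n) d) {κ : E n ≃ₗ[ℝ] E n}

/-- The mass matrix is bounded by its diagonal. -/
theorem cellProduct_self_le_diagonal [NeZero d] (hp : ∀ v, v ≠ 0 → 0 < ⟪κ v, v⟫_ℝ) {v : E n × ℝ}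
    (hv : v.1 ∈ (affineSpan ℝ (range T.points)).direction) :
    cellProduct T κ v v ≤ (d + 1) * ∑ k, normalTrace T k v * normalTrace T k v *
      cellProduct T κ (rtBasis T k) (rtBasis T k) := by
  have h := bilinForm_sum_self_le (cellForm T κ) (cellProduct_self_nonneg T hp)
    fun k => normalTrace T k v • rtBasis T k
  rw [← eq_sum_normalTrace_smul_rtBasis T hv] at h
  simp only [Fintype.card_fin, map_smul, LinearMap.smul_apply, smul_eq_mul, ← mul_assoc] at h
  push_cast at h
  exact h

end CellProduct

/-! ### The mass matrix on shape regular simplices -/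

section ShapeRegularSimplex

variable {n d : ℕ} (T : Affine.Simplex ℝ (E n) d)

theorem vol_inter_closedBall {x : E n} (hx : x ∈ affineSpan ℝ (range T.points)) {r : ℝ}
    (hr : 0 ≤ r) :
    vol d ((affineSpan ℝ (range T.points) : Set (E n)) ∩ Metric.closedBall x r) =
      r ^ d * (unitBallVolume (affineSpan ℝ (range T.points)).direction).toReal := by
  rw [vol, Measure.real, measure_inter_closedBall (finrank_direction_span T) hx hr,
    ENNReal.toReal_mul, ENNReal.toReal_ofReal (pow_nonneg hr d)]

theorem unitBallVolume_toReal_pos (V : Submodule ℝ (E n)) : 0 < (unitBallVolume V).toReal :=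
  ENNReal.toReal_pos (unitBallVolume_pos V).ne' (unitBallVolume_lt_top V).ne

variable {T} {x : E n} {r σ : ℝ}

/-- A ball in a simplex is not wider than the heights of the simplex. -/
theorem le_height_of_ball_subset [NeZero d] (hx : x ∈ affineSpan ℝ (range T.points)) (hr : 0 < r)
    (hball : Metric.closedBall x r ∩ affineSpan ℝ (range T.points) ⊆ T.closedInterior)
    (k : Fin (d + 1)) : r ≤ height T k := by
  -- The diameter of the ball along the normal has length `2 * r` and stays in the simplex, where
  -- the coordinate of `k` ranges between 0 and 1 with slope the inverse height. This gives even `2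
  -- * r ≤ height T k`.
  have hmem : ∀ t : ℝ, |t| ≤ r → x + t • normal T k ∈ T.closedInterior := by
    intro t ht
    refine hball ⟨?_, ?_⟩
    · rw [Metric.mem_closedBall, dist_eq_norm, add_sub_cancel_left, norm_smul, norm_normal, mul_one]
      exact ht
    · rw [add_comm x]
      exact AffineSubspace.vadd_mem_of_mem_direction
        (Submodule.smul_mem _ _ (normal_mem_direction T k)) hx
  have h1 := hmem r (abs_of_pos hr).le
  have h2 := hmem (-r) (by rw [abs_neg]; exact (abs_of_pos hr).le)
  rw [mem_closedInterior_iff] at h1 h2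
  have h3 : bary T k (x + (-r) • normal T k) ≤ 1 := by
    rw [← sum_bary T h2.1]
    exact Finset.single_le_sum (f := fun i => bary T i _) (fun i _ => h2.2 i) (Finset.mem_univ k)
  have h4 := h1.2 k
  have h5 : ∀ t : ℝ, bary T k (x + t • normal T k) = bary T k x - (height T k)⁻¹ * t := by
    intro t
    have : foot T k - (x + t • normal T k) = foot T k - x - t • normal T k := by abel
    rw [bary_apply, bary_apply, this, inner_sub_left (foot T k - x), real_inner_smul_left,
      real_inner_self_eq_norm_sq, norm_normal]
    ring
  rw [h5] at h3 h4
  have h6 : 2 * ((height T k)⁻¹ * r) ≤ 1 := by linarith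
  have hh := height_pos T k
  have h7 : 0 < (height T k)⁻¹ * r := by positivity
  have h8 : (height T k)⁻¹ * r ≤ 1 := by linarith
  rwa [inv_mul_le_iff₀ hh, mul_one] at h8

theorem isBounded_closedInterior : Bornology.IsBounded T.closedInterior :=
  T.isCompact_closedInterior.isBounded

/-- The simplex lies in the ball of radius `σ * r` around any of its points. -/
theorem vol_closedInterior_le (hx : x ∈ T.closedInterior) (hr : 0 < r) (hσ : 1 ≤ σ)
    (hdiam : Metric.diam T.closedInterior ≤ σ * r) :
    vol d T.closedInterior ≤
      σ ^ d * r ^ d * (unitBallVolume (affineSpan ℝ (range T.points)).direction).toReal := by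
  have hσr : 0 ≤ σ * r := by positivity
  rw [← mul_pow, ← vol_inter_closedBall T (T.closedInterior_subset_affineSpan hx) hσr]
  refine measureReal_mono (fun y hy => ⟨T.closedInterior_subset_affineSpan hy, ?_⟩) ?_
  · exact (Metric.dist_le_diam_of_mem isBounded_closedInterior hy hx).trans hdiam
  · refine (measure_lt_top_of_isBounded (finrank_direction_span T) ?_ inter_subset_left).ne
    exact Metric.isBounded_closedBall.subset inter_subset_right

/-- An affine field is bounded on the simplex by its mean square. -/
theorem norm_rtEval_sq_mul_le [NeZero d] (hx : x ∈ affineSpan ℝ (range T.points)) (hr : 0 < r)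
    (hσ : 1 ≤ σ)
    (hball : Metric.closedBall x r ∩ affineSpan ℝ (range T.points) ⊆ T.closedInterior)
    (hdiam : Metric.diam T.closedInterior ≤ σ * r) {v : E n × ℝ}
    (hv : v.1 ∈ (affineSpan ℝ (range T.points)).direction) {y : E n} (hy : y ∈ T.closedInterior) :
    ‖rtEval T v y‖ ^ 2 *
        (r ^ d * (unitBallVolume (affineSpan ℝ (range T.points)).direction).toReal) ≤
      2 * (1 + 4 * σ) ^ 2 * cellProduct T (LinearEquiv.refl ℝ (E n)) v v := by
  set P := affineSpan ℝ (range T.points) with hP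
  set ω := (unitBallVolume P.direction).toReal with hω
  have hω0 : 0 < ω := unitBallVolume_toReal_pos _
  -- The zero of the field if `v.2 ≠ 0`. For constant fields 0⁻¹ = 0 makes it a vertex, and its
  -- position does not matter.
  set c : E n := T.points 0 - v.2⁻¹ • v.1 with hc
  have hcP : c ∈ P := by
    have := AffineSubspace.vadd_mem_of_mem_direction (P.direction.smul_mem (-v.2⁻¹) hv)
      (point_mem_span T 0)
    rw [hc, sub_eq_neg_add, ← neg_smul]
    exact this
  have hev : ∀ z, v.2 ≠ 0 → ‖rtEval T v z‖ = |v.2| * dist z c := by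
    intro z h2
    have : rtEval T v z = v.2 • (z - c) := by
      rw [rtEval, hc, sub_sub_eq_add_sub, add_sub_right_comm, smul_add, smul_smul,
        mul_inv_cancel₀ h2, one_smul, add_comm]
    rw [this, norm_smul, dist_eq_norm, Real.norm_eq_abs]
  set B : Set (E n) := (P : Set (E n)) ∩ Metric.closedBall x r with hB
  -- A neighbourhood of the zero, where the field may be small compared with its value at `y`.
  set B' : Set (E n) := (P : Set (E n)) ∩ Metric.closedBall c (r / 4) with hB'
  have hBT : B ⊆ T.closedInterior := fun z hz => hball ⟨hz.2, hz.1⟩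
  have hPc : IsClosed (P : Set (E n)) := AffineSubspace.closed_of_finiteDimensional P
  have hBm : MeasurableSet B := (hPc.inter Metric.isClosed_closedBall).measurableSet
  have hB'm : MeasurableSet B' := (hPc.inter Metric.isClosed_closedBall).measurableSet
  -- pointwise comparison
  have hpt : ∀ z ∈ B \ B', ‖rtEval T v y‖ ≤ (1 + 4 * σ) * ‖rtEval T v z‖ := by
    rintro z ⟨hz, hz'⟩
    by_cases h2 : v.2 = 0
    · have h3 : ∀ w, rtEval T v w = v.1 := fun w => by rw [rtEval, h2, zero_smul, add_zero]
      rw [h3, h3]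
      nlinarith [norm_nonneg v.1]
    · rw [hev _ h2, hev _ h2]
      have h3 : r / 4 < dist z c := by
        by_contra h
        exact hz' ⟨hz.1, Metric.mem_closedBall.2 (not_lt.1 h)⟩
      have h4 : dist y z ≤ σ * r :=
        (Metric.dist_le_diam_of_mem isBounded_closedInterior hy (hBT hz)).trans hdiam
      have h5 := dist_triangle y z c
      -- Since `r < 4 * dist z c`, the distance from `y` to `z`, at most `σ * r`, is at most `4 * σ
      -- * dist z c`.
      have h6 : dist y c ≤ (1 + 4 * σ) * dist z c := by nlinarith
      calc |v.2| * dist y c ≤ |v.2| * ((1 + 4 * σ) * dist z c) :=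
            mul_le_mul_of_nonneg_left h6 (abs_nonneg _)
        _ = _ := by ring
  -- the measure of the region
  have hfinB : (Measure.euclideanHausdorffMeasure d : Measure (E n)) B ≠ ∞ :=
    ((measure_mono hBT).trans_lt (measure_closedInterior_lt_top T)).ne
  have hvolB : vol d B = r ^ d * ω := vol_inter_closedBall T hx hr.le
  have hvolB' : vol d B' = (r / 4) ^ d * ω := vol_inter_closedBall T hcP (by positivity)
  have hfinB' : (Measure.euclideanHausdorffMeasure d : Measure (E n)) B' ≠ ∞ := by
    refine (measure_lt_top_of_isBounded (finrank_direction_span T) ?_ inter_subset_left).ne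
    exact Metric.isBounded_closedBall.subset inter_subset_right
  have hd : (1 / 4 : ℝ) ^ d ≤ 1 / 4 := by
    calc (1 / 4 : ℝ) ^ d ≤ (1 / 4 : ℝ) ^ 1 :=
          pow_le_pow_of_le_one (by norm_num) (by norm_num) (NeZero.pos d)
      _ = 1 / 4 := pow_one _
  -- The removed ball takes at most a quarter of the volume because `d ≥ 1`; one half is a safe
  -- remainder.
  have hvol : r ^ d * ω / 2 ≤ vol d (B \ B') := by
    have h1 : vol d B ≤ vol d (B \ B') + vol d B' := by
      refine (measureReal_mono (fun z hz => ?_) ?_).trans (measureReal_union_le _ _)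
      · by_cases h : z ∈ B'
        · exact Or.inr h
        · exact Or.inl ⟨hz, h⟩
      · exact ((measure_union_le _ _).trans_lt (ENNReal.add_lt_top.2
          ⟨(measure_mono sdiff_subset).trans_lt hfinB.lt_top, hfinB'.lt_top⟩)).ne
    rw [hvolB, hvolB', div_eq_mul_one_div r 4, mul_pow] at h1
    have h2 : 0 < r ^ d * ω := by positivity
    nlinarith
  -- integration
  have hint := cellProduct_integrable T (LinearEquiv.refl ℝ (E n)) v v
  have hSm : MeasurableSet (B \ B') := hBm.diff hB'm
  have hST : B \ B' ⊆ T.closedInterior := sdiff_subset.trans hBT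
  have h1 : ‖rtEval T v y‖ ^ 2 / (1 + 4 * σ) ^ 2 * vol d (B \ B') ≤
      cellProduct T (LinearEquiv.refl ℝ (E n)) v v := by
    refine (setIntegral_ge_of_const_le_real (c := ‖rtEval T v y‖ ^ 2 / (1 + 4 * σ) ^ 2) hSm ?_
      (fun z hz => ?_) (hint.mono_set hST)).trans
      (setIntegral_mono_set hint (Filter.Eventually.of_forall fun z => ?_)
        (Filter.Eventually.of_forall hST))
    · exact ((measure_mono sdiff_subset).trans_lt hfinB.lt_top).ne
    · rw [div_le_iff₀ (by positivity)]
      have h3 := pow_le_pow_left₀ (norm_nonneg _) (hpt z hz) 2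
      change _ ≤ ⟪rtEval T v z, rtEval T v z⟫_ℝ * _
      rw [real_inner_self_eq_norm_sq]
      linarith
    · exact real_inner_self_nonneg (x := rtEval T v z)
  have h2 : ‖rtEval T v y‖ ^ 2 / (1 + 4 * σ) ^ 2 * (r ^ d * ω / 2) ≤
      cellProduct T (LinearEquiv.refl ℝ (E n)) v v :=
    (mul_le_mul_of_nonneg_left hvol (by positivity)).trans h1
  have h3 : 0 < (1 + 4 * σ) ^ 2 := by positivity
  calc ‖rtEval T v y‖ ^ 2 * (r ^ d * ω)
      = 2 * (1 + 4 * σ) ^ 2 * (‖rtEval T v y‖ ^ 2 / (1 + 4 * σ) ^ 2 * (r ^ d * ω / 2)) := by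
        field_simp
    _ ≤ _ := mul_le_mul_of_nonneg_left h2 (by positivity)

/-- A basis field is at most diameter over height, hence at most `σ`, since the height is at least
`r`. The remaining factor is the bound on the volume. -/
theorem rtBasis_cellProduct_le [NeZero d] (hx : x ∈ affineSpan ℝ (range T.points)) (hr : 0 < r)
    (hσ : 1 ≤ σ)
    (hball : Metric.closedBall x r ∩ affineSpan ℝ (range T.points) ⊆ T.closedInterior)
    (hdiam : Metric.diam T.closedInterior ≤ σ * r) (k : Fin (d + 1)) :
    cellProduct T (LinearEquiv.refl ℝ (E n)) (rtBasis T k) (rtBasis T k) ≤ σ ^ (d + 2) *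
      (r ^ d * (unitBallVolume (affineSpan ℝ (range T.points)).direction).toReal) := by
  have hh := height_pos T k
  have hrh := le_height_of_ball_subset hx hr hball k
  have hxT : x ∈ T.closedInterior := hball ⟨Metric.mem_closedBall_self hr.le, hx⟩
  have hpt : ∀ z ∈ T.closedInterior,
      ⟪(LinearEquiv.refl ℝ (E n)).symm (rtEval T (rtBasis T k) z), rtEval T (rtBasis T k) z⟫_ℝ ≤
        σ ^ 2 := by
    intro z hz
    change ⟪rtEval T (rtBasis T k) z, rtEval T (rtBasis T k) z⟫_ℝ ≤ σ ^ 2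
    rw [real_inner_self_eq_norm_sq]
    refine pow_le_pow_left₀ (norm_nonneg _) ?_ 2
    rw [rtEval_rtBasis, norm_smul, norm_inv, Real.norm_of_nonneg hh.le, ← dist_eq_norm,
      inv_mul_le_iff₀ hh]
    have h1 := (Metric.dist_le_diam_of_mem isBounded_closedInterior hz
      (T.point_mem_closedInterior k)).trans hdiam
    nlinarith
  have h1 := setIntegral_mono_on (cellProduct_integrable T (LinearEquiv.refl ℝ (E n)) _ _)
    (integrableOn_const (measure_closedInterior_lt_top T).ne)
    T.isClosed_closedInterior.measurableSet hpt
  rw [setIntegral_const, smul_eq_mul] at h1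
  have h2 := vol_closedInterior_le hxT hr hσ hdiam
  calc _ ≤ _ := h1
    _ ≤ (σ ^ d * r ^ d * (unitBallVolume (affineSpan ℝ (range T.points)).direction).toReal)
        * σ ^ 2 := mul_le_mul_of_nonneg_right h2 (sq_nonneg σ)
    _ = _ := by ring

variable {κ : E n ≃ₗ[ℝ] E n} {θ : ℝ}

/-- The diagonal of the mass matrix is bounded by the mass matrix, uniformly for shape regular
simplices and tensors of bounded anisotropy. -/
theorem diagonal_le_cellProduct_self [NeZero d] (hx : x ∈ affineSpan ℝ (range T.points))
    (hr : 0 < r) (hσ : 1 ≤ σ)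
    (hball : Metric.closedBall x r ∩ affineSpan ℝ (range T.points) ⊆ T.closedInterior)
    (hdiam : Metric.diam T.closedInterior ≤ σ * r)
    (hV : ∀ v ∈ (affineSpan ℝ (range T.points)).direction,
      κ v ∈ (affineSpan ℝ (range T.points)).direction)
    (hs : ∀ u v, ⟪κ u, v⟫_ℝ = ⟪u, κ v⟫_ℝ) (hp : ∀ v, v ≠ 0 → 0 < ⟪κ v, v⟫_ℝ) (hθ : 1 ≤ θ)
    (hani : ∀ u ∈ (affineSpan ℝ (range T.points)).direction,
      ∀ v ∈ (affineSpan ℝ (range T.points)).direction, ‖u‖ = 1 → ‖v‖ = 1 →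
        ⟪κ u, u⟫_ℝ ≤ θ * ⟪κ v, v⟫_ℝ) {v : E n × ℝ}
    (hv : v.1 ∈ (affineSpan ℝ (range T.points)).direction) :
    ∑ k, normalTrace T k v * normalTrace T k v * cellProduct T κ (rtBasis T k) (rtBasis T k) ≤
      (d + 1) * (2 * θ ^ 2 * σ ^ (d + 2) * (1 + 4 * σ) ^ 2) * cellProduct T κ v v := by
  set V := (affineSpan ℝ (range T.points)).direction with hVdef
  set w := r ^ d * (unitBallVolume V).toReal with hw
  have hw0 : 0 < w := mul_pos (pow_pos hr d) (unitBallVolume_toReal_pos _)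
  have hθ0 : 0 < θ := by linarith
  have he := norm_normal T 0
  have heV := normal_mem_direction T 0
  -- The normal serves only as some unit tangent vector. The quotient `m` measures the size of `κ`
  -- and cancels at the end, leaving one factor `θ` from each of the two comparisons with the
  -- identity.
  set m := ⟪κ (normal T 0), normal T 0⟫_ℝ with hm
  have hm0 : 0 < m := hp _ fun h => by simp [h] at he
  have hTm := T.isClosed_closedInterior.measurableSet
  have hup : ∀ u : E n × ℝ, u.1 ∈ V →
      m * cellProduct T κ u u ≤ θ * cellProduct T (LinearEquiv.refl ℝ (E n)) u u := by
    intro u hu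
    rw [cellProduct, cellProduct, ← integral_const_mul, ← integral_const_mul]
    refine setIntegral_mono_on ((cellProduct_integrable T κ u u).const_mul _)
      ((cellProduct_integrable T _ u u).const_mul _) hTm fun z hz => ?_
    have h1 := inner_symm_self_le hV hθ0 hm0 (fun a ha ha1 => hani _ heV a ha he ha1)
      (rtEval_mem_direction T hu (T.closedInterior_subset_affineSpan hz))
    rw [← real_inner_self_eq_norm_sq] at h1
    exact h1
  have hlow : cellProduct T (LinearEquiv.refl ℝ (E n)) v v ≤ θ * m * cellProduct T κ v v := by
    rw [cellProduct, cellProduct, ← integral_const_mul]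
    refine setIntegral_mono_on (cellProduct_integrable T _ v v)
      ((cellProduct_integrable T κ v v).const_mul _) hTm fun z hz => ?_
    have h1 := norm_sq_le_inner_symm hs hp (fun a ha ha1 => hani a ha _ heV ha1 he)
      (rtEval_mem_direction T hv (T.closedInterior_subset_affineSpan hz))
    rw [← real_inner_self_eq_norm_sq] at h1
    exact h1
  have hterm : ∀ k, normalTrace T k v * normalTrace T k v *
      cellProduct T κ (rtBasis T k) (rtBasis T k) ≤
        2 * θ ^ 2 * σ ^ (d + 2) * (1 + 4 * σ) ^ 2 * cellProduct T κ v v := by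
    intro k
    obtain ⟨y, hy⟩ := openFacet_nonempty T (NeZero.ne d) k
    have hyT := closedFacet_subset_closedInterior T k (openFacet_subset_closedFacet T k hy)
    have ht : normalTrace T k v * normalTrace T k v ≤ ‖rtEval T v y‖ ^ 2 := by
      rw [normalTrace_eq_of_bary_eq_zero T ((mem_openFacet_iff T).1 hy).2.1, ← pow_two, ← sq_abs]
      refine pow_le_pow_left₀ (abs_nonneg _) ?_ 2
      have := abs_real_inner_le_norm (rtEval T v y) (normal T k)
      rwa [norm_normal, mul_one] at this
    have h1 := norm_rtEval_sq_mul_le hx hr hσ hball hdiam hv hyT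
    have h2 := rtBasis_cellProduct_le hx hr hσ hball hdiam k
    have h3 := hup _ (rtBasis_fst_mem_direction T k)
    set I := cellProduct T (LinearEquiv.refl ℝ (E n)) v v
    set J := cellProduct T κ v v
    set F := cellProduct T κ (rtBasis T k) (rtBasis T k)
    set G := cellProduct T (LinearEquiv.refl ℝ (E n)) (rtBasis T k) (rtBasis T k)
    have hF : 0 ≤ F := cellProduct_self_nonneg T hp _
    have h4 : m * F ≤ θ * (σ ^ (d + 2) * w) := h3.trans (mul_le_mul_of_nonneg_left h2 hθ0.le)
    have h5 : 0 ≤ ‖rtEval T v y‖ ^ 2 := sq_nonneg _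
    refine le_of_mul_le_mul_left ?_ hm0
    calc m * (normalTrace T k v * normalTrace T k v * F)
        ≤ m * (‖rtEval T v y‖ ^ 2 * F) :=
          mul_le_mul_of_nonneg_left (mul_le_mul_of_nonneg_right ht hF) hm0.le
      _ = ‖rtEval T v y‖ ^ 2 * (m * F) := by ring
      _ ≤ ‖rtEval T v y‖ ^ 2 * (θ * (σ ^ (d + 2) * w)) := mul_le_mul_of_nonneg_left h4 h5
      _ = θ * σ ^ (d + 2) * (‖rtEval T v y‖ ^ 2 * w) := by ring
      _ ≤ θ * σ ^ (d + 2) * (2 * (1 + 4 * σ) ^ 2 * I) :=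
          mul_le_mul_of_nonneg_left h1 (by positivity)
      _ ≤ θ * σ ^ (d + 2) * (2 * (1 + 4 * σ) ^ 2 * (θ * m * J)) := by
          gcongr
      _ = m * (2 * θ ^ 2 * σ ^ (d + 2) * (1 + 4 * σ) ^ 2 * J) := by ring
  refine (Finset.sum_le_sum fun k _ => hterm k).trans (le_of_eq ?_)
  rw [Finset.sum_const, Finset.card_univ, Fintype.card_fin, nsmul_eq_mul]
  push_cast
  ring

end ShapeRegularSimplex

/-! ### Simplices with a common facet -/

section CommonFacet

variable {n d : ℕ} {T T' : Affine.Simplex ℝ (E n) d}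

/-- Both coordinates are affine and vanish on the common facet, so on the plane they are
proportional. Their ratio is read off at the vertex opposite to the facet. -/
theorem bary_eq_mul_of_openFacet_eq (hd : d ≠ 0) {k k' : Fin (d + 1)}
    (h : openFacet T k = openFacet T' k') {x : E n} (hx : x ∈ affineSpan ℝ (range T.points)) :
    bary T' k' x = bary T k x * bary T' k' (T.points k) := by
  rw [affineMap_eq_sum_bary T _ hx]
  refine Finset.sum_eq_single k (fun i _ hi => ?_) (by simp)
  have h1 : T.points i ∈ closedFacet T k :=
    subset_convexHull ℝ _ (mem_image_of_mem _ (by simpa using hi))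
  rw [closedFacet_eq_closure T hd, h, ← closedFacet_eq_closure T' hd, mem_closedFacet_iff] at h1
  rw [h1.2.2, mul_zero]

/-- Simplices in the same plane with a common facet and disjoint interiors are on opposite sides of
the facet. -/
theorem bary_point_neg_of_openFacet_eq (hd : d ≠ 0)
    (hspan : affineSpan ℝ (range T.points) = affineSpan ℝ (range T'.points)) {k k' : Fin (d + 1)}
    (h : openFacet T k = openFacet T' k') (hdisj : Disjoint (openCell T) (openCell T')) :
    bary T' k' (T.points k) < 0 := by
  -- If this value were zero, the coordinate would vanish on the whole plane, also at its own
  -- vertex, where it is 1.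
  have hne : bary T' k' (T.points k) ≠ 0 := by
    intro h0
    have h1 := bary_eq_mul_of_openFacet_eq hd h (x := T'.points k')
      (hspan ▸ point_mem_span T' k')
    rw [h0, mul_zero, bary_point, if_pos rfl] at h1
    exact one_ne_zero h1
  by_contra hneg
  have hpos : 0 < bary T' k' (T.points k) := lt_of_le_of_ne (not_lt.1 hneg) (Ne.symm hne)
  obtain ⟨p, hp⟩ := openFacet_nonempty T hd k
  have hp' := h ▸ hp
  rw [mem_openFacet_iff] at hp hp'
  -- Starting on the common facet, move slightly towards the vertex `k`. If both simplices lay on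
  -- the same side, the path would enter both open cells.
  set γ : ℝ → E n := fun t => AffineMap.lineMap p (T.points k) t with hγ
  have hcont : Continuous γ := AffineMap.lineMap_continuous
  have hev : ∀ᶠ t in 𝓝[>] (0 : ℝ), ∀ i, i ≠ k' → 0 < bary T' i (γ t) := by
    rw [Filter.eventually_all]
    intro i
    by_cases hi : i = k'
    · exact Filter.Eventually.of_forall fun _ hh => absurd hi hh
    · have hc : ContinuousAt (fun t => bary T' i (γ t)) 0 :=
        ((continuous_bary T' i).comp hcont).continuousAt
      have h0 : 0 < bary T' i (γ 0) := by
        simpa [hγ] using hp'.2.2 i hi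
      exact ((hc.eventually (lt_mem_nhds h0)).filter_mono nhdsWithin_le_nhds).mono
        fun t ht _ => ht
  obtain ⟨t, ht, ht0, ht1⟩ := (hev.and (Ioo_mem_nhdsGT (zero_lt_one' ℝ))).exists
  have hspt : γ t ∈ affineSpan ℝ (range T.points) :=
    AffineMap.lineMap_mem _ hp.1 (point_mem_span T k)
  have hk : bary T k (γ t) = t := by
    rw [hγ, bary_lineMap, hp.2.1, bary_point, if_pos rfl]
    ring
  suffices h1 : γ t ∈ openCell T ∧ γ t ∈ openCell T' from Set.disjoint_left.1 hdisj h1.1 h1.2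
  constructor
  · rw [mem_openCell_iff]
    refine ⟨hspt, fun i => ?_⟩
    by_cases hi : i = k
    · rw [hi, hk]
      exact ht0
    · rw [hγ, bary_lineMap, bary_point, if_neg hi, mul_zero, add_zero]
      exact mul_pos (sub_pos.2 ht1) (hp.2.2 i hi)
  · rw [mem_openCell_iff]
    refine ⟨hspan ▸ hspt, fun i => ?_⟩
    by_cases hi : i = k'
    · rw [hi, bary_eq_mul_of_openFacet_eq hd h hspt, hk]
      exact mul_pos ht0 hpos
    · exact ht i hi

/-- The coordinates of all vertices that are not shared vanish at `x`. As at most one coordinate of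
`x` vanishes and the vertex sets differ, exactly one vertex is not shared, and the common face is a
facet with `x` in its interior. -/
theorem exists_openFacet_of_mem_convexHull_inter {x : E n}
    (hx : x ∈ convexHull ℝ (range T.points ∩ range T'.points))
    (hgen : ∀ i j, i ≠ j → bary T i x = 0 → bary T j x ≠ 0)
    (hne : range T.points ≠ range T'.points) :
    ∃ k, range T.points ∩ range T'.points = T.points '' {k}ᶜ ∧ x ∈ openFacet T k := by
  set A : Set (Fin (d + 1)) := {i | T.points i ∈ range T'.points} with hA
  have himg : range T.points ∩ range T'.points = T.points '' A := by
    ext y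
    constructor
    · rintro ⟨⟨i, rfl⟩, hi⟩
      exact ⟨i, hi, rfl⟩
    · rintro ⟨i, hi, rfl⟩
      exact ⟨⟨i, rfl⟩, hi⟩
  rw [himg, mem_convexHull_image_iff] at hx
  obtain ⟨k, hk⟩ : ∃ k, k ∉ A := by
    by_contra! hall
    refine hne (Set.eq_of_subset_of_ncard_le ?_ ?_ (finite_range _))
    · rintro _ ⟨i, rfl⟩
      exact hall i
    · rw [← image_univ, ← image_univ, ncard_image_of_injective _ T.independent.injective,
        ncard_image_of_injective _ T'.independent.injective]
  have hAk : A = {k}ᶜ := by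
    ext i
    constructor
    · rintro hi rfl
      exact hk hi
    · intro hi
      by_contra hiA
      exact hgen i k hi (hx.2.2 i hiA) (hx.2.2 k hk)
  refine ⟨k, by rw [himg, hAk], ?_⟩
  rw [mem_openFacet_iff]
  exact ⟨hx.1, hx.2.2 k hk, fun i hi => lt_of_le_of_ne (hx.2.1 i)
    (Ne.symm (hgen k i (Ne.symm hi) (hx.2.2 k hk)))⟩

end CommonFacet

/-! ### Facets of a mesh -/

namespace Mesh

variable {n : ℕ} {G : Geometry n} (M : Mesh G)

theorem _root_.MixedDim.Geometry.Ω_subset_plane (G : Geometry n) (s : G.Sub) :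
    G.Ω s ⊆ G.plane s := by
  obtain ⟨U, -, h⟩ := G.relOpen s
  rw [h]
  exact inter_subset_right

theorem openCell_subset {s : G.Sub} (c : M.Cell s) : openCell (M.simplex c) ⊆ G.Ω s :=
  (M.partitions s).2.1 c

theorem disjoint_openCell {s : G.Sub} {c c' : M.Cell s} (h : c ≠ c') :
    Disjoint (openCell (M.simplex c)) (openCell (M.simplex c')) :=
  (M.partitions s).2.2 h

theorem span_eq {s : G.Sub} (c : M.Cell s) :
    affineSpan ℝ (range (M.simplex c).points) = G.plane s :=
  affineSpan_eq_of_openCell_subset _ (G.finrank_plane s)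
    ((M.openCell_subset c).trans (G.Ω_subset_plane s))

theorem notMem_Ω_of_mem_dirichlet {x : E n} (h : x ∈ G.dirichlet) (s : G.Sub) : x ∉ G.Ω s := by
  have h1 : x ∈ closure (⋃ s, G.Ω s) \ ⋃ s, G.Ω s := G.boundary_eq ▸ Or.inl h
  exact fun hx => h1.2 (mem_iUnion.2 ⟨s, hx⟩)

theorem notMem_Ω_of_mem_neumann {x : E n} (h : x ∈ G.neumann) (s : G.Sub) : x ∉ G.Ω s := by
  have h1 : x ∈ closure (⋃ s, G.Ω s) \ ⋃ s, G.Ω s := G.boundary_eq ▸ Or.inr h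
  exact fun hx => h1.2 (mem_iUnion.2 ⟨s, hx⟩)

theorem eq_of_mem_Ω {x : E n} {s t : G.Sub} (hs : x ∈ G.Ω s) (ht : x ∈ G.Ω t) : s = t := by
  by_contra h
  exact Set.disjoint_left.1 (G.disjoint h) hs ht

theorem hi_ne_lo (g : G.Interface) : G.hi g ≠ G.lo g := by
  intro h
  have := G.dim_hi g
  rw [h] at this
  omega

/-- The alternatives of `Mesh.resolved` exclude one another because subdomains and the two boundary
parts are disjoint; one point decides which of them holds. -/
theorem openFacet_subset_of_mem {s : G.Sub} (c : M.Cell s) {k : Fin (G.dim s + 1)} {x : E n}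
    (hx : x ∈ openFacet (M.simplex c) k) (hxs : x ∈ G.Ω s) :
    openFacet (M.simplex c) k ⊆ G.Ω s := by
  rcases M.resolved s c k with h | ⟨g, hg, h, -⟩ | h | h
  · exact h
  · exact absurd (hg.trans (eq_of_mem_Ω hxs (h hx))) (hi_ne_lo g)
  · exact absurd hxs (notMem_Ω_of_mem_dirichlet (h hx) s)
  · exact absurd hxs (notMem_Ω_of_mem_neumann (h hx) s)

/-- Two different elements share a facet inside their subdomain. -/
def Adjacent {s : G.Sub} (c c' : M.Cell s) : Prop :=
  c ≠ c' ∧ ∃ k k', openFacet (M.simplex c) k = openFacet (M.simplex c') k' ∧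
    openFacet (M.simplex c) k ⊆ G.Ω s

/-- Conformity puts a common point into the hull of the common vertices. A generic point avoids all
faces of codimension two, so this hull is a facet of both elements. -/
theorem adjacent_of_mem {s : G.Sub} {c c' : M.Cell s} (hcc : c ≠ c') {x : E n}
    (hx : x ∈ (M.simplex c).closedInterior) (hx' : x ∈ (M.simplex c').closedInterior)
    (hxs : x ∈ G.Ω s)
    (hgen : ∀ (e : M.Cell s) i j, i ≠ j → bary (M.simplex e) i x = 0 →
      bary (M.simplex e) j x ≠ 0) : M.Adjacent c c' := by
  have hconf := M.conforming s c c' ⟨⟨hx, hx'⟩, hxs⟩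
  have hne : range (M.simplex c).points ≠ range (M.simplex c').points := by
    intro h
    have h1 : openCell (M.simplex c) = openCell (M.simplex c') := by
      rw [openCell_eq_hullInterior, openCell_eq_hullInterior, h]
    obtain ⟨y, hy⟩ := openCell_nonempty (M.simplex c)
    exact Set.disjoint_left.1 (M.disjoint_openCell hcc) hy (h1 ▸ hy)
  obtain ⟨k, hk, hxk⟩ := exists_openFacet_of_mem_convexHull_inter hconf (hgen c) hne
  rw [inter_comm] at hconf
  obtain ⟨k', hk', -⟩ := exists_openFacet_of_mem_convexHull_inter hconf (hgen c') hne.symm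
  refine ⟨hcc, k, k', ?_, M.openFacet_subset_of_mem c hxk hxs⟩
  rw [openFacet_eq_hullInterior, openFacet_eq_hullInterior, ← hk, ← hk', inter_comm]

theorem Ω_subset_iUnion (s : G.Sub) : G.Ω s ⊆ ⋃ c : M.Cell s, (M.simplex c).closedInterior := by
  rw [(M.partitions s).1]
  exact subset_closure

/-- A set of elements of a subdomain that contains the neighbours of its members contains no or
all elements. -/
theorem mem_of_adjacent_closed {s : G.Sub} (I : Set (M.Cell s))
    (hI : ∀ c ∈ I, ∀ c', M.Adjacent c c' → c' ∈ I) {c₀ : M.Cell s} (h₀ : c₀ ∈ I)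
    (c₁ : M.Cell s) : c₁ ∈ I := by
  by_contra h₁
  set P := G.plane s with hP
  have hPd := G.finrank_plane s
  set UI : Set (E n) := ⋃ c ∈ I, (M.simplex c).closedInterior with hUI
  set UJ : Set (E n) := ⋃ c ∈ Iᶜ, (M.simplex c).closedInterior with hUJ
  have hUIc : IsClosed UI := I.toFinite.isClosed_biUnion fun c _ =>
    (M.simplex c).isClosed_closedInterior
  have hUJc : IsClosed UJ := Iᶜ.toFinite.isClosed_biUnion fun c _ =>
    (M.simplex c).isClosed_closedInterior
  have hcover : G.Ω s ⊆ UI ∪ UJ := by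
    intro x hx
    obtain ⟨c, hc⟩ := mem_iUnion.1 (M.Ω_subset_iUnion s hx)
    by_cases hcI : c ∈ I
    · exact Or.inl (mem_biUnion hcI hc)
    · exact Or.inr (mem_biUnion (show c ∈ Iᶜ from hcI) hc)
  have hmeet : ∀ c : M.Cell s, ∃ x ∈ G.Ω s, x ∈ (M.simplex c).closedInterior := fun c => by
    obtain ⟨x, hx⟩ := openCell_nonempty (M.simplex c)
    exact ⟨x, M.openCell_subset c hx, openCell_subset_closedInterior _ hx⟩
  -- Two closed sets that cover a connected set and both meet it have a common point in it. This
  -- point may lie on a low-dimensional face, so the elements found there need not share a facet;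
  -- the rest of the proof replaces it by a generic point nearby.
  obtain ⟨x, hxΩ, hxI, hxJ⟩ := isPreconnected_closed_iff.1 (G.isConnected s).isPreconnected UI UJ
    hUIc hUJc hcover
    (by obtain ⟨x, hx, hx'⟩ := hmeet c₀; exact ⟨x, hx, mem_biUnion h₀ hx'⟩)
    (by obtain ⟨x, hx, hx'⟩ := hmeet c₁; exact ⟨x, hx, mem_biUnion (show c₁ ∈ Iᶜ from h₁) hx'⟩)
  obtain ⟨c, hcI, hc⟩ := mem_iUnion₂.1 hxI
  obtain ⟨c', hcJ, hc'⟩ := mem_iUnion₂.1 hxJ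
  obtain ⟨U, hU, hΩ⟩ := G.relOpen s
  have hxU : x ∈ U := (hΩ ▸ hxΩ).1
  obtain ⟨ρ, hρ, hball⟩ := Metric.isOpen_iff.1 hU x hxU
  have hnear : ∀ e : M.Cell s, x ∈ (M.simplex e).closedInterior →
      ∃ y ∈ P, y ∈ Metric.ball x ρ ∩ {z | ∀ k ∈ univ, 0 < bary (M.simplex e) k z} := by
    intro e he
    rw [closedInterior_eq_closure] at he
    obtain ⟨y, hyb, hye⟩ := mem_closure_iff.1 he _ Metric.isOpen_ball (Metric.mem_ball_self hρ)
    rw [openCell_eq_inter, M.span_eq] at hye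
    exact ⟨y, hye.1, hyb, hye.2⟩
  have hopen : ∀ e : M.Cell s,
      IsOpen (Metric.ball x ρ ∩ {z | ∀ k ∈ univ, 0 < bary (M.simplex e) k z}) := fun e =>
    Metric.isOpen_ball.inter (isOpen_bary_pos _ _)
  have hcell : ∀ (e : M.Cell s) z, z ∈ P →
      z ∈ {z | ∀ k ∈ univ, 0 < bary (M.simplex e) k z} → z ∈ (M.simplex e).closedInterior := by
    intro e z hz hz'
    refine openCell_subset_closedInterior _ ?_
    rw [openCell_eq_inter, M.span_eq]
    exact ⟨hz, hz'⟩
  have hvert : ∀ (e : M.Cell s) k, (M.simplex e).points k ∈ P := fun e k => by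
    rw [hP, ← M.span_eq e]
    exact point_mem_span _ k
  obtain ⟨y₀, hy₀P, hy₀⟩ := hnear c hc
  -- A point of the open cell of `c` near `x` that is on none of the facet planes of the mesh.
  obtain ⟨y, hyP, hy, hyne⟩ := exists_mem_forall_ne_zero hPd (hopen c) hy₀P hy₀
    (fun i : M.Cell s × Fin (G.dim s + 1) => bary (M.simplex i.1) i.2)
    fun i => ⟨(M.simplex i.1).points i.2, hvert _ _, by simp [bary_point]⟩
  obtain ⟨z₀, hz₀P, hz₀⟩ := hnear c' hc'
  -- A point of the open cell of `c'` near `x` such that the segment from `y` to `z` meets no two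
  -- facet planes of one element at the same point. For each pair of coordinates this excludes the
  -- zeros of a 2×2 determinant, which is affine in `z` and nonzero at a vertex by the choice of
  -- `y`.
  obtain ⟨z, hzP, hz, hzne⟩ := exists_mem_forall_ne_zero hPd (hopen c') hz₀P hz₀
    (fun i : M.Cell s × {p : Fin (G.dim s + 1) × Fin (G.dim s + 1) // p.1 ≠ p.2} =>
      bary (M.simplex i.1) i.2.1.1 y • bary (M.simplex i.1) i.2.1.2 -
        bary (M.simplex i.1) i.2.1.2 y • bary (M.simplex i.1) i.2.1.1)
    fun i => ⟨(M.simplex i.1).points i.2.1.2, hvert _ _, by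
      simpa [bary_point, i.2.2] using hyne (i.1, i.2.1.1)⟩
  have hγ : Continuous fun t : ℝ => (AffineMap.lineMap y z t : E n) :=
    AffineMap.lineMap_continuous
  have hseg : ∀ t ∈ Icc (0 : ℝ) 1, (AffineMap.lineMap y z t : E n) ∈ G.Ω s := by
    intro t ht
    rw [hΩ]
    refine ⟨hball ?_, AffineMap.lineMap_mem _ hyP hzP⟩
    exact (convex_ball x ρ).segment_subset hy.1 hz.1
      (segment_eq_image_lineMap ℝ y z ▸ mem_image_of_mem _ ht)
  have hpre : IsPreconnected ((fun t : ℝ => (AffineMap.lineMap y z t : E n)) '' Icc 0 1) :=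
    isPreconnected_Icc.image _ hγ.continuousOn
  -- The segment is connected, stays in the subdomain, and runs from a member of `I` to a nonmember,
  -- so it passes through a common point of the two families.
  obtain ⟨p, ⟨t, ht, rfl⟩, hpI, hpJ⟩ := isPreconnected_closed_iff.1 hpre UI UJ hUIc hUJc
    (by rintro _ ⟨t, ht, rfl⟩; exact hcover (hseg t ht))
    ⟨y, ⟨0, by simp, by simp⟩, mem_biUnion hcI (hcell c y hyP hy.2)⟩
    ⟨z, ⟨1, by simp, by simp⟩, mem_biUnion hcJ (hcell c' z hzP hz.2)⟩
  obtain ⟨e, heI, he⟩ := mem_iUnion₂.1 hpI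
  obtain ⟨e', heJ, he'⟩ := mem_iUnion₂.1 hpJ
  refine heJ (hI e heI e' (M.adjacent_of_mem (fun h => heJ (h ▸ heI)) he he' (hseg t ht) ?_))
  intro a i j hij h1 h2
  rw [bary_lineMap] at h1 h2
  have h3 := hzne (a, ⟨(i, j), hij⟩)
  have h4 := hyne (a, i)
  simp only [AffineMap.coe_sub, AffineMap.coe_smul, Pi.sub_apply, Pi.smul_apply,
    smul_eq_mul] at h3 h4
  -- Two coordinates vanishing at the parameter `t` make `t` times the determinant zero. Hence `t =
  -- 0`, which contradicts the choice of `y`.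
  have h5 : t * (bary (M.simplex a) i y * bary (M.simplex a) j z -
      bary (M.simplex a) j y * bary (M.simplex a) i z) = 0 := by
    linear_combination bary (M.simplex a) i y * h2 - bary (M.simplex a) j y * h1
  have ht0 : t = 0 := (mul_eq_zero.1 h5).resolve_right h3
  rw [ht0] at h1
  simp at h1
  exact h4 h1

/-- A facet belongs to at most two elements. -/
theorem eq_or_eq_of_openFacet_eq {s : G.Sub} (hd : G.dim s ≠ 0) {c c' c'' : M.Cell s}
    {k k' k'' : Fin (G.dim s + 1)} (hcc : c ≠ c')
    (h' : openFacet (M.simplex c) k = openFacet (M.simplex c') k')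
    (h'' : openFacet (M.simplex c) k = openFacet (M.simplex c'') k'') : c'' = c ∨ c'' = c' := by
  by_contra! hne
  have hs : ∀ a b : M.Cell s, affineSpan ℝ (range (M.simplex a).points) =
      affineSpan ℝ (range (M.simplex b).points) := fun a b => by rw [M.span_eq, M.span_eq]
  have h1 := bary_point_neg_of_openFacet_eq hd (hs _ _) h' (M.disjoint_openCell hcc)
  have h2 := bary_point_neg_of_openFacet_eq hd (hs _ _) h'' (M.disjoint_openCell hne.1.symm)
  have h3 := bary_point_neg_of_openFacet_eq hd (hs _ _) (h'.symm.trans h'')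
    (M.disjoint_openCell hne.2.symm)
  -- Three elements at one facet would lie pairwise on opposite sides, but by proportionality one
  -- negative number would be a product of two negative ones.
  have h4 := bary_eq_mul_of_openFacet_eq hd (h'.symm.trans h'') (x := (M.simplex c).points k)
    (by rw [hs c' c]; exact point_mem_span _ k)
  nlinarith [mul_pos_of_neg_of_neg h1 h3]

end Mesh

namespace Mesh

variable {n : ℕ} {G : Geometry n} (M : Mesh G)

/-! ### Fields with prescribed normal components -/

/-- The field whose normal component on the facet `k` of the element `c` is `t s c k`. -/
def traceField (t : ∀ s, M.Cell s → Fin (G.dim s + 1) → ℝ) : M.Field :=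
  fun s c => ∑ k, t s c k • rtBasis (M.simplex c) k

theorem normalTrace_traceField (t : ∀ s, M.Cell s → Fin (G.dim s + 1) → ℝ) {s : G.Sub}
    (hd : G.dim s ≠ 0) (c : M.Cell s) (k : Fin (G.dim s + 1)) :
    normalTrace (M.simplex c) k (M.traceField t s c) = t s c k := by
  have : NeZero (G.dim s) := ⟨hd⟩
  simp [traceField, normalTrace_sum, normalTrace_smul, normalTrace_rtBasis]

theorem traceField_snd (t : ∀ s, M.Cell s → Fin (G.dim s + 1) → ℝ) {s : G.Sub} (c : M.Cell s) :
    (M.traceField t s c).2 = ∑ k, t s c k * (height (M.simplex c) k)⁻¹ := by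
  simp [traceField, Prod.snd_sum, rtBasis]

/-- Conditions are needed in positive dimension only: on points the inverse height is 0, so the
field vanishes whatever `t` is. -/
theorem traceField_mem_V {t : ∀ s, M.Cell s → Fin (G.dim s + 1) → ℝ}
    (h1 : ∀ s, G.dim s ≠ 0 → ∀ (c c' : M.Cell s) (k k' : Fin (G.dim s + 1)), c ≠ c' →
      openFacet (M.simplex c) k = openFacet (M.simplex c') k' →
      openFacet (M.simplex c) k ⊆ G.Ω s → t s c k + t s c' k' = 0)
    (h2 : ∀ s, G.dim s ≠ 0 → ∀ (c : M.Cell s) (k : Fin (G.dim s + 1)),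
      openFacet (M.simplex c) k ⊆ G.neumann → t s c k = 0) : M.traceField t ∈ M.V := by
  refine ⟨fun s c => ⟨?_, fun hd => ?_⟩, fun s c c' k k' hcc heq hsub => ?_, fun s c k hk => ?_⟩
  · rw [traceField, Prod.fst_sum, ← M.span_eq c]
    exact Submodule.sum_mem _ fun k _ => Submodule.smul_mem _ _ (rtBasis_fst_mem_direction _ k)
  · rw [M.traceField_snd]
    simp [height_of_eq_zero _ hd]
  · by_cases hd : G.dim s = 0
    · rw [normalTrace_of_eq_zero _ hd, normalTrace_of_eq_zero _ hd, add_zero]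
    · rw [M.normalTrace_traceField t hd, M.normalTrace_traceField t hd]
      exact h1 s hd c c' k k' hcc heq hsub
  · by_cases hd : G.dim s = 0
    · rw [normalTrace_of_eq_zero _ hd]
    · rw [M.normalTrace_traceField t hd]
      exact h2 s hd c k hk

theorem dim_ne_zero_of_onInterface {g : G.Interface} {s : G.Sub} {c : M.Cell s}
    {k : Fin (G.dim s + 1)} (h : M.OnInterface g c k) : G.dim s ≠ 0 := by
  have := G.dim_hi g
  rw [h.1] at this
  omega

/-- A facet inside a subdomain lies on no interface. -/
theorem not_onInterface_of_subset {s : G.Sub} (hd : G.dim s ≠ 0) {c : M.Cell s}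
    {k : Fin (G.dim s + 1)} (h : openFacet (M.simplex c) k ⊆ G.Ω s) (g : G.Interface) :
    ¬ M.OnInterface g c k := by
  rintro ⟨hg, hsub, -⟩
  obtain ⟨x, hx⟩ := openFacet_nonempty (M.simplex c) hd k
  exact hi_ne_lo g (hg.trans (eq_of_mem_Ω (h hx) (hsub hx)))

theorem not_subset_neumann_of_subset {s t : G.Sub} (hd : G.dim s ≠ 0) {c : M.Cell s}
    {k : Fin (G.dim s + 1)} (h : openFacet (M.simplex c) k ⊆ G.Ω t) :
    ¬ openFacet (M.simplex c) k ⊆ G.neumann := by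
  intro hN
  obtain ⟨x, hx⟩ := openFacet_nonempty (M.simplex c) hd k
  exact notMem_Ω_of_mem_neumann (hN hx) t (h hx)

theorem not_subset_of_subset_dirichlet {s : G.Sub} (hd : G.dim s ≠ 0) {c : M.Cell s}
    {k : Fin (G.dim s + 1)} (h : openFacet (M.simplex c) k ⊆ G.dirichlet) (t : G.Sub) :
    ¬ openFacet (M.simplex c) k ⊆ G.Ω t := by
  intro hN
  obtain ⟨x, hx⟩ := openFacet_nonempty (M.simplex c) hd k
  exact notMem_Ω_of_mem_dirichlet (h hx) t (hN hx)

/-! ### Facets on the Dirichlet boundary -/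

/-- The open cell lies in the subdomain, so Dirichlet points of an element lie on its relative
boundary. This is null unless the element has full dimension; then a Dirichlet point inside a facet
would, by the resolution of the boundary, make it a Dirichlet facet, and what remains is the null
set of lower faces. -/
theorem measure_dirichlet_inter_eq_zero {s : G.Sub} (c : M.Cell s)
    (h : G.dim s ≠ 0 → ∀ k, ¬ openFacet (M.simplex c) k ⊆ G.dirichlet) :
    (Measure.euclideanHausdorffMeasure (n - 1) : Measure (E n))
      (G.dirichlet ∩ (M.simplex c).closedInterior) = 0 := by
  have hle : G.dim s ≤ n := by
    rw [← G.finrank_plane s]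
    simpa using Submodule.finrank_le (G.plane s).direction
  have hcell : ∀ x ∈ G.dirichlet, x ∉ openCell (M.simplex c) := fun x hx hx' =>
    notMem_Ω_of_mem_dirichlet hx s (M.openCell_subset c hx')
  rcases lt_trichotomy (G.dim s) (n - 1) with hlt | heq | hgt
  · refine measure_mono_null (inter_subset_right.trans
      (M.simplex c).closedInterior_subset_affineSpan) (measure_plane_eq_zero ?_)
    rwa [finrank_direction_span]
  · rw [← heq]
    refine measure_mono_null ?_ (measure_closedInterior_sdiff_openCell (M.simplex c))
    rintro x ⟨hx, hx'⟩
    exact ⟨hx', hcell x hx⟩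
  · have hd : G.dim s = n - 1 + 1 := by omega
    refine measure_mono_null (t := ⋃ k, closedFacet (M.simplex c) k \ openFacet (M.simplex c) k) ?_
      (measure_iUnion_null fun k => measure_closedFacet_sdiff_openFacet _ hd k)
    rintro x ⟨hx, hx'⟩
    rw [mem_closedInterior_iff] at hx'
    have hnot := hcell x hx
    rw [mem_openCell_iff] at hnot
    push Not at hnot
    obtain ⟨k, hk⟩ := hnot hx'.1
    have hk0 : bary (M.simplex c) k x = 0 := le_antisymm hk (hx'.2 k)
    refine mem_iUnion.2 ⟨k, (mem_closedFacet_iff _).2 ⟨hx'.1, hx'.2, hk0⟩, fun hxk => ?_⟩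
    rcases M.resolved s c k with h1 | ⟨g, -, h1, -⟩ | h1 | h1
    · exact notMem_Ω_of_mem_dirichlet hx s (h1 hxk)
    · exact notMem_Ω_of_mem_dirichlet hx _ (h1 hxk)
    · exact h (by omega) k h1
    · exact Set.disjoint_left.1 G.boundary_disjoint hx (h1 hxk)

/-- The closure of the finite union of subdomains is covered by the closed elements. Without a
Dirichlet facet, the Dirichlet part would be a finite union of null sets. -/
theorem exists_dirichlet_facet :
    ∃ (s : G.Sub) (c : M.Cell s) (k : Fin (G.dim s + 1)), G.dim s ≠ 0 ∧
      openFacet (M.simplex c) k ⊆ G.dirichlet := by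
  by_contra! hcon
  refine G.dirichlet_pos.ne' (measure_mono_null
    (t := ⋃ s, ⋃ c : M.Cell s, G.dirichlet ∩ (M.simplex c).closedInterior) ?_
    (measure_iUnion_null fun s => measure_iUnion_null fun c =>
      M.measure_dirichlet_inter_eq_zero c fun hd k => hcon s c k hd))
  intro x hx
  have h1 : x ∈ closure (⋃ s, G.Ω s) \ ⋃ s, G.Ω s := G.boundary_eq ▸ Or.inl hx
  have h2 := h1.1
  rw [closure_iUnion_of_finite] at h2
  obtain ⟨s, hs⟩ := mem_iUnion.1 h2
  rw [← (M.partitions s).1] at hs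
  obtain ⟨c, hc⟩ := mem_iUnion.1 hs
  exact mem_iUnion.2 ⟨s, mem_iUnion.2 ⟨c, hx, hc⟩⟩

/-! ### Volumes of intersections with mortar elements -/

theorem vol_le_sum_inter {ι : Type} [Fintype ι] {d : ℕ} {s : Set (E n)} {t : ι → Set (E n)}
    (h : s ⊆ ⋃ i, t i) : vol d s ≤ ∑ i, vol d (s ∩ t i) := by
  have h1 : s = ⋃ i, s ∩ t i := by
    rw [← inter_iUnion, inter_eq_self_of_subset_left h]
  calc vol d s = vol d (⋃ i, s ∩ t i) := congrArg _ h1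
    _ ≤ _ := measureReal_iUnion_fintype_le _

theorem vol_closedInterior_le_sum_mortar (g : G.Interface) (c : M.Cell (G.lo g)) :
    vol (G.dim (G.lo g)) (M.simplex c).closedInterior ≤ ∑ m : M.Mortar g,
      vol (G.dim (G.lo g)) ((M.simplex c).closedInterior ∩ (M.mortarSimplex m).closedInterior) := by
  refine vol_le_sum_inter ?_
  rw [(M.mortar_partitions g).1, ← (M.partitions (G.lo g)).1]
  exact subset_iUnion (fun c : M.Cell (G.lo g) => (M.simplex c).closedInterior) c

theorem vol_closedFacet_le_sum_mortar {g : G.Interface} {c : M.Cell (G.hi g)}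
    {k : Fin (G.dim (G.hi g) + 1)} (h : M.OnInterface g c k) :
    vol (G.dim (G.lo g)) (closedFacet (M.simplex c) k) ≤ ∑ m : M.Mortar g,
      vol (G.dim (G.lo g)) (closedFacet (M.simplex c) k ∩ (M.mortarSimplex m).closedInterior) := by
  refine vol_le_sum_inter ?_
  rw [(M.mortar_partitions g).1, closedFacet_eq_closure _ (M.dim_ne_zero_of_onInterface h)]
  exact closure_mono h.2.1

theorem exists_onInterface (g : G.Interface) :
    ∃ (c : M.Cell (G.hi g)) (k : Fin (G.dim (G.hi g) + 1)), M.OnInterface g c k := by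
  obtain ⟨x, hx⟩ := (G.isConnected (G.lo g)).nonempty
  have h1 := subset_closure hx
  rw [← (M.trace_partitions g).1] at h1
  obtain ⟨⟨⟨c, k⟩, hf⟩, -⟩ := mem_iUnion.1 h1
  exact ⟨c, k, rfl, hf⟩

end Mesh

namespace Discretization

variable {n : ℕ} (D : Discretization n)

/-! ### The kernel of the transposed divergence operator -/

theorem B_apply (r : D.W) (q : D.Q) : D.B r q =
    -((∑ s, ∑ c : D.M.Cell s, q s c * rtDiv (D.G.dim s) (D.flux r s c) *
          vol (D.G.dim s) (D.M.simplex c).closedInterior) +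
        -(∑ g, ∑ c : D.M.Cell (D.G.lo g), ∑ τ : D.M.Mortar g, q (D.G.lo g) c * r.2 g τ *
          vol (D.G.dim (D.G.lo g))
            ((D.M.simplex c).closedInterior ∩ (D.M.mortarSimplex τ).closedInterior))) := rfl

theorem flux_apply (r : D.W) : D.flux r = (r.1 : D.M.Field) + (D.R r.2 : D.M.Field) := rfl

variable {D} {q : D.Q}

/-- Testing with a field of `V_{0h}` that is supported in one subdomain. -/
theorem sum_trace_eq_zero (hq : ∀ r, D.B r q = 0) {s : D.G.Sub} (hd : D.G.dim s ≠ 0)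
    (t : D.M.Cell s → Fin (D.G.dim s + 1) → ℝ)
    (h1 : ∀ (c c' : D.M.Cell s) (k k' : Fin (D.G.dim s + 1)), c ≠ c' →
      openFacet (D.M.simplex c) k = openFacet (D.M.simplex c') k' →
      openFacet (D.M.simplex c) k ⊆ D.G.Ω s → t c k + t c' k' = 0)
    (h2 : ∀ (c : D.M.Cell s) (k : Fin (D.G.dim s + 1)),
      openFacet (D.M.simplex c) k ⊆ D.G.neumann → t c k = 0)
    (h3 : ∀ g (c : D.M.Cell s) (k : Fin (D.G.dim s + 1)), D.M.OnInterface g c k → t c k = 0) :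
    ∑ c, q s c * (∑ k, t c k * (height (D.M.simplex c) k)⁻¹) *
      vol (D.G.dim s) (D.M.simplex c).closedInterior = 0 := by
  classical
  -- Extension of the prescribed normal components by zero to the other subdomains.
  obtain ⟨t', hs, hne⟩ : ∃ t' : ∀ s, D.M.Cell s → Fin (D.G.dim s + 1) → ℝ,
      t' s = t ∧ ∀ s', s' ≠ s → t' s' = 0 :=
    ⟨Function.update 0 s t, by rw [Function.update_self],
      fun s' h => by rw [Function.update_of_ne h]; rfl⟩
  have hV : D.M.traceField t' ∈ D.M.V := by
    refine D.M.traceField_mem_V (fun s' _ c c' k k' hcc heq hsub => ?_) fun s' _ c k hk => ?_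
    · by_cases h : s' = s
      · subst h
        rw [hs]
        exact h1 c c' k k' hcc heq hsub
      · simp [hne s' h]
    · by_cases h : s' = s
      · subst h
        rw [hs]
        exact h2 c k hk
      · simp [hne s' h]
  have hV0 : D.M.traceField t' ∈ D.M.V0 := by
    refine ⟨hV, fun g s' c k hg => ?_⟩
    rw [D.M.normalTrace_traceField t' (D.M.dim_ne_zero_of_onInterface hg)]
    by_cases h : s' = s
    · subst h
      rw [hs]
      exact h3 g c k hg
    · simp [hne s' h]
  have h0 := hq (⟨_, hV0⟩, 0)
  have hfl : D.flux (⟨_, hV0⟩, 0) = D.M.traceField t' := by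
    rw [flux_apply]
    simp
  rw [B_apply, hfl] at h0
  simp only [rtDiv, D.M.traceField_snd, Pi.zero_apply, mul_zero, zero_mul, Finset.sum_const_zero,
    neg_zero, add_zero, neg_eq_zero] at h0
  rw [Finset.sum_eq_single s (fun s' _ h => by simp [hne s' h]) (by simp), hs] at h0
  have hd' : (D.G.dim s : ℝ) ≠ 0 := by exact_mod_cast hd
  refine (mul_eq_zero.1 (?_ : (D.G.dim s : ℝ) * _ = 0)).resolve_left hd'
  rw [← h0, Finset.mul_sum]
  exact Finset.sum_congr rfl fun c _ => by ring

open Classical in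
theorem sum_indicator {s : D.G.Sub} (c : D.M.Cell s) (k : Fin (D.G.dim s + 1)) :
    ∑ e, q s e * (∑ l, (if e = c ∧ l = k then (1 : ℝ) else 0) *
      (height (D.M.simplex e) l)⁻¹) * vol (D.G.dim s) (D.M.simplex e).closedInterior =
    q s c * ((height (D.M.simplex c) k)⁻¹ * vol (D.G.dim s) (D.M.simplex c).closedInterior) := by
  rw [Finset.sum_eq_single c (fun e _ he => by simp [he]) (by simp),
    Finset.sum_eq_single k (fun l _ hl => by simp [hl]) (by simp)]
  simp [mul_assoc]

theorem facet_weight_pos {s : D.G.Sub} (hd : D.G.dim s ≠ 0) (c : D.M.Cell s)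
    (k : Fin (D.G.dim s + 1)) :
    0 < (height (D.M.simplex c) k)⁻¹ * vol (D.G.dim s) (D.M.simplex c).closedInterior :=
  mul_pos (inv_pos.2 (height_pos_of_ne_zero _ hd k)) (vol_closedInterior_pos _)

/-- In neighbouring elements `q` is zero or has the same sign. -/
theorem eq_mul_of_adjacent (hq : ∀ r, D.B r q = 0) {s : D.G.Sub} {c c' : D.M.Cell s}
    (h : D.M.Adjacent c c') : ∃ a : ℝ, 0 < a ∧ q s c' = a * q s c := by
  classical
  obtain ⟨hcc, k, k', hkk, hsub⟩ := h
  -- A zero-dimensional plane is one point, so two different elements would have overlapping open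
  -- cells.
  have hd : D.G.dim s ≠ 0 := by
    intro hd
    have hmem : ∀ e : D.M.Cell s, ∀ x ∈ openCell (D.M.simplex e), x ∈ D.G.plane s := fun e x hx =>
      D.G.Ω_subset_plane s (D.M.openCell_subset e hx)
    obtain ⟨x, hx⟩ := openCell_nonempty (D.M.simplex c)
    obtain ⟨y, hy⟩ := openCell_nonempty (D.M.simplex c')
    have h1 : x -ᵥ y ∈ (D.G.plane s).direction :=
      AffineSubspace.vsub_mem_direction (hmem c x hx) (hmem c' y hy)
    have h2 := D.G.finrank_plane s
    rw [hd, Submodule.finrank_eq_zero] at h2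
    rw [h2, Submodule.mem_bot, vsub_eq_zero_iff_eq] at h1
    exact Set.disjoint_left.1 (D.M.disjoint_openCell hcc) hx (h1 ▸ hy)
  -- A shared facet has exactly two sides, so once one side is identified the other is too. This
  -- makes the two-indicator test field below continuous across every facet.
  have key : ∀ {a a' : D.M.Cell s} {i i' : Fin (D.G.dim s + 1)}, a ≠ a' →
      openFacet (D.M.simplex a) i = openFacet (D.M.simplex a') i' →
      ∀ {e e' : D.M.Cell s} {l l' : Fin (D.G.dim s + 1)}, e ≠ e' →
      openFacet (D.M.simplex e) l = openFacet (D.M.simplex e') l' →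
      (e = a ∧ l = i) → (e' = a' ∧ l' = i') := by
    rintro a a' i i' haa hii e e' l l' hee hll ⟨rfl, rfl⟩
    rcases D.M.eq_or_eq_of_openFacet_eq hd haa hii hll with rfl | rfl
    · exact absurd rfl hee
    · exact ⟨rfl, openFacet_injective _ hd (hll.symm.trans hii)⟩
  -- A unit flux from `c` into `c'` through their common facet, zero on every other facet.
  have h0 := sum_trace_eq_zero hq hd
    (fun e l => (if e = c ∧ l = k then 1 else 0) - (if e = c' ∧ l = k' then 1 else 0))
    (fun e e' l l' hee hll _ => by
      have h1 : (e = c ∧ l = k) ↔ (e' = c' ∧ l' = k') :=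
        ⟨key hcc hkk hee hll, key hcc.symm hkk.symm hee.symm hll.symm⟩
      have h2 : (e = c' ∧ l = k') ↔ (e' = c ∧ l' = k) :=
        ⟨key hcc.symm hkk.symm hee hll, key hcc hkk hee.symm hll.symm⟩
      simp only [h1, h2]
      ring)
    (fun e l hN => by
      rw [if_neg, if_neg, sub_zero]
      · rintro ⟨rfl, rfl⟩
        exact D.M.not_subset_neumann_of_subset hd (hkk ▸ hsub) hN
      · rintro ⟨rfl, rfl⟩
        exact D.M.not_subset_neumann_of_subset hd hsub hN)
    (fun g e l hg => by
      rw [if_neg, if_neg, sub_zero]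
      · rintro ⟨rfl, rfl⟩
        exact D.M.not_onInterface_of_subset hd (hkk ▸ hsub) g hg
      · rintro ⟨rfl, rfl⟩
        exact D.M.not_onInterface_of_subset hd hsub g hg)
  simp only [sub_mul, mul_sub, Finset.sum_sub_distrib] at h0
  rw [sum_indicator, sum_indicator, sub_eq_zero] at h0
  have hw := facet_weight_pos hd c k
  have hw' := facet_weight_pos hd c' k'
  -- Each weight is the area of the facet divided by the dimension, so this factor is in fact 1; its
  -- positivity is all that is needed.
  refine ⟨_, div_pos hw hw', ?_⟩
  rw [div_mul_eq_mul_div, mul_comm, h0, mul_div_cancel_right₀ _ hw'.ne']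

/-- On each subdomain `q` is zero or has one sign. -/
theorem exists_pos_mul_eq (hq : ∀ r, D.B r q = 0) {s : D.G.Sub} (c c' : D.M.Cell s) :
    ∃ a : ℝ, 0 < a ∧ q s c' = a * q s c := by
  refine D.M.mem_of_adjacent_closed {e | ∃ a : ℝ, 0 < a ∧ q s e = a * q s c} ?_ (c₀ := c)
    ⟨1, one_pos, (one_mul _).symm⟩ c'
  rintro e ⟨a, ha, hae⟩ e' hee
  obtain ⟨b, hb, hbe⟩ := eq_mul_of_adjacent hq hee
  exact ⟨b * a, mul_pos hb ha, by rw [hbe, hae, mul_assoc]⟩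

theorem eq_zero_of_eq_zero (hq : ∀ r, D.B r q = 0) {s : D.G.Sub} {c : D.M.Cell s}
    (h : q s c = 0) (c' : D.M.Cell s) : q s c' = 0 := by
  obtain ⟨a, -, ha⟩ := exists_pos_mul_eq hq c c'
  rw [ha, h, mul_zero]

/-- All values of `q` on the subdomain are positive multiples of one value, so a sum with
nonnegative weights, one of them positive, cannot cancel. -/
theorem eq_zero_of_sum_eq_zero (hq : ∀ r, D.B r q = 0) {s : D.G.Sub} {w : D.M.Cell s → ℝ}
    (hw : ∀ c, 0 ≤ w c) {c₀ : D.M.Cell s} (hc₀ : 0 < w c₀) (h : ∑ c, q s c * w c = 0)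
    (c : D.M.Cell s) : q s c = 0 := by
  choose a ha hqa using exists_pos_mul_eq hq c₀
  have h1 : q s c₀ * ∑ c, a c * w c = 0 := by
    rw [← h, Finset.mul_sum]
    exact Finset.sum_congr rfl fun c _ => by rw [hqa c]; ring
  have h2 : 0 < ∑ c, a c * w c :=
    Finset.sum_pos' (fun c _ => mul_nonneg (ha c).le (hw c))
      ⟨c₀, Finset.mem_univ _, mul_pos (ha c₀) hc₀⟩
  exact eq_zero_of_eq_zero hq ((mul_eq_zero.1 h1).resolve_right h2.ne') c

/-- `q` vanishes on a subdomain that touches the Dirichlet boundary. -/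
theorem exists_forall_eq_zero (hq : ∀ r, D.B r q = 0) : ∃ s, ∀ c : D.M.Cell s, q s c = 0 := by
  classical
  obtain ⟨s, c, k, hd, hD⟩ := D.M.exists_dirichlet_facet
  -- A unit outflow through one Dirichlet facet; the only term that survives is `q s c` with a
  -- positive weight.
  have h0 := sum_trace_eq_zero hq hd (fun e l => if e = c ∧ l = k then 1 else 0)
    (fun e e' l l' _ hll hsub => by
      rw [if_neg, if_neg, add_zero]
      · rintro ⟨rfl, rfl⟩
        exact D.M.not_subset_of_subset_dirichlet hd hD s (hll ▸ hsub)
      · rintro ⟨rfl, rfl⟩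
        exact D.M.not_subset_of_subset_dirichlet hd hD s hsub)
    (fun e l hN => by
      rw [if_neg]
      rintro ⟨rfl, rfl⟩
      obtain ⟨x, hx⟩ := openFacet_nonempty (D.M.simplex e) hd l
      exact Set.disjoint_left.1 D.G.boundary_disjoint (hD hx) (hN hx))
    (fun g e l hg => by
      rw [if_neg]
      rintro ⟨rfl, rfl⟩
      exact D.M.not_subset_of_subset_dirichlet hd hD _ hg.2.1)
  rw [sum_indicator, mul_eq_zero, or_iff_left (facet_weight_pos hd c k).ne'] at h0
  exact ⟨s, eq_zero_of_eq_zero hq h0⟩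

/-! ### Transfer of zeros across the interfaces -/

open Classical in
/-- The interface part of the normal components of the extension of a mortar function. -/
def interfaceTrace (D : Discretization n) (μ : D.M.Λ) (s : D.G.Sub) (c : D.M.Cell s)
    (k : Fin (D.G.dim s + 1)) : ℝ :=
  if ∃ g, D.M.OnInterface g c k then normalTrace (D.M.simplex c) k ((D.R μ : D.M.Field) s c) else 0

theorem interfaceTrace_eq {μ : D.M.Λ} {g : D.G.Interface} {s : D.G.Sub} {c : D.M.Cell s}
    {k : Fin (D.G.dim s + 1)} (h : D.M.OnInterface g c k) :
    vol (D.G.dim (D.G.lo g)) (closedFacet (D.M.simplex c) k) * interfaceTrace D μ s c k =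
      ∑ m : D.M.Mortar g, μ g m * vol (D.G.dim (D.G.lo g))
        (closedFacet (D.M.simplex c) k ∩ (D.M.mortarSimplex m).closedInterior) := by
  rw [interfaceTrace, if_pos ⟨g, h⟩]
  exact D.isExtension.1 μ g s c k h

theorem traceField_interfaceTrace_mem_V (μ : D.M.Λ) :
    D.M.traceField (interfaceTrace D μ) ∈ D.M.V := by
  refine D.M.traceField_mem_V (fun s hd c c' k k' _ heq hsub => ?_) fun s hd c k hN => ?_
  · rw [interfaceTrace, interfaceTrace, if_neg, if_neg, add_zero]
    · rintro ⟨g, hg⟩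
      exact D.M.not_onInterface_of_subset hd (heq ▸ hsub) g hg
    · rintro ⟨g, hg⟩
      exact D.M.not_onInterface_of_subset hd hsub g hg
  · rw [interfaceTrace, if_neg]
    rintro ⟨g, hg⟩
    exact D.M.not_subset_neumann_of_subset hd hg.2.1 hN

/-- The correction in `V0` that, added to the extension, leaves only the interface fluxes. It
removes whatever the extension operator does elsewhere, so the total flux has known normal
components. -/
theorem traceField_sub_mem_V0 (μ : D.M.Λ) :
    D.M.traceField (interfaceTrace D μ) - (D.R μ : D.M.Field) ∈ D.M.V0 := by
  refine ⟨D.M.V.sub_mem (traceField_interfaceTrace_mem_V μ) (D.R μ).2, fun g s c k hg => ?_⟩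
  have h : ∀ u v : E n × ℝ, normalTrace (D.M.simplex c) k (u - v) =
      normalTrace (D.M.simplex c) k u - normalTrace (D.M.simplex c) k v := fun u v => by
    rw [sub_eq_add_neg, ← neg_one_smul ℝ, normalTrace_add, normalTrace_smul]
    ring
  simp only [Pi.sub_apply]
  rw [h, D.M.normalTrace_traceField _ (D.M.dim_ne_zero_of_onInterface hg), interfaceTrace,
    if_pos ⟨g, hg⟩, sub_self]

/-- Testing with a mortar function of one interface. -/
theorem interface_balance (hq : ∀ r, D.B r q = 0) (g : D.G.Interface) :
    ∃ (w : D.M.Cell (D.G.hi g) → ℝ) (w' : D.M.Cell (D.G.lo g) → ℝ),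
      (∀ c, 0 ≤ w c) ∧ (∃ c, 0 < w c) ∧ (∀ c, 0 < w' c) ∧
      ∑ c, q (D.G.hi g) c * w c = ∑ c, q (D.G.lo g) c * w' c := by
  classical
  set μ : D.M.Λ := Pi.single g fun _ => 1 with hμ
  have hμg : μ g = fun _ => 1 := Pi.single_eq_same g _
  have hμne : ∀ g', g' ≠ g → μ g' = 0 := fun g' h => Pi.single_eq_of_ne h _
  set t := interfaceTrace D μ with ht
  have hvol : ∀ {g' : D.G.Interface} {s : D.G.Sub} {c : D.M.Cell s} {k : Fin (D.G.dim s + 1)},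
      D.M.OnInterface g' c k →
      0 < vol (D.G.dim (D.G.lo g')) (closedFacet (D.M.simplex c) k) := by
    intro g' s c k h
    exact vol_closedFacet_pos _ (by rw [← D.G.dim_hi g', h.1]) k
  -- On an interface facet the trace is the mean value of a nonnegative mortar function; elsewhere
  -- it is zero by definition.
  have ht0 : ∀ s c k, 0 ≤ t s c k := by
    intro s c k
    by_cases h : ∃ g', D.M.OnInterface g' c k
    · obtain ⟨g', hg'⟩ := h
      have h1 : 0 ≤ vol (D.G.dim (D.G.lo g')) (closedFacet (D.M.simplex c) k) * t s c k := by
        rw [ht, interfaceTrace_eq hg']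
        refine Finset.sum_nonneg fun m _ => mul_nonneg ?_ ENNReal.toReal_nonneg
        by_cases hgg : g' = g
        · subst hgg
          rw [hμg]
          exact zero_le_one
        · rw [hμne g' hgg]
          exact le_rfl
      exact nonneg_of_mul_nonneg_right h1 (hvol hg')
    · rw [ht, interfaceTrace, if_neg h]
  have hts : ∀ s c k, s ≠ D.G.hi g → t s c k = 0 := by
    intro s c k hs
    by_cases h : ∃ g', D.M.OnInterface g' c k
    · obtain ⟨g', hg'⟩ := h
      have hgg : g' ≠ g := fun h => hs (by rw [← h, hg'.1])
      have h1 := interfaceTrace_eq (μ := μ) hg'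
      rw [hμne g' hgg] at h1
      simp only [Pi.zero_apply, zero_mul, Finset.sum_const_zero] at h1
      exact (mul_eq_zero.1 h1).resolve_left (hvol hg').ne'
    · rw [ht, interfaceTrace, if_neg h]
  have hd : D.G.dim (D.G.hi g) ≠ 0 := by
    have := D.G.dim_hi g
    omega
  have hflux : D.flux (⟨_, traceField_sub_mem_V0 μ⟩, μ) = D.M.traceField t := by
    rw [flux_apply]
    simp [ht]
  have h0 := hq (⟨_, traceField_sub_mem_V0 μ⟩, μ)
  rw [B_apply, hflux, neg_eq_zero, ← sub_eq_add_neg, sub_eq_zero,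
    Finset.sum_eq_single (D.G.hi g) (fun s _ hs => Finset.sum_eq_zero fun c _ => by
      simp [rtDiv, D.M.traceField_snd, hts s c _ hs]) (by simp),
    Finset.sum_eq_single g (fun g' _ hg' => by simp [hμne g' hg']) (by simp)] at h0
  -- The weights are the integrated divergence of the test flux over the elements above and the
  -- volume covered by mortar elements below. All interface fluxes are outward, so the divergence is
  -- nonnegative.
  refine ⟨fun c => rtDiv (D.G.dim (D.G.hi g)) (D.M.traceField t _ c) *
      vol (D.G.dim (D.G.hi g)) (D.M.simplex c).closedInterior,
    fun c => ∑ m : D.M.Mortar g, vol (D.G.dim (D.G.lo g))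
      ((D.M.simplex c).closedInterior ∩ (D.M.mortarSimplex m).closedInterior), ?_, ?_, ?_, ?_⟩
  · intro c
    refine mul_nonneg (mul_nonneg (Nat.cast_nonneg _) ?_) ENNReal.toReal_nonneg
    rw [D.M.traceField_snd]
    exact Finset.sum_nonneg fun k _ => mul_nonneg (ht0 _ _ _)
      (inv_nonneg.2 (height_pos_of_ne_zero _ hd k).le)
  · obtain ⟨c, k, hck⟩ := D.M.exists_onInterface g
    have htp : 0 < t _ c k := by
      have h1 := interfaceTrace_eq (μ := μ) hck
      rw [hμg] at h1
      simp only [one_mul] at h1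
      have h2 := (hvol hck).trans_le (D.M.vol_closedFacet_le_sum_mortar hck)
      rw [← h1] at h2
      exact pos_of_mul_pos_right h2 (hvol hck).le
    refine ⟨c, mul_pos (mul_pos (Nat.cast_pos.2 (Nat.pos_of_ne_zero hd)) ?_)
      (vol_closedInterior_pos _)⟩
    rw [D.M.traceField_snd]
    exact Finset.sum_pos' (fun k _ => mul_nonneg (ht0 _ _ _)
      (inv_nonneg.2 (height_pos_of_ne_zero _ hd k).le))
      ⟨k, Finset.mem_univ _, mul_pos htp (inv_pos.2 (height_pos_of_ne_zero _ hd k))⟩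
  · intro c
    exact (vol_closedInterior_pos _).trans_le (D.M.vol_closedInterior_le_sum_mortar g c)
  · simp only [← mul_assoc, Finset.mul_sum]
    rw [h0]
    simp [hμg]

theorem forall_lo_eq_zero_of_hi (hq : ∀ r, D.B r q = 0) (g : D.G.Interface)
    (h : ∀ c, q (D.G.hi g) c = 0) (c : D.M.Cell (D.G.lo g)) : q (D.G.lo g) c = 0 := by
  obtain ⟨w, w', -, -, hw', hb⟩ := interface_balance hq g
  simp only [h, zero_mul, Finset.sum_const_zero] at hb
  exact eq_zero_of_sum_eq_zero hq (fun c => (hw' c).le) (hw' c) hb.symm c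

theorem forall_hi_eq_zero_of_lo (hq : ∀ r, D.B r q = 0) (g : D.G.Interface)
    (h : ∀ c, q (D.G.lo g) c = 0) (c : D.M.Cell (D.G.hi g)) : q (D.G.hi g) c = 0 := by
  obtain ⟨w, w', hw, ⟨c₀, hc₀⟩, -, hb⟩ := interface_balance hq g
  simp only [h, zero_mul, Finset.sum_const_zero] at hb
  exact eq_zero_of_sum_eq_zero hq hw hc₀ hb c

variable (D)

/-- The property that `q` vanishes on a subdomain passes through every interface in both directions.
It holds next to the Dirichlet boundary and hence, by connectedness of the graph, everywhere. -/
theorem injective_BT : Function.Injective D.BT := by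
  refine (injective_iff_map_eq_zero D.BT).2 fun q hBq => ?_
  have hq : ∀ r, D.B r q = 0 := fun r => LinearMap.congr_fun hBq r
  obtain ⟨s₀, h₀⟩ := exists_forall_eq_zero hq
  have hiff : ∀ s t, Relation.EqvGen (fun s t => ∃ g, D.G.lo g = s ∧ D.G.hi g = t) s t →
      ((∀ c, q s c = 0) ↔ ∀ c, q t c = 0) := by
    intro s t h
    induction h with
    | rel s t h =>
      obtain ⟨g, rfl, rfl⟩ := h
      exact ⟨forall_hi_eq_zero_of_lo hq g, forall_lo_eq_zero_of_hi hq g⟩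
    | refl s => exact Iff.rfl
    | symm s t _ ih => exact ih.symm
    | trans s t u _ _ ih1 ih2 => exact ih1.trans ih2
  funext s c
  exact (hiff s₀ s (D.G.connected s₀ s)).1 h₀ c

end Discretization

/-- A positive definite form on a finite dimensional space is an isomorphism to the dual. -/
theorem bijective_of_pos {X : Type*} [AddCommGroup X] [Module ℝ X] [FiniteDimensional ℝ X]
    (S : X →ₗ[ℝ] Module.Dual ℝ X) (hS : ∀ x, x ≠ 0 → 0 < S x x) : Function.Bijective S := by
  have hinj : Function.Injective S := by
    refine (injective_iff_map_eq_zero S).2 fun x hx => ?_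
    by_contra h
    have := hS x h
    rw [hx] at this
    exact lt_irrefl _ this
  exact ⟨hinj, (LinearMap.injective_iff_surjective_of_finrank_eq_finrank
    (Subspace.dual_finrank_eq (K := ℝ) (V := X)).symm).1 hinj⟩

namespace Discretization

variable {n : ℕ} (D : Discretization n)

/-! ### The forms `a` and `a^D` -/

theorem A_apply (w r : D.W) : D.A w r = (∑ s, ∑ c : D.M.Cell s,
    cellProduct (D.M.simplex c) (D.P.K s) (D.flux w s c) (D.flux r s c)) +
      D.mortarProduct w.2 r.2 := rfl

theorem DA_apply (w r : D.W) : D.DA w r =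
    (∑ s, ∑ c : D.M.Cell s, ∑ k : Fin (D.G.dim s + 1),
      normalTrace (D.M.simplex c) k (D.flux w s c) *
        normalTrace (D.M.simplex c) k (D.flux r s c) *
        cellProduct (D.M.simplex c) (D.P.K s)
          (rtBasis (D.M.simplex c) k) (rtBasis (D.M.simplex c) k)) +
      D.mortarProduct w.2 r.2 := rfl

theorem flux_fst_mem (w : D.W) {s : D.G.Sub} (c : D.M.Cell s) :
    (D.flux w s c).1 ∈ (affineSpan ℝ (range (D.M.simplex c).points)).direction := by
  rw [D.M.span_eq]
  exact ((D.M.V.add_mem w.1.2.1 (D.R w.2).2).1 s c).1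

theorem flux_eq_zero_of_dim_eq_zero (w : D.W) {s : D.G.Sub} (hd : D.G.dim s = 0)
    (c : D.M.Cell s) : D.flux w s c = 0 := by
  have h := (D.M.V.add_mem w.1.2.1 (D.R w.2).2).1 s c
  have h1 := h.1
  have h2 := D.G.finrank_plane s
  rw [hd, Submodule.finrank_eq_zero] at h2
  rw [h2, Submodule.mem_bot] at h1
  exact Prod.ext h1 (h.2 hd)

theorem eq_zero_of_flux_eq_zero {w : D.W} (h : D.flux w = 0) (h2 : w.2 = 0) : w = 0 := by
  refine Prod.ext (Subtype.ext ?_) h2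
  rw [flux_apply, h2] at h
  simpa using h

/-- The weight of a mortar element in the interface product. -/
def mortarWeight (g : D.G.Interface) (τ : D.M.Mortar g) : ℝ :=
  ∫ x in (D.M.mortarSimplex τ).closedInterior, D.P.γ g * (D.P.Kν g x)⁻¹
    ∂(Measure.euclideanHausdorffMeasure (D.G.dim (D.G.lo g)))

theorem mortarProduct_eq (l m : D.M.Λ) :
    D.mortarProduct l m = ∑ g, ∑ τ, D.mortarWeight g τ * (l g τ * m g τ) := rfl

theorem measurableSet_openCell {d : ℕ} (T : Affine.Simplex ℝ (E n) d) :
    MeasurableSet (openCell T) := by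
  rw [openCell_eq_inter]
  exact (AffineSubspace.closed_of_finiteDimensional _).measurableSet.inter
    (isOpen_bary_pos T univ).measurableSet

theorem mortarWeight_pos (g : D.G.Interface) (τ : D.M.Mortar g) : 0 < D.mortarWeight g τ := by
  set d := D.G.dim (D.G.lo g)
  set T : Affine.Simplex ℝ (E n) d := D.M.mortarSimplex τ with hT
  obtain ⟨m, M, hm, hK⟩ := D.P.Kν_bounds g
  have hsub : openCell T ⊆ D.G.Ω (D.G.lo g) := (D.M.mortar_partitions g).2.1 τ
  obtain ⟨x₀, hx₀⟩ := openCell_nonempty T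
  have hM : 0 < M := hm.trans_le ((hK x₀ (hsub hx₀)).1.trans (hK x₀ (hsub hx₀)).2)
  have hγ := D.P.γ_pos g
  -- The bounds on `Kν` are known only in the interface itself, which may exclude the boundary of
  -- the mortar element; that boundary is a null set.
  have hae : T.closedInterior =ᵐ[Measure.euclideanHausdorffMeasure d] openCell T :=
    (ae_eq_set).2 ⟨measure_closedInterior_sdiff_openCell T, by
      rw [sdiff_eq_empty.2 (openCell_subset_closedInterior T), measure_empty]⟩
  have hfin : (Measure.euclideanHausdorffMeasure d : Measure (E n)) (openCell T) ≠ ∞ :=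
    ((measure_mono (openCell_subset_closedInterior T)).trans_lt
      (measure_closedInterior_lt_top T)).ne
  have hmeas := measurableSet_openCell T
  have hint : IntegrableOn (fun x => D.P.γ g * (D.P.Kν g x)⁻¹) (openCell T)
      (Measure.euclideanHausdorffMeasure d) := by
    refine Measure.integrableOn_of_bounded (M := D.P.γ g * m⁻¹) hfin
      ((D.P.Kν_measurable g).inv.const_mul _).aestronglyMeasurable ?_
    refine (ae_restrict_iff' hmeas).2 (Filter.Eventually.of_forall fun x hx => ?_)
    have h1 := (hK x (hsub hx)).1
    have h2 : 0 < D.P.Kν g x := hm.trans_le h1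
    rw [Real.norm_of_nonneg (by positivity)]
    gcongr
  change 0 < ∫ x in T.closedInterior, _ ∂_
  rw [setIntegral_congr_set hae]
  refine lt_of_lt_of_le ?_ (setIntegral_ge_of_const_le_real (c := D.P.γ g * M⁻¹) hmeas hfin
    (fun x hx => ?_) hint)
  · exact mul_pos (by positivity) (ENNReal.toReal_pos (measure_openCell_pos T).ne' hfin)
  · have h1 := hK x (hsub hx)
    have h2 : 0 < D.P.Kν g x := hm.trans_le h1.1
    have h3 := h1.2
    gcongr

theorem mortarProduct_self_nonneg (l : D.M.Λ) : 0 ≤ D.mortarProduct l l := by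
  rw [mortarProduct_eq]
  exact Finset.sum_nonneg fun g _ => Finset.sum_nonneg fun τ _ =>
    mul_nonneg (D.mortarWeight_pos g τ).le (mul_self_nonneg _)

theorem eq_zero_of_mortarProduct_self {l : D.M.Λ} (h : D.mortarProduct l l = 0) : l = 0 := by
  rw [mortarProduct_eq] at h
  have hnn : ∀ g (τ : D.M.Mortar g), 0 ≤ D.mortarWeight g τ * (l g τ * l g τ) := fun g τ =>
    mul_nonneg (D.mortarWeight_pos g τ).le (mul_self_nonneg _)
  funext g τ
  have h1 := (Finset.sum_eq_zero_iff_of_nonneg fun g _ => Finset.sum_nonneg fun τ _ => hnn g τ).1 h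
    g (Finset.mem_univ g)
  have h2 := (Finset.sum_eq_zero_iff_of_nonneg fun τ _ => hnn g τ).1 h1 τ (Finset.mem_univ τ)
  simpa using (mul_eq_zero.1 h2).resolve_left (D.mortarWeight_pos g τ).ne'

theorem mortarProduct_comm (l m : D.M.Λ) : D.mortarProduct l m = D.mortarProduct m l := by
  simp only [mortarProduct_eq, mul_comm (l _ _)]

theorem A_comm (w r : D.W) : D.A w r = D.A r w := by
  rw [A_apply, A_apply, mortarProduct_comm]
  congr 1
  exact Finset.sum_congr rfl fun s _ => Finset.sum_congr rfl fun c _ =>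
    cellProduct_comm _ (D.P.K_symm s) _ _

theorem DA_comm (w r : D.W) : D.DA w r = D.DA r w := by
  rw [DA_apply, DA_apply, mortarProduct_comm]
  congr 1
  exact Finset.sum_congr rfl fun s _ => Finset.sum_congr rfl fun c _ =>
    Finset.sum_congr rfl fun k _ => by ring

theorem flux_product_nonneg (w : D.W) {s : D.G.Sub} (c : D.M.Cell s) :
    0 ≤ cellProduct (D.M.simplex c) (D.P.K s) (D.flux w s c) (D.flux w s c) :=
  cellProduct_self_nonneg _ (D.P.K_pos s) _

/-- The mortar term controls `w.2`, the elements of positive dimension control the total flux, and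
on points the flux is zero anyway. Once `w.2 = 0`, the total flux is the component in `V0`. -/
theorem A_self_pos {w : D.W} (hw : w ≠ 0) : 0 < D.A w w := by
  have h1 : 0 ≤ ∑ s, ∑ c : D.M.Cell s,
      cellProduct (D.M.simplex c) (D.P.K s) (D.flux w s c) (D.flux w s c) :=
    Finset.sum_nonneg fun s _ => Finset.sum_nonneg fun c _ => D.flux_product_nonneg w c
  have h2 := D.mortarProduct_self_nonneg w.2
  rw [A_apply]
  refine lt_of_le_of_ne (add_nonneg h1 h2) fun h0 => hw ?_
  obtain ⟨h3, h4⟩ := (add_eq_zero_iff_of_nonneg h1 h2).1 h0.symm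
  refine D.eq_zero_of_flux_eq_zero ?_ (D.eq_zero_of_mortarProduct_self h4)
  funext s c
  by_cases hd : D.G.dim s = 0
  · exact D.flux_eq_zero_of_dim_eq_zero w hd c
  · have h5 := (Finset.sum_eq_zero_iff_of_nonneg fun s _ => Finset.sum_nonneg fun c _ =>
      D.flux_product_nonneg w c).1 h3 s (Finset.mem_univ s)
    have h6 := (Finset.sum_eq_zero_iff_of_nonneg fun c _ => D.flux_product_nonneg w c).1 h5 c
      (Finset.mem_univ c)
    by_contra hne
    exact (cellProduct_self_pos _ hd (D.P.K_pos s) hne).ne' h6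

theorem diagonal_nonneg (w : D.W) {s : D.G.Sub} (c : D.M.Cell s) (k : Fin (D.G.dim s + 1)) :
    0 ≤ normalTrace (D.M.simplex c) k (D.flux w s c) *
        normalTrace (D.M.simplex c) k (D.flux w s c) *
        cellProduct (D.M.simplex c) (D.P.K s)
          (rtBasis (D.M.simplex c) k) (rtBasis (D.M.simplex c) k) :=
  mul_nonneg (mul_self_nonneg _) (cellProduct_self_nonneg _ (D.P.K_pos s) _)

/-- On an element, the form `a` is bounded by the form `a^D`. -/
theorem flux_product_le (w : D.W) {s : D.G.Sub} (c : D.M.Cell s) :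
    cellProduct (D.M.simplex c) (D.P.K s) (D.flux w s c) (D.flux w s c) ≤
      (n + 1) * ∑ k, normalTrace (D.M.simplex c) k (D.flux w s c) *
        normalTrace (D.M.simplex c) k (D.flux w s c) *
        cellProduct (D.M.simplex c) (D.P.K s)
          (rtBasis (D.M.simplex c) k) (rtBasis (D.M.simplex c) k) := by
  have hnn := Finset.sum_nonneg (s := Finset.univ) fun k _ => D.diagonal_nonneg w c k
  by_cases hd : D.G.dim s = 0
  · rw [D.flux_eq_zero_of_dim_eq_zero w hd c] at hnn ⊢
    rw [cellProduct_zero]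
    positivity
  · have : NeZero (D.G.dim s) := ⟨hd⟩
    have hle : (D.G.dim s : ℝ) ≤ n := by
      rw [← D.G.finrank_plane s]
      exact_mod_cast (by simpa using Submodule.finrank_le (D.G.plane s).direction)
    refine (cellProduct_self_le_diagonal _ (D.P.K_pos s) (D.flux_fst_mem w c)).trans ?_
    exact mul_le_mul_of_nonneg_right (by linarith) hnn

theorem A_self_le (w : D.W) : D.A w w ≤ (n + 1) * D.DA w w := by
  rw [A_apply, DA_apply, mul_add, Finset.mul_sum]
  refine add_le_add (Finset.sum_le_sum fun s _ => ?_) ?_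
  · rw [Finset.mul_sum]
    exact Finset.sum_le_sum fun c _ => D.flux_product_le w c
  · have := D.mortarProduct_self_nonneg w.2
    have hn : (0 : ℝ) ≤ n := Nat.cast_nonneg n
    nlinarith

theorem DA_self_pos {w : D.W} (hw : w ≠ 0) : 0 < D.DA w w := by
  have h1 := (D.A_self_pos hw).trans_le (D.A_self_le w)
  exact pos_of_mul_pos_right h1 (by positivity)

/-- The constant in the bound of `a^D` by `a`. -/
def diagonalConstant (n : ℕ) (σ θ : ℝ) : ℝ :=
  -- Truncation at 1 admits arbitrary real `σ` and `θ`, and `n` bounds all dimensions of subdomains.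
  (n + 1) * (2 * max θ 1 ^ 2 * max σ 1 ^ (n + 2) * (1 + 4 * max σ 1) ^ 2)

theorem one_le_diagonalConstant (n : ℕ) (σ θ : ℝ) : 1 ≤ diagonalConstant n σ θ := by
  have hσ : 1 ≤ max σ 1 := le_max_right _ _
  have hθ : 1 ≤ max θ 1 := le_max_right _ _
  have h1 : (1 : ℝ) ≤ n + 1 := by simp
  have h2 : 1 ≤ max θ 1 ^ 2 := one_le_pow₀ hθ
  have h3 : 1 ≤ max σ 1 ^ (n + 2) := one_le_pow₀ hσ
  have h4 : 1 ≤ (1 + 4 * max σ 1) ^ 2 := one_le_pow₀ (by linarith)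
  unfold diagonalConstant
  refine one_le_mul_of_one_le_of_one_le h1 (one_le_mul_of_one_le_of_one_le
    (one_le_mul_of_one_le_of_one_le ?_ h3) h4)
  linarith

theorem diagonal_le {σ θ : ℝ} (hσ : D.M.ShapeRegular σ) (hθ : D.P.AnisotropyBound θ)
    (w : D.W) {s : D.G.Sub} (c : D.M.Cell s) :
    ∑ k, normalTrace (D.M.simplex c) k (D.flux w s c) *
        normalTrace (D.M.simplex c) k (D.flux w s c) *
        cellProduct (D.M.simplex c) (D.P.K s)
          (rtBasis (D.M.simplex c) k) (rtBasis (D.M.simplex c) k) ≤ diagonalConstant n σ θ *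
      cellProduct (D.M.simplex c) (D.P.K s) (D.flux w s c) (D.flux w s c) := by
  have hnn := D.flux_product_nonneg w c
  by_cases hd : D.G.dim s = 0
  · have h0 : 0 ≤ diagonalConstant n σ θ := zero_le_one.trans (one_le_diagonalConstant n σ θ)
    refine le_trans (le_of_eq ?_) (mul_nonneg h0 hnn)
    exact Finset.sum_eq_zero fun k _ => by rw [normalTrace_of_eq_zero _ hd, zero_mul, zero_mul]
  · have : NeZero (D.G.dim s) := ⟨hd⟩
    have hle : D.G.dim s ≤ n := by
      rw [← D.G.finrank_plane s]
      simpa using Submodule.finrank_le (D.G.plane s).direction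
    obtain ⟨x, hx, r, hr, hball, hdiam⟩ := hσ s c hd
    have hσ1 : 1 ≤ max σ 1 := le_max_right _ _
    have h1 := diagonal_le_cellProduct_self (T := D.M.simplex c) (κ := D.P.K s) (x := x) (r := r)
      (σ := max σ 1) (θ := max θ 1) (by rwa [D.M.span_eq]) hr hσ1
      (by rwa [D.M.span_eq])
      (hdiam.trans (mul_le_mul_of_nonneg_right (le_max_left _ _) hr.le))
      (by rw [D.M.span_eq]; exact D.P.K_tangent s) (D.P.K_symm s) (D.P.K_pos s)
      (le_max_right _ _)
      (by
        rw [D.M.span_eq]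
        intro u hu v hv hu1 hv1
        have hv0 : v ≠ 0 := fun h => by simp [h] at hv1
        exact (hθ s u hu v hv hu1 hv1).trans
          (mul_le_mul_of_nonneg_right (le_max_left _ _) (D.P.K_pos s v hv0).le))
      (D.flux_fst_mem w c)
    refine h1.trans (mul_le_mul_of_nonneg_right ?_ hnn)
    unfold diagonalConstant
    gcongr

theorem DA_self_le {σ θ : ℝ} (hσ : D.M.ShapeRegular σ) (hθ : D.P.AnisotropyBound θ) (w : D.W) :
    D.DA w w ≤ diagonalConstant n σ θ * D.A w w := by
  rw [A_apply, DA_apply, mul_add, Finset.mul_sum]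
  refine add_le_add (Finset.sum_le_sum fun s _ => ?_) ?_
  · rw [Finset.mul_sum]
    exact Finset.sum_le_sum fun c _ => D.diagonal_le hσ hθ w c
  · exact le_mul_of_one_le_left (D.mortarProduct_self_nonneg w.2) (one_le_diagonalConstant n σ θ)

end Discretization

/-! ### Symmetric positive definite operators -/

section Operators

variable {X Y : Type*} [AddCommGroup X] [Module ℝ X] [AddCommGroup Y] [Module ℝ Y]

theorem apply_inv {T : X →ₗ[ℝ] Y} (hT : Function.Bijective T) (y : Y) : T (inv T y) = y := by
  rw [inv, dif_pos hT]
  exact (LinearEquiv.ofBijective T hT).apply_symm_apply y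

theorem inv_apply {T : X →ₗ[ℝ] Y} (hT : Function.Bijective T) (x : X) : inv T (T x) = x :=
  hT.1 (apply_inv hT _)

theorem bilin_sq_le {β : X →ₗ[ℝ] Module.Dual ℝ X} (hs : ∀ x y, β x y = β y x)
    (hp : ∀ x, x ≠ 0 → 0 < β x x) (x y : X) : β x y ^ 2 ≤ β x x * β y y := by
  refine LinearMap.BilinForm.apply_sq_le_of_symm β (fun x => ?_) ⟨fun x y => hs x y⟩ x y
  by_cases hx : x = 0
  · simp [hx]
  · exact (hp x hx).le

theorem IsSPD.nonneg {H : Module.Dual ℝ X →ₗ[ℝ] X} (hH : IsSPD H) (f : Module.Dual ℝ X) :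
    0 ≤ f (H f) := by
  by_cases hf : f = 0
  · simp [hf]
  · exact (hH.2 f hf).le

theorem IsSPD.sq_le {H : Module.Dual ℝ X →ₗ[ℝ] X} (hH : IsSPD H) (f g : Module.Dual ℝ X) :
    f (H g) ^ 2 ≤ f (H f) * g (H g) :=
  bilin_sq_le (β := (Module.Dual.eval ℝ X) ∘ₗ H) (fun f g => hH.1 g f) hH.2 g f |>.trans_eq
    (mul_comm _ _)

theorem IsSPD.bijective [FiniteDimensional ℝ X] {H : Module.Dual ℝ X →ₗ[ℝ] X} (hH : IsSPD H) :
    Function.Bijective H := by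
  have hinj : Function.Injective H := by
    refine (injective_iff_map_eq_zero H).2 fun f hf => ?_
    by_contra h
    have := hH.2 f h
    rw [hf, map_zero] at this
    exact lt_irrefl _ this
  exact ⟨hinj, (LinearMap.injective_iff_surjective_of_finrank_eq_finrank
    (Subspace.dual_finrank_eq (K := ℝ) (V := X))).1 hinj⟩

theorem isSPD_inv [FiniteDimensional ℝ X] {S : X →ₗ[ℝ] Module.Dual ℝ X}
    (hs : ∀ x y, S x y = S y x) (hp : ∀ x, x ≠ 0 → 0 < S x x) : IsSPD (inv S) := by
  have hb := bijective_of_pos S hp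
  refine ⟨fun f f' => ?_, fun f hf => ?_⟩
  · obtain ⟨x, rfl⟩ := hb.2 f
    obtain ⟨x', rfl⟩ := hb.2 f'
    rw [inv_apply hb, inv_apply hb, hs]
  · obtain ⟨x, rfl⟩ := hb.2 f
    rw [inv_apply hb]
    exact hp x fun h => hf (by rw [h, map_zero])

theorem SpectrallyEquivalent.mono {H S : Module.Dual ℝ X →ₗ[ℝ] X} {c₁ c₂ c₁' c₂' : ℝ}
    (h : SpectrallyEquivalent H S c₁ c₂) (hH : IsSPD H) (h₁ : c₁' ≤ c₁) (h₂ : c₂ ≤ c₂') :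
    SpectrallyEquivalent H S c₁' c₂' := fun f =>
  ⟨(mul_le_mul_of_nonneg_right h₁ (hH.nonneg f)).trans (h f).1,
    (h f).2.trans (mul_le_mul_of_nonneg_right h₂ (hH.nonneg f))⟩

/-- Positivity of the upper constant is not assumed; it is forced by any nonzero vector. -/
theorem SpectrallyEquivalent.pos [FiniteDimensional ℝ X] {H P : Module.Dual ℝ X →ₗ[ℝ] X}
    {c₁ c₂ : ℝ} (h : SpectrallyEquivalent H P c₁ c₂) (hH : IsSPD H) (hc₁ : 0 < c₁) {x : X}
    (hx : x ≠ 0) : 0 < c₂ := by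
  obtain ⟨f, rfl⟩ := hH.bijective.2 x
  have h0 := hH.2 f fun hf => hx (by rw [hf, map_zero])
  have h1 := (mul_pos hc₁ h0).trans_le ((h f).1.trans (h f).2)
  exact pos_of_mul_pos_left h1 h0.le

variable {S : X →ₗ[ℝ] Module.Dual ℝ X} {H : Module.Dual ℝ X →ₗ[ℝ] X} {c₁ c₂ : ℝ}

/-- Inversion of the lower bound, from functionals to vectors. Apply it to the functional `S (H f)`
and use the Cauchy–Schwarz inequality of `H` for this functional and `f`; one factor `S (H f) (H f)`
cancels. -/
theorem SpectrallyEquivalent.lower [FiniteDimensional ℝ X]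
    (h : SpectrallyEquivalent H (inv S) c₁ c₂) (hp : ∀ x, x ≠ 0 → 0 < S x x) (hH : IsSPD H)
    (hc : 0 ≤ c₁) (f : Module.Dual ℝ X) :
    c₁ * S (H f) (H f) ≤ f (H f) := by
  have hb := bijective_of_pos S hp
  by_cases hf : H f = 0
  · simp [hf]
  have h1 := (h (S (H f))).1
  rw [inv_apply hb] at h1
  have h2 := hH.sq_le (S (H f)) f
  have h3 := hp _ hf
  have h4 := hH.nonneg f
  have h5 := mul_le_mul_of_nonneg_left h2 hc
  have h6 := mul_le_mul_of_nonneg_right h1 h4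
  refine le_of_mul_le_mul_left ?_ h3
  nlinarith

/-- Inversion of the upper bound, by the Cauchy–Schwarz inequality of `inv S` for `f` and `S (H f)`;
one factor `f (H f)` cancels. -/
theorem SpectrallyEquivalent.upper [FiniteDimensional ℝ X]
    (h : SpectrallyEquivalent H (inv S) c₁ c₂) (hs : ∀ x y, S x y = S y x)
    (hp : ∀ x, x ≠ 0 → 0 < S x x) (hH : IsSPD H) (hc : 0 ≤ c₂) (f : Module.Dual ℝ X) :
    f (H f) ≤ c₂ * S (H f) (H f) := by
  have hb := bijective_of_pos S hp
  have hP := isSPD_inv hs hp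
  have h1 := (h f).2
  have h2 := hP.sq_le f (S (H f))
  rw [inv_apply hb] at h2
  have h4 := hH.nonneg f
  by_cases hf : f (H f) = 0
  · rw [hf]
    refine mul_nonneg hc ?_
    by_cases h0 : H f = 0
    · simp [h0]
    · exact (hp _ h0).le
  have h5 : 0 < f (H f) := lt_of_le_of_ne h4 (Ne.symm hf)
  have h6 : 0 ≤ S (H f) (H f) := by
    by_cases h0 : H f = 0
    · simp [h0]
    · exact (hp _ h0).le
  have h7 := mul_le_mul_of_nonneg_right h1 h6
  refine le_of_mul_le_mul_left ?_ h5
  nlinarith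

/-- A bound for the condition number from two-sided bounds. -/
theorem condNumber_le [FiniteDimensional ℝ X] {N : X → ℝ} (hN : ∀ x, x ≠ 0 → 0 < N x)
    {T : X →ₗ[ℝ] X} (hT : Function.Bijective T) {a b c d : ℝ} (ha : 0 < a) (hb : 0 < b)
    (hd : 0 < d) (h1 : ∀ x, a * N (T x) ≤ b * N x) (h2 : ∀ x, d * N x ≤ c * N (T x)) :
    condNumber N T ≤ ENNReal.ofReal (b * c / (d * a)) := by
  have hT1 : opNorm N T ≤ ENNReal.ofReal (b / a) := by
    refine iSup_le fun x => ENNReal.ofReal_le_ofReal ?_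
    rw [div_le_div_iff₀ (hN x x.2) ha, mul_comm]
    exact h1 x
  have hT2 : opNorm N (inv T) ≤ ENNReal.ofReal (c / d) := by
    refine iSup_le fun x => ENNReal.ofReal_le_ofReal ?_
    rw [div_le_div_iff₀ (hN x x.2) hd, mul_comm]
    have := h2 (inv T x)
    rwa [apply_inv hT] at this
  refine (mul_le_mul' hT1 hT2).trans (le_of_eq ?_)
  rw [← ENNReal.ofReal_mul (by positivity)]
  congr 1
  field_simp

end Operators

namespace Discretization

variable {n : ℕ} (D : Discretization n)

/-! ### The Schur complement and the weighted norm -/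

theorem bijective_A : Function.Bijective D.A := bijective_of_pos D.A fun _ => D.A_self_pos

theorem bijective_DA : Function.Bijective D.DA := bijective_of_pos D.DA fun _ => D.DA_self_pos

theorem DA_grad (q : D.Q) : D.DA (D.grad q) = D.BT q := apply_inv D.bijective_DA _

/-- Identifies the pressure part of the weighted norm with the Schur complement form, by which the
norm becomes block diagonal. -/
theorem schur_apply (q q' : D.Q) : D.schur q q' = D.DA (D.grad q') (D.grad q) := by
  rw [DA_grad]
  rfl

theorem schur_comm (q q' : D.Q) : D.schur q q' = D.schur q' q := by
  rw [schur_apply, schur_apply, DA_comm]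

theorem schur_self_pos {q : D.Q} (hq : q ≠ 0) : 0 < D.schur q q := by
  rw [schur_apply]
  refine D.DA_self_pos fun h => hq (D.injective_BT ?_)
  rw [← DA_grad, h, map_zero, map_zero]

theorem bijective_schur : Function.Bijective D.schur :=
  bijective_of_pos D.schur fun _ => D.schur_self_pos

/-- The square of the weighted norm. -/
def energy (x : D.W × D.Q) : ℝ := D.A x.1 x.1 + D.schur x.2 x.2

theorem A_self_nonneg (w : D.W) : 0 ≤ D.A w w := by
  by_cases hw : w = 0
  · simp [hw]
  · exact (D.A_self_pos hw).le

theorem DA_self_nonneg (w : D.W) : 0 ≤ D.DA w w := by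
  by_cases hw : w = 0
  · simp [hw]
  · exact (D.DA_self_pos hw).le

theorem schur_self_nonneg (q : D.Q) : 0 ≤ D.schur q q := by
  rw [schur_apply]
  exact D.DA_self_nonneg _

theorem energy_nonneg (x : D.W × D.Q) : 0 ≤ D.energy x :=
  add_nonneg (D.A_self_nonneg _) (D.schur_self_nonneg _)

theorem energy_pos {x : D.W × D.Q} (hx : x ≠ 0) : 0 < D.energy x := by
  by_cases h1 : x.1 = 0
  · have h2 : x.2 ≠ 0 := fun h2 => hx (Prod.ext h1 h2)
    exact add_pos_of_nonneg_of_pos (D.A_self_nonneg _) (D.schur_self_pos h2)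
  · exact add_pos_of_pos_of_nonneg (D.A_self_pos h1) (D.schur_self_nonneg _)

theorem tripleNorm_eq (x : D.W × D.Q) : D.tripleNorm x = Real.sqrt (D.energy x) := by
  rw [tripleNorm, energy, schur_apply]

theorem tripleNorm_sq (x : D.W × D.Q) : D.tripleNorm x ^ 2 = D.energy x := by
  rw [tripleNorm_eq, Real.sq_sqrt (D.energy_nonneg x)]

theorem tripleNorm_nonneg (x : D.W × D.Q) : 0 ≤ D.tripleNorm x := Real.sqrt_nonneg _

theorem tripleNorm_pos {x : D.W × D.Q} (hx : x ≠ 0) : 0 < D.tripleNorm x := by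
  rw [tripleNorm_eq]
  exact Real.sqrt_pos.2 (D.energy_pos hx)

theorem A_sq_le (w r : D.W) : D.A w r ^ 2 ≤ D.A w w * D.A r r :=
  bilin_sq_le D.A_comm (fun _ => D.A_self_pos) w r

theorem DA_sq_le (w r : D.W) : D.DA w r ^ 2 ≤ D.DA w w * D.DA r r :=
  bilin_sq_le D.DA_comm (fun _ => D.DA_self_pos) w r

theorem form_comm (x y : D.W × D.Q) : D.form x y = D.form y x := by
  simp only [form]
  rw [D.A_comm]
  ring

/-! ### Uniform well-posedness -/

/-- The term a costs 1. Each coupling term is a product in a^D, where passing from a^D to a on the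
flux costs `√C`, bounded by `C`. -/
theorem abs_form_le {C : ℝ} (hC : 1 ≤ C) (h : ∀ w, D.DA w w ≤ C * D.A w w) (x y : D.W × D.Q) :
    |D.form x y| ≤ (1 + 2 * C) * D.tripleNorm x * D.tripleNorm y := by
  have hx := D.tripleNorm_nonneg x
  have hy := D.tripleNorm_nonneg y
  have hA : ∀ z : D.W × D.Q, D.A z.1 z.1 ≤ D.tripleNorm z ^ 2 := fun z => by
    rw [tripleNorm_sq]
    exact le_add_of_nonneg_right (D.schur_self_nonneg _)
  have hS : ∀ z : D.W × D.Q, D.DA (D.grad z.2) (D.grad z.2) ≤ D.tripleNorm z ^ 2 := fun z => by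
    rw [tripleNorm_sq, ← schur_apply]
    exact le_add_of_nonneg_left (D.A_self_nonneg _)
  have h1 : |D.A x.1 y.1| ≤ D.tripleNorm x * D.tripleNorm y := by
    refine abs_le_of_sq_le_sq ((D.A_sq_le _ _).trans ?_) (by positivity)
    rw [mul_pow]
    exact mul_le_mul (hA x) (hA y) (D.A_self_nonneg _) (by positivity)
  have h2 : ∀ u v : D.W × D.Q,
      |D.DA (D.grad u.2) v.1| ≤ C * (D.tripleNorm u * D.tripleNorm v) := by
    intro u v
    have hu := D.tripleNorm_nonneg u
    have hv := D.tripleNorm_nonneg v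
    refine abs_le_of_sq_le_sq ((D.DA_sq_le _ _).trans ?_) (by positivity)
    calc D.DA (D.grad u.2) (D.grad u.2) * D.DA v.1 v.1
        ≤ D.tripleNorm u ^ 2 * (C * D.tripleNorm v ^ 2) :=
          mul_le_mul (hS u) ((h v.1).trans (mul_le_mul_of_nonneg_left (hA v) (by linarith)))
            (D.DA_self_nonneg _) (by positivity)
      _ = C * (D.tripleNorm u * D.tripleNorm v) ^ 2 := by ring
      _ ≤ C ^ 2 * (D.tripleNorm u * D.tripleNorm v) ^ 2 :=
          mul_le_mul_of_nonneg_right (le_self_pow₀ hC two_ne_zero) (sq_nonneg _)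
      _ = _ := by ring
  have h3 := h2 x y
  have h4 := h2 y x
  have h5 := abs_add_le (D.A x.1 y.1 + D.DA (D.grad x.2) y.1) (D.DA (D.grad y.2) x.1)
  have h6 := abs_add_le (D.A x.1 y.1) (D.DA (D.grad x.2) y.1)
  rw [form]
  linarith

/-- The test function is (r + δ D_h q, -q) for y = (r, q): the coupling of r and q cancels, leaving
a(r, r) + δ a(D_h q, r) + δ a^D(D_h q, D_h q). The mixed term is absorbed by half of the other two.
-/
theorem exists_form_ge (y : D.W × D.Q) (hy : y ≠ 0) : ∃ x : D.W × D.Q, x ≠ 0 ∧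
    1 / (4 * (n + 1) : ℝ) * (D.tripleNorm x * D.tripleNorm y) ≤ D.form x y := by
  -- Chosen such that δ a(D_h q, D_h q) ≤ a^D(D_h q, D_h q).
  set δ : ℝ := 1 / (n + 1) with hδ
  have hn : (0 : ℝ) < n + 1 := by positivity
  have hδ0 : 0 < δ := by positivity
  have hδ1 : δ ≤ 1 := by
    rw [hδ, div_le_one hn]
    simp
  have hδn : δ * (n + 1) = 1 := by rw [hδ]; field_simp
  set g := D.grad y.2 with hg
  set a := D.A y.1 y.1 with ha
  set d := D.DA g g with hd
  set e := D.A g y.1 with he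
  have ha0 : 0 ≤ a := D.A_self_nonneg _
  have hd0 : 0 ≤ d := D.DA_self_nonneg _
  have hgg : D.A g g ≤ (n + 1) * d := D.A_self_le g
  have hgg0 : 0 ≤ D.A g g := D.A_self_nonneg g
  have hδgg : δ * D.A g g ≤ d := by
    calc δ * D.A g g ≤ δ * ((n + 1) * d) := mul_le_mul_of_nonneg_left hgg hδ0.le
      _ = d := by rw [← mul_assoc, hδn, one_mul]
  have he2 : (δ * e) ^ 2 ≤ δ * (d * a) := by
    have h1 : e ^ 2 ≤ D.A g g * a := D.A_sq_le g y.1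
    calc (δ * e) ^ 2 = δ * (δ * e ^ 2) := by ring
      _ ≤ δ * (δ * (D.A g g * a)) := by gcongr
      _ = δ * (δ * D.A g g * a) := by ring
      _ ≤ δ * (d * a) := by gcongr
  have habs : |δ * e| ≤ (a + δ * d) / 2 := by
    refine abs_le_of_sq_le_sq (he2.trans ?_) (by positivity)
    nlinarith [sq_nonneg (a - δ * d)]
  obtain ⟨hlow, hup⟩ := abs_le.1 habs
  refine ⟨(y.1 + δ • g, -y.2), fun h0 => hy ?_, ?_⟩
  · have h2 : y.2 = 0 := by simpa using congrArg Prod.snd h0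
    have h1 : y.1 + δ • g = 0 := congrArg Prod.fst h0
    rw [hg, h2, map_zero, smul_zero, add_zero] at h1
    exact Prod.ext h1 h2
  · have hform : D.form (y.1 + δ • g, -y.2) y = a + δ * e + δ * d := by
      simp only [form, map_add, map_neg, map_smul, LinearMap.add_apply, LinearMap.neg_apply,
        LinearMap.smul_apply, smul_eq_mul]
      rw [← hg, ← ha, ← hd, ← he]
      ring
    have hy2 : D.tripleNorm y ^ 2 = a + d := by rw [tripleNorm_sq, energy, schur_apply]
    -- Together with the lower bound `(a + δ * d) / 2` for the form, this factor 2 yields the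
    -- constant `δ / 4`.
    have hx2 : D.tripleNorm (y.1 + δ • g, -y.2) ^ 2 ≤ (2 * D.tripleNorm y) ^ 2 := by
      rw [mul_pow, hy2, tripleNorm_sq, energy, schur_apply]
      simp only [map_add, map_neg, map_smul, LinearMap.add_apply, LinearMap.neg_apply,
        LinearMap.smul_apply, smul_eq_mul, neg_neg]
      rw [D.A_comm y.1 g, ← hg, ← ha, ← hd, ← he]
      nlinarith [mul_le_mul_of_nonneg_left hδgg hδ0.le]
    have hx := abs_le_of_sq_le_sq hx2 (by have := D.tripleNorm_nonneg y; positivity)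
    have hx' : D.tripleNorm (y.1 + δ • g, -y.2) ≤ 2 * D.tripleNorm y := (le_abs_self _).trans hx
    rw [hform]
    have hy0 := D.tripleNorm_nonneg y
    calc 1 / (4 * (n + 1) : ℝ) * (D.tripleNorm (y.1 + δ • g, -y.2) * D.tripleNorm y)
        ≤ 1 / (4 * (n + 1) : ℝ) * (2 * D.tripleNorm y * D.tripleNorm y) := by gcongr
      _ = δ / 2 * D.tripleNorm y ^ 2 := by rw [hδ]; field_simp; ring
      _ = δ / 2 * a + δ / 2 * d := by rw [hy2]; ring
      _ ≤ a + δ * e + δ * d := by nlinarith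

theorem wellPosed_of_le {C : ℝ} (hC : 1 ≤ C) (h : ∀ w, D.DA w w ≤ C * D.A w w) :
    D.WellPosed (1 + 2 * C) (1 / (4 * (n + 1))) := by
  refine ⟨D.abs_form_le hC h, fun y hy => ?_⟩
  obtain ⟨x, hx, hxy⟩ := D.exists_form_ge y hy
  have hy0 := D.tripleNorm_pos hy
  -- A real supremum is meaningful only for a bounded family; continuity of the form supplies the
  -- bound.
  refine le_ciSup_of_le ⟨1 + 2 * C, ?_⟩ ⟨x, hx⟩ ?_
  · rintro _ ⟨z, rfl⟩
    change D.form z.1 y / (D.tripleNorm z.1 * D.tripleNorm y) ≤ 1 + 2 * C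
    rw [div_le_iff₀ (mul_pos (D.tripleNorm_pos z.2) hy0), ← mul_assoc]
    exact (le_abs_self _).trans (D.abs_form_le hC h z.1 y)
  · rwa [le_div_iff₀ (mul_pos (D.tripleNorm_pos hx) hy0)]

/-! ### Preconditioning -/

/-- The square of the norm of a functional that is dual to the weighted norm. -/
def dualEnergy (f : Module.Dual ℝ D.W × Module.Dual ℝ D.Q) : ℝ :=
  f.1 (inv D.A f.1) + f.2 (inv D.schur f.2)

theorem isSPD_inv_A : IsSPD (inv D.A) := isSPD_inv D.A_comm fun _ => D.A_self_pos

theorem isSPD_inv_schur : IsSPD (inv D.schur) := isSPD_inv D.schur_comm fun _ => D.schur_self_pos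

theorem dualEnergy_nonneg (f : Module.Dual ℝ D.W × Module.Dual ℝ D.Q) : 0 ≤ D.dualEnergy f :=
  add_nonneg (D.isSPD_inv_A.nonneg _) (D.isSPD_inv_schur.nonneg _)

/-- The second row of the block operator carries the sign of `-B`, so the symmetric form is the
pairing with a minus in the pressure component. -/
theorem form_eq_saddle (x y : D.W × D.Q) :
    D.form x y = (D.saddle x).1 y.1 - (D.saddle x).2 y.2 := by
  simp only [form, DA_grad]
  change _ = (D.A x.1 + D.BT x.2) y.1 - (-(D.B x.1)) y.2
  rw [LinearMap.add_apply, LinearMap.neg_apply, sub_neg_eq_add]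
  rfl

/-- Cauchy–Schwarz in each block and then between the blocks. The energies are even in the pressure
component, so the sign is harmless. -/
theorem pairing_sq_le (f : Module.Dual ℝ D.W × Module.Dual ℝ D.Q) (y : D.W × D.Q) :
    (f.1 y.1 - f.2 y.2) ^ 2 ≤ D.dualEnergy f * D.energy y := by
  have h1 := D.isSPD_inv_A.sq_le f.1 (D.A y.1)
  have h2 := D.isSPD_inv_schur.sq_le f.2 (D.schur y.2)
  rw [inv_apply D.bijective_A] at h1
  rw [inv_apply D.bijective_schur] at h2
  have ha := D.isSPD_inv_A.nonneg f.1
  have hb := D.isSPD_inv_schur.nonneg f.2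
  have hc := D.A_self_nonneg y.1
  have hd := D.schur_self_nonneg y.2
  rw [dualEnergy, energy]
  set a := f.1 (inv D.A f.1)
  set b := f.2 (inv D.schur f.2)
  set c := D.A y.1 y.1
  set d := D.schur y.2 y.2
  set u := f.1 y.1
  set v := f.2 y.2
  have h3 : (u * v) ^ 2 ≤ (a * c) * (b * d) := by
    rw [mul_pow]
    exact mul_le_mul h1 h2 (sq_nonneg _) (by positivity)
  have h4 : |u * v| ≤ (a * d + b * c) / 2 := by
    refine abs_le_of_sq_le_sq (h3.trans ?_) (by positivity)
    nlinarith [sq_nonneg (a * d - b * c)]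
  have h5 := neg_abs_le (u * v)
  nlinarith

/-- Test with the Riesz representative of `D.saddle x`, its pressure component negated: both the
form and the energy of this vector equal the dual energy. -/
theorem dualEnergy_saddle_le {α : ℝ}
    (h : ∀ x y, |D.form x y| ≤ α * D.tripleNorm x * D.tripleNorm y) (x : D.W × D.Q) :
    D.dualEnergy (D.saddle x) ≤ α ^ 2 * D.energy x := by
  set f := D.saddle x with hf
  set y : D.W × D.Q := (inv D.A f.1, -inv D.schur f.2) with hy
  have h1 : D.form x y = D.dualEnergy f := by
    rw [form_eq_saddle, ← hf, hy, dualEnergy, map_neg, sub_neg_eq_add]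
  have h2 : D.energy y = D.dualEnergy f := by
    simp only [energy, hy, map_neg, LinearMap.neg_apply, neg_neg]
    rw [apply_inv D.bijective_A, apply_inv D.bijective_schur, dualEnergy]
  have h3 := h x y
  rw [h1, abs_of_nonneg (D.dualEnergy_nonneg f)] at h3
  have h4 := D.tripleNorm_sq y
  rw [h2] at h4
  have hx := D.tripleNorm_nonneg x
  rcases (D.tripleNorm_nonneg y).eq_or_lt with h0 | h0
  · rw [← h4, ← h0]
    have := mul_nonneg (sq_nonneg α) (D.energy_nonneg x)
    simpa using this
  · have h5 : D.tripleNorm y ≤ α * D.tripleNorm x := by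
      refine le_of_mul_le_mul_right ?_ h0
      rw [← h4] at h3
      linarith
    rw [← h4, ← D.tripleNorm_sq x, ← mul_pow]
    exact pow_le_pow_left₀ h0.le h5 2

/-- The form is symmetric, so the inf-sup condition may be applied with the roles of its arguments
exchanged. Each quotient in the supremum is at most the dual norm of `D.saddle x` over the norm of
`x`. -/
theorem le_dualEnergy_saddle {β : ℝ} (hβ : 0 < β)
    (h : ∀ y, y ≠ 0 → β ≤ ⨆ x : {x : D.W × D.Q // x ≠ 0},
      D.form x y / (D.tripleNorm x * D.tripleNorm y)) (x : D.W × D.Q) :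
    β ^ 2 * D.energy x ≤ D.dualEnergy (D.saddle x) := by
  by_cases hx : x = 0
  · simp [hx, energy, dualEnergy]
  have hx0 := D.tripleNorm_pos hx
  have hne : Nonempty {x : D.W × D.Q // x ≠ 0} := ⟨⟨x, hx⟩⟩
  set r := Real.sqrt (D.dualEnergy (D.saddle x)) with hr
  have hr2 : r ^ 2 = D.dualEnergy (D.saddle x) := Real.sq_sqrt (D.dualEnergy_nonneg _)
  have h1 : β ≤ r / D.tripleNorm x := by
    refine (h x hx).trans (ciSup_le fun y => ?_)
    have hy0 := D.tripleNorm_pos y.2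
    rw [div_le_div_iff₀ (mul_pos hy0 hx0) hx0, ← mul_assoc]
    refine mul_le_mul_of_nonneg_right ?_ hx0.le
    rw [form_comm, form_eq_saddle]
    refine (le_abs_self _).trans (abs_le_of_sq_le_sq ((D.pairing_sq_le _ _).trans_eq ?_)
      (mul_nonneg (Real.sqrt_nonneg _) hy0.le))
    rw [mul_pow, hr2, tripleNorm_sq]
  rw [le_div_iff₀ hx0] at h1
  rw [← hr2, ← tripleNorm_sq, ← mul_pow]
  exact pow_le_pow_left₀ (mul_pos hβ hx0).le h1 2

section Preconditioner

variable {D} {Hw : Module.Dual ℝ D.W →ₗ[ℝ] D.W} {Hp : Module.Dual ℝ D.Q →ₗ[ℝ] D.Q}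

theorem bijective_blockDiag (hHw : IsSPD Hw) (hHp : IsSPD Hp) :
    Function.Bijective (D.blockDiag Hw Hp) :=
  hHw.bijective.prodMap hHp.bijective

/-- The square of the norm induced by a preconditioner. -/
def precondEnergy (D : Discretization n) (Hw : Module.Dual ℝ D.W →ₗ[ℝ] D.W)
    (Hp : Module.Dual ℝ D.Q →ₗ[ℝ] D.Q) (f : Module.Dual ℝ D.W × Module.Dual ℝ D.Q) : ℝ :=
  f.1 (Hw f.1) + f.2 (Hp f.2)

theorem precondNorm_blockDiag (hHw : IsSPD Hw) (hHp : IsSPD Hp)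
    (f : Module.Dual ℝ D.W × Module.Dual ℝ D.Q) :
    D.precondNorm (D.blockDiag Hw Hp) (D.blockDiag Hw Hp f) =
      Real.sqrt (precondEnergy D Hw Hp f) := by
  rw [precondNorm, inv_apply (bijective_blockDiag hHw hHp)]
  rfl

variable {c₁ c₂ : ℝ}

theorem precondEnergy_bounds (hw : SpectrallyEquivalent Hw (inv D.A) c₁ c₂)
    (hp : SpectrallyEquivalent Hp (inv D.schur) c₁ c₂)
    (f : Module.Dual ℝ D.W × Module.Dual ℝ D.Q) :
    c₁ * precondEnergy D Hw Hp f ≤ D.dualEnergy f ∧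
      D.dualEnergy f ≤ c₂ * precondEnergy D Hw Hp f := by
  rw [precondEnergy, dualEnergy, mul_add, mul_add]
  exact ⟨add_le_add (hw f.1).1 (hp f.2).1, add_le_add (hw f.1).2 (hp f.2).2⟩

theorem energy_blockDiag_bounds (hHw : IsSPD Hw) (hHp : IsSPD Hp) (hc₁ : 0 ≤ c₁) (hc₂ : 0 ≤ c₂)
    (hw : SpectrallyEquivalent Hw (inv D.A) c₁ c₂)
    (hp : SpectrallyEquivalent Hp (inv D.schur) c₁ c₂)
    (f : Module.Dual ℝ D.W × Module.Dual ℝ D.Q) :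
    c₁ * D.energy (D.blockDiag Hw Hp f) ≤ precondEnergy D Hw Hp f ∧
      precondEnergy D Hw Hp f ≤ c₂ * D.energy (D.blockDiag Hw Hp f) := by
  have hb : D.blockDiag Hw Hp f = (Hw f.1, Hp f.2) := rfl
  rw [precondEnergy, energy, hb, mul_add, mul_add]
  exact ⟨add_le_add (hw.lower (fun _ => D.A_self_pos) hHw hc₁ f.1)
      (hp.lower (fun _ => D.schur_self_pos) hHp hc₁ f.2),
    add_le_add (hw.upper D.A_comm (fun _ => D.A_self_pos) hHw hc₂ f.1)
      (hp.upper D.schur_comm (fun _ => D.schur_self_pos) hHp hc₂ f.2)⟩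

theorem mul_sqrt_le_mul_sqrt {a b u v : ℝ} (ha : 0 ≤ a) (hb : 0 ≤ b)
    (h : a ^ 2 * u ≤ b ^ 2 * v) : a * Real.sqrt u ≤ b * Real.sqrt v := by
  have h1 := Real.sqrt_le_sqrt h
  rwa [Real.sqrt_mul (sq_nonneg a), Real.sqrt_mul (sq_nonneg b), Real.sqrt_sq ha,
    Real.sqrt_sq hb] at h1

/-- The condition number of the preconditioned saddle point operator, with common constants for
both blocks. -/
theorem preconditioned_saddle {α β : ℝ} (hα : 0 < α) (hβ : 0 < β) (hwp : D.WellPosed α β)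
    (hHw : IsSPD Hw) (hHp : IsSPD Hp) (hc₁ : 0 < c₁)
    (hw : SpectrallyEquivalent Hw (inv D.A) c₁ c₂)
    (hp : SpectrallyEquivalent Hp (inv D.schur) c₁ c₂) :
    Function.Bijective (D.blockDiag Hw Hp ∘ₗ D.saddle) ∧
      condNumber D.tripleNorm (D.blockDiag Hw Hp ∘ₗ D.saddle) ≤
        ENNReal.ofReal (α * c₂ / (β * c₁)) ∧
      condNumber (D.precondNorm (D.blockDiag Hw Hp)) (D.blockDiag Hw Hp ∘ₗ D.saddle) ≤
        ENNReal.ofReal (α * c₂ / (β * c₁)) := by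
  have hMb := bijective_blockDiag hHw hHp
  have hup := D.dualEnergy_saddle_le hwp.1
  have hlow := D.le_dualEnergy_saddle hβ hwp.2
  have hbij : Function.Bijective (D.blockDiag Hw Hp ∘ₗ D.saddle) := by
    have hinj : Function.Injective (D.blockDiag Hw Hp ∘ₗ D.saddle) := by
      refine (injective_iff_map_eq_zero _).2 fun x hx => ?_
      have h0 : D.saddle x = 0 := hMb.1 (by rw [map_zero]; exact hx)
      by_contra hne
      have h1 := hlow x
      rw [h0] at h1
      have h2 : D.dualEnergy 0 = 0 := by simp [dualEnergy]
      have h3 := mul_pos (pow_pos hβ 2) (D.energy_pos hne)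
      linarith
    exact ⟨hinj, LinearMap.injective_iff_surjective.1 hinj⟩
  refine ⟨hbij, ?_⟩
  -- On the zero space `c₂` may have any sign, but operator norms are suprema over the empty set,
  -- hence 0. Otherwise `c₂` is positive.
  rcases subsingleton_or_nontrivial (D.W × D.Q) with hsub | hnt
  · have h0 : ∀ (N : D.W × D.Q → ℝ) T, condNumber N T = 0 := by
      intro N T
      have : IsEmpty {x : D.W × D.Q // x ≠ 0} := ⟨fun x => x.2 (Subsingleton.elim _ _)⟩
      simp [condNumber, opNorm]
    rw [h0, h0]
    exact ⟨bot_le, bot_le⟩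
  have hc₂ : 0 < c₂ := by
    obtain ⟨x, hx⟩ := exists_ne (0 : D.W × D.Q)
    by_cases h1 : x.1 = 0
    · exact hp.pos hHp hc₁ (x := x.2) fun h2 => hx (Prod.ext h1 h2)
    · exact hw.pos hHw hc₁ h1
  have hpre := precondEnergy_bounds hw hp
  have hen := energy_blockDiag_bounds hHw hHp hc₁.le hc₂.le hw hp
  constructor
  · refine condNumber_le (fun x hx => D.tripleNorm_pos hx) hbij hc₁ hα hβ (fun x => ?_) fun x => ?_
    · rw [tripleNorm_eq, tripleNorm_eq]
      refine mul_sqrt_le_mul_sqrt hc₁.le hα.le ?_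
      have h1 := (hen (D.saddle x)).1
      have h2 := (hpre (D.saddle x)).1
      have h3 := hup x
      have h4 := mul_le_mul_of_nonneg_left h1 hc₁.le
      rw [LinearMap.comp_apply, pow_two c₁, mul_assoc]
      linarith
    · rw [tripleNorm_eq, tripleNorm_eq]
      refine mul_sqrt_le_mul_sqrt hβ.le hc₂.le ?_
      have h1 := (hen (D.saddle x)).2
      have h2 := (hpre (D.saddle x)).2
      have h3 := hlow x
      have h4 := mul_le_mul_of_nonneg_left h1 hc₂.le
      rw [LinearMap.comp_apply, pow_two c₂, mul_assoc]
      linarith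
  · refine condNumber_le (fun x hx => ?_) hbij hc₁ hα hβ (fun x => ?_) fun x => ?_
    · obtain ⟨f, rfl⟩ := hMb.2 x
      rw [precondNorm_blockDiag hHw hHp]
      have h1 := (hen f).2
      refine Real.sqrt_pos.2 ?_
      have h2 := (hen f).1
      exact (mul_pos hc₁ (D.energy_pos hx)).trans_le h2
    · rw [LinearMap.comp_apply, precondNorm_blockDiag hHw hHp]
      obtain ⟨f, hf⟩ := hMb.2 x
      have h1 := (hen f).1
      have h2 := (hpre (D.saddle x)).1
      have h3 := hup x
      rw [← hf, precondNorm_blockDiag hHw hHp, hf]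
      refine mul_sqrt_le_mul_sqrt hc₁.le hα.le ?_
      rw [hf] at h1
      have h4 := mul_le_mul_of_nonneg_left (h2.trans h3) hc₁.le
      have h5 := mul_le_mul_of_nonneg_left h1 (sq_nonneg α)
      rw [pow_two c₁, mul_assoc]
      linarith
    · rw [LinearMap.comp_apply, precondNorm_blockDiag hHw hHp]
      obtain ⟨f, hf⟩ := hMb.2 x
      have h1 := (hen f).2
      have h2 := (hpre (D.saddle x)).2
      have h3 := hlow x
      rw [← hf, precondNorm_blockDiag hHw hHp, hf]
      refine mul_sqrt_le_mul_sqrt hβ.le hc₂.le ?_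
      rw [hf] at h1
      have h4 := mul_le_mul_of_nonneg_left (h3.trans h2) hc₂.le
      have h5 := mul_le_mul_of_nonneg_left h1 (sq_nonneg β)
      rw [pow_two c₂, mul_assoc]
      linarith

end Preconditioner

end Discretization

end MixedDim

end

/-! ### Assembly of the theorem -/

theorem mainTheorem5 (n : ℕ) (hn : n = 2 ∨ n = 3) :
    (∀ D : MixedDim.Discretization n,
      Function.Bijective D.A ∧ Function.Bijective D.DA ∧ Function.Bijective D.schur) ∧
    (∀ σ θ : ℝ, ∃ α β : ℝ, 0 < α ∧ 0 < β ∧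
      ∀ D : MixedDim.Discretization n, D.M.ShapeRegular σ → D.P.AnisotropyBound θ →
        D.WellPosed α β) ∧
    (∀ (D : MixedDim.Discretization n) (α β : ℝ), 0 < α → 0 < β → D.WellPosed α β →
      ∀ (Hw : Module.Dual ℝ D.W →ₗ[ℝ] D.W) (Hp : Module.Dual ℝ D.Q →ₗ[ℝ] D.Q)
        (c₁w c₂w c₁p c₂p : ℝ),
        MixedDim.IsSPD Hw → MixedDim.IsSPD Hp →
        0 < c₁w → 0 < c₁p →
        MixedDim.SpectrallyEquivalent Hw (MixedDim.inv D.A) c₁w c₂w →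
        MixedDim.SpectrallyEquivalent Hp (MixedDim.inv D.schur) c₁p c₂p →
        Function.Bijective (D.blockDiag Hw Hp) ∧
        Function.Bijective (D.blockDiag Hw Hp ∘ₗ D.saddle) ∧
        MixedDim.condNumber D.tripleNorm (D.blockDiag Hw Hp ∘ₗ D.saddle) ≤
          ENNReal.ofReal (α * max c₂w c₂p / (β * min c₁w c₁p)) ∧
        MixedDim.condNumber (D.precondNorm (D.blockDiag Hw Hp))
            (D.blockDiag Hw Hp ∘ₗ D.saddle) ≤
          ENNReal.ofReal (α * max c₂w c₂p / (β * min c₁w c₁p))) := by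
  refine ⟨fun D => ⟨D.bijective_A, D.bijective_DA, D.bijective_schur⟩, fun σ θ => ?_, ?_⟩
  · have hC := MixedDim.Discretization.one_le_diagonalConstant n σ θ
    exact ⟨1 + 2 * MixedDim.Discretization.diagonalConstant n σ θ, 1 / (4 * (n + 1)),
      by linarith, by positivity, fun D hσ hθ => D.wellPosed_of_le hC (D.DA_self_le hσ hθ)⟩
  · intro D α β hα hβ hwp Hw Hp c₁w c₂w c₁p c₂p hHw hHp hc₁w hc₁p hw hp
    exact ⟨MixedDim.Discretization.bijective_blockDiag hHw hHp,
      -- Both blocks are brought to common constants by weakening each equivalence to the smaller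
      -- lower and the larger upper one.
      MixedDim.Discretization.preconditioned_saddle hα hβ hwp hHw hHp (lt_min hc₁w hc₁p)
        (hw.mono hHw (min_le_left _ _) (le_max_left _ _))
        (hp.mono hHp (min_le_right _ _) (le_max_right _ _))⟩
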